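/- Notation and definitions. Let $\mathbb N=\{1,2,\dots\}$ and $[n]=\{1,\dots,n\}$. A composition of a finite set $S$ is an ordered sequence $\gamma=(\gamma_1,\dots,\gamma_k)$ of disjoint non-empty subsets of $S$ with union $S$; $\mathcal C_n$ is the (finite) set of compositions of $[n]$, $\mathbf 1_n=([n])$, $\gamma_A$ is the restriction of $\gamma$ to $A\subset S$ (intersect the blocks with $A$, delete the empty ones), and a permutation $\sigma$ acts blockwise. $\mathcal C$ is the projective limit of the $\mathcal C_n$ under restriction, with the product $\sigma$-field; $\gamma_{[n]}\in\mathcal C_n$ is the restriction of $\gamma\in\mathcal C$ and $\mathbf 1_{\mathbb N}=(\mathbf 1_n)_n$. A measure $\mu$ on $\mathcal C$ is exchangeable if $\mu(\delta_{[n]}=\gamma)=\mu(\sigma(\delta_{[n]})=\gamma)$ for all $n$, all permutations $\sigma$ of $[n]$ and all $\gamma\in\mathcal C_n$ (similarly for probability measures on $\mathcal C_n$). A *fragmentation measure* is an exchangeable measure $\mu$ on $\mathcal C$ with $\mu(\{\mathbf 1_{\mathbb N}\})=0$ and $\mu(\gamma_{[n]}\ne\mathbf 1_n)<\infty$ for all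 $n$. For $\gamma=(\gamma_1,\dots,\gamma_k)\in\mathcal C_n$ and $\gamma^{(\cdot)}=(\gamma^{(i)})_{i\in[n]}$ in $\mathcal C_n$, $\mathrm{FRAG}(\gamma,\gamma^{(\cdot)})\in\mathcal C_n$ is obtained by replacing each block $\gamma_i$ by the sequence of blocks of the restriction of $\gamma^{(\min\gamma_i)}$ to $\gamma_i$. A *(time-homogeneous) exchangeable fragmentation process on $\mathcal C_n$* is a Markov process $(X(t))_{t\ge0}$ on $\mathcal C_n$, continuous in probability, with $X(0)=\mathbf 1_n$ a.s., such that for some exchangeable probability measures $(p_r)_{r>0}$ on $\mathcal C_n$, for all $t\ge0$, $r>0$, the conditional law of $X(t+r)$ given $X(t)=\gamma$ is the law of $\mathrm{FRAG}(\gamma,\gamma^{(\cdot)})$ with $\gamma^{(1)},\dots,\gamma^{(n)}$ i.i.d. of law $p_r$. A *c-fragmentation* is a Markov process $(\Gamma(t))_{t\ge 0}$ on $\mathcal C$ such that, for every $n$, $(\Gamma_{[n]}(t))_{t\ge0}$ is such a process on $\mathcal C_n$. A measure $\mu$ on $\mathcal C$ is *the measure of* $\Gamma$ if it is exchangeable,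 $\mu(\{\mathbf 1_{\mathbb N}\})=0$, and for all $n$ and $\gamma\in\mathcal C_n\setminus\{\mathbf 1_n\}$ $$\mu(\{\delta\in\mathcal C:\delta_{[n]}=\gamma\})=q_\gamma:=\lim_{s\to0+}\tfrac1s\,\mathbb P(\Gamma_{[n]}(s)=\gamma)$$ (in particular the limit exists). The law of a process is its law on $\mathcal C^{[0,\infty)}$ with the product $\sigma$-field. **Proposition (Poissonian construction).** (1) Let $\mu$ be a fragmentation measure. There is a Poisson random measure on $\mathbb R_+\times\mathcal C\times\mathbb N$ with intensity $dt\otimes\mu\otimes\sharp$ ($\sharp$ the counting measure on $\mathbb N$). Let $M$ be any such Poisson random measure, on any probability space. For each $n$, consider the paths in $\mathcal C_n$ that start from $\mathbf 1_n$, are right continuous and piecewise constant, jump only at times $s>0$ for which $M$ has an atom $(s,\gamma,k)$ with $\gamma_{[n]}\ne\mathbf 1_n$ and $k\le n$, and at the time of each such atom satisfy $$\Gamma_{[n]}(s)=\mathrm{FRAG}\big(\Gamma_{[n]}(s-),\Delta^{(\cdot)}_n(\gamma,k)\big),\qquad \Delta_n^{(k)}(\gamma,k)=\gamma_{[n]},\quad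 \Delta_n^{(i)}(\gamma,k)=\mathbf 1_n\ (i\neq k).$$ Almost surely, for every $n$ there is exactly one such path, and these paths are the restrictions of a unique path in $\mathcal C$. The process $\Gamma$ on $\mathcal C$ so defined (it has a version for which every $\Gamma(t)$ is measurable) is a c-fragmentation, and $\mu$ is the measure of $\Gamma$. (2) Every c-fragmentation has exactly one measure; it depends only on the law of the c-fragmentation and is a fragmentation measure; and the map sending the law of a c-fragmentation to its measure is a bijection from the set of laws of c-fragmentations onto the set of fragmentation measures. -/

import Mathlib

open MeasureTheory ProbabilityTheory Filter Topology
open scoped NNReal ENNReal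

universe u

noncomputable section

namespace CFrag

/-! ## Compositions. Here ℕ is `{1, 2, …}`, i.e. `ℕ+`. -/

/-- The set `[n] = {1, …, n}`. -/
abbrev seg (n : ℕ+) : Finset ℕ+ := Finset.Icc 1 n

/-- A composition of a finite set `S`: an ordered sequence of disjoint, non-empty subsets of `S`
with union `S`. -/
@[ext]
structure Comp (S : Finset ℕ+) where
  blocks : List (Finset ℕ+)
  nonempty : ∀ A ∈ blocks, A.Nonempty
  disjoint : blocks.Pairwise Disjoint
  mem_iff : ∀ i, i ∈ S ↔ ∃ A ∈ blocks, i ∈ A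

/-- The blocks intersected with `A`, in the same order, the empty ones being deleted. -/
def restrictBlocks (A : Finset ℕ+) (l : List (Finset ℕ+)) : List (Finset ℕ+) :=
  (l.map (fun B => B ∩ A)).filter (fun B => B ≠ ∅)

theorem mem_restrictBlocks {A : Finset ℕ+} {l : List (Finset ℕ+)} {C : Finset ℕ+} :
    C ∈ restrictBlocks A l ↔ (∃ B ∈ l, B ∩ A = C) ∧ C.Nonempty := by
  simp [restrictBlocks, Finset.nonempty_iff_ne_empty]

theorem restrictBlocks_pairwise {A : Finset ℕ+} {l : List (Finset ℕ+)}
    (h : l.Pairwise Disjoint) : (restrictBlocks A l).Pairwise Disjoint := by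
  refine List.Pairwise.filter _ ?_
  rw [List.pairwise_map]
  exact h.imp (fun hab => hab.mono Finset.inter_subset_left Finset.inter_subset_left)

namespace Comp

variable {S : Finset ℕ+}

theorem block_subset (γ : Comp S) {A : Finset ℕ+} (hA : A ∈ γ.blocks) : A ⊆ S :=
  fun i hi => (γ.mem_iff i).2 ⟨A, hA, hi⟩

theorem min'_mem (γ : Comp S) {A : Finset ℕ+} (hA : A ∈ γ.blocks) :
    A.min' (γ.nonempty A hA) ∈ S :=
  γ.block_subset hA (A.min'_mem _)

/-- The composition with a single non-empty block. -/
def one (S : Finset ℕ+) (hS : S.Nonempty) : Comp S where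
  blocks := [S]
  nonempty := by simpa using hS
  disjoint := List.pairwise_singleton _ _
  mem_iff := by simp

/-- The restriction `γ_A` of a composition to a subset `A`. -/
def restrict (γ : Comp S) {A : Finset ℕ+} (hA : A ⊆ S) : Comp A where
  blocks := restrictBlocks A γ.blocks
  nonempty := fun _ hB => (mem_restrictBlocks.1 hB).2
  disjoint := restrictBlocks_pairwise γ.disjoint
  mem_iff := by
    intro i
    constructor
    · intro hi
      obtain ⟨B, hB, hiB⟩ := (γ.mem_iff i).1 (hA hi)
      have hm : i ∈ B ∩ A := Finset.mem_inter.2 ⟨hiB, hi⟩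
      exact ⟨B ∩ A, mem_restrictBlocks.2 ⟨⟨B, hB, rfl⟩, ⟨i, hm⟩⟩, hm⟩
    · rintro ⟨C, hC, hi⟩
      obtain ⟨⟨B, -, rfl⟩, -⟩ := mem_restrictBlocks.1 hC
      exact (Finset.mem_inter.1 hi).2

/-- The image `σ(γ) = (σ(γ_1), …, σ(γ_k))` under a permutation `σ` of `S`. -/
def perm (σ : Equiv.Perm S) (γ : Comp S) : Comp S where
  blocks := γ.blocks.map (fun A => A.map (Equiv.Perm.ofSubtype σ).toEmbedding)
  nonempty := by
    intro B hB
    obtain ⟨A, hA, rfl⟩ := List.mem_map.1 hB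
    exact (γ.nonempty A hA).map
  disjoint := by
    rw [List.pairwise_map]
    exact γ.disjoint.imp (fun h => (Finset.disjoint_map _).2 h)
  mem_iff := by
    have key : ∀ j, j ∈ S ↔ Equiv.Perm.ofSubtype σ j ∈ S := by
      intro j
      by_cases hj : j ∈ S
      · simp [hj, Equiv.Perm.ofSubtype_apply_of_mem σ hj]
      · simp [hj, Equiv.Perm.ofSubtype_apply_of_not_mem σ hj]
    intro i
    obtain ⟨j, rfl⟩ := (Equiv.Perm.ofSubtype σ).surjective i
    rw [← key, γ.mem_iff]
    simp

/-- `FRAG(γ, δ)`: each block `γ_i`, with least element `m_i`, is replaced by the sequence of the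
blocks of the restriction of `δ^(m_i)` to `γ_i`. -/
def frag (γ : Comp S) (δ : S → Comp S) : Comp S where
  blocks := γ.blocks.attach.flatMap (fun A =>
    ((δ ⟨A.1.min' (γ.nonempty A.1 A.2), γ.min'_mem A.2⟩).restrict (γ.block_subset A.2)).blocks)
  nonempty := by
    intro B hB
    obtain ⟨A, -, hB⟩ := List.mem_flatMap.1 hB
    exact Comp.nonempty _ B hB
  disjoint := by
    rw [List.pairwise_flatMap]
    refine ⟨fun A _ => Comp.disjoint _, ?_⟩
    have h : γ.blocks.attach.Pairwise (fun A B => Disjoint A.1 B.1) := by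
      have h' := γ.disjoint
      rw [← List.attach_map_subtype_val γ.blocks, List.pairwise_map] at h'
      exact h'
    refine h.imp ?_
    intro A B hAB C hC D hD
    exact hAB.mono (Comp.block_subset _ hC) (Comp.block_subset _ hD)
  mem_iff := by
    intro i
    constructor
    · intro hi
      obtain ⟨A, hA, hiA⟩ := (γ.mem_iff i).1 hi
      obtain ⟨C, hC, hiC⟩ := (((δ ⟨A.min' (γ.nonempty A hA), γ.min'_mem hA⟩).restrict
        (γ.block_subset hA)).mem_iff i).1 hiA
      exact ⟨C, List.mem_flatMap.2 ⟨⟨A, hA⟩, List.mem_attach _ _, hC⟩, hiC⟩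
    · rintro ⟨C, hC, hi⟩
      obtain ⟨A, -, hC⟩ := List.mem_flatMap.1 hC
      exact γ.block_subset A.2 (Comp.block_subset _ hC hi)

end Comp

/-- The (discrete) σ-algebra on the finite set of compositions of `S`. -/
instance (S : Finset ℕ+) : MeasurableSpace (Comp S) := ⊤

/-- `𝒞_n`, the set of compositions of `[n]`. -/
abbrev CFin (n : ℕ+) : Type := Comp (seg n)

theorem seg_nonempty (n : ℕ+) : (seg n).Nonempty := ⟨1, by simp⟩

theorem seg_subset {m n : ℕ+} (h : m ≤ n) : seg m ⊆ seg n := Finset.Icc_subset_Icc_right h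

/-- `𝟏_n`, the composition of `[n]` with a single block. -/
def oneFin (n : ℕ+) : CFin n := Comp.one (seg n) (seg_nonempty n)

theorem restrict_oneFin {m n : ℕ+} (h : m ≤ n) :
    (oneFin n).restrict (seg_subset h) = oneFin m := by
  ext1
  have h1 : seg n ∩ seg m = seg m := Finset.inter_eq_right.2 (seg_subset h)
  have h2 : seg m ≠ ∅ := (seg_nonempty m).ne_empty
  change restrictBlocks (seg m) [seg n] = [seg m]
  simp only [restrictBlocks, List.map_cons, List.map_nil, h1]
  simp [h2]

/-- `𝒞`, the set of compositions of `ℕ`: the projective limit of the `𝒞_n`. -/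
def CInf : Type :=
  {γ : (n : ℕ+) → CFin n // ∀ (m n : ℕ+) (h : m ≤ n), (γ n).restrict (seg_subset h) = γ m}

/-- The Borel σ-algebra of the product topology on `𝒞`, i.e. the product σ-algebra. -/
instance : MeasurableSpace CInf :=
  inferInstanceAs (MeasurableSpace {γ : (n : ℕ+) → CFin n //
    ∀ (m n : ℕ+) (h : m ≤ n), (γ n).restrict (seg_subset h) = γ m})

/-- The restriction `γ_[n]` of a composition `γ` of `ℕ`. -/
def CInf.toFin (γ : CInf) (n : ℕ+) : CFin n := γ.1 n

/-- `𝟏_ℕ`, the composition of `ℕ` with a single block. -/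
def oneInf : CInf := ⟨oneFin, fun _ _ h => restrict_oneFin h⟩

/-! ## Exchangeability, fragmentation measures -/

/-- A measure on compositions of a finite set is exchangeable if it is invariant under all
permutations of that set. -/
def IsExchangeableFin {S : Finset ℕ+} (p : Measure (Comp S)) : Prop :=
  ∀ (σ : Equiv.Perm S) (γ : Comp S), p {δ | δ = γ} = p {δ | δ.perm σ = γ}

/-- A measure on `𝒞` is exchangeable if, for all `n`, `γ_[n]` and `σ(γ_[n])` have the same
distribution for every permutation `σ` of `[n]`. -/
def IsExchangeable (μ : Measure CInf) : Prop :=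
  ∀ (n : ℕ+) (σ : Equiv.Perm (seg n)) (γ : CFin n),
    μ {δ | δ.toFin n = γ} = μ {δ | (δ.toFin n).perm σ = γ}

/-- Fragmentation measures. -/
structure IsFragMeasure (μ : Measure CInf) : Prop where
  exchangeable : IsExchangeable μ
  one_eq_zero : μ {oneInf} = 0
  lt_top : ∀ n : ℕ+, μ {γ | γ.toFin n ≠ oneFin n} < ∞

/-! ## Fragmentation processes -/

section Processes

variable {Ω : Type u} [MeasurableSpace Ω]

/-- The Markov property of a process with time set `ℝ_+`, with respect to the filtration that it
generates. -/
def IsMarkovProcess {E : Type*} [MeasurableSpace E] (X : ℝ≥0 → Ω → E) (P : Measure Ω) : Prop :=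
  ∀ (s t : ℝ≥0), s ≤ t → ∀ A : Set E, MeasurableSet A →
    P[(X t ⁻¹' A).indicator (fun _ => (1 : ℝ)) |
        ⨆ r : Set.Iic s, MeasurableSpace.comap (X r) inferInstance]
      =ᵐ[P] P[(X t ⁻¹' A).indicator (fun _ => (1 : ℝ)) |
        MeasurableSpace.comap (X s) inferInstance]

/-- `p-FRAG(γ, ·)`: the law of `FRAG(γ, γ^(·))`, where the `γ^(i)` are i.i.d. with law `p`. -/
def fragLaw {S : Finset ℕ+} (p : Measure (Comp S)) (γ : Comp S) : Measure (Comp S) :=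
  (Measure.pi (fun _ : S => p)).map γ.frag

/-- A (time-homogeneous) exchangeable fragmentation process of compositions on `𝒞_n`. -/
structure IsFragProcessFin {n : ℕ+} (X : ℝ≥0 → Ω → CFin n) (P : Measure Ω) : Prop where
  measurable : ∀ t, Measurable (X t)
  markov : IsMarkovProcess X P
  continuous_in_prob : ∀ t, Tendsto (fun s => P {ω | X s ω ≠ X t ω}) (𝓝 t) (𝓝 0)
  zero : ∀ᵐ ω ∂P, X 0 ω = oneFin n
  semigroup : ∃ p : ℝ≥0 → ProbabilityMeasure (CFin n),
    (∀ r, 0 < r → IsExchangeableFin (p r : Measure (CFin n))) ∧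
    ∀ (t r : ℝ≥0) (γ : CFin n), 0 < r → P {ω | X t ω = γ} ≠ 0 →
      (P[|{ω | X t ω = γ}]).map (X (t + r)) = fragLaw (p r : Measure (CFin n)) γ

/-- A c-fragmentation: a Markov process on `𝒞` all of whose restrictions to `[n]` are
(time-homogeneous) exchangeable fragmentation processes on `𝒞_n`. -/
structure IsCFragmentation (Γ : ℝ≥0 → Ω → CInf) (P : Measure Ω) : Prop where
  measurable : ∀ t, Measurable (Γ t)
  markov : IsMarkovProcess Γ P
  restrict : ∀ n : ℕ+, IsFragProcessFin (fun t ω => (Γ t ω).toFin n) P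

/-- `μ` is the measure of `Γ`: it is exchangeable, does not charge `𝟏_ℕ`, and
`μ {δ | δ_[n] = γ}` is the jump rate `q_γ = lim_{s → 0+} P(Γ_[n](s) = γ) / s`
for every `n` and every composition `γ ≠ 𝟏_n` of `[n]`. -/
structure HasFragMeasure (Γ : ℝ≥0 → Ω → CInf) (P : Measure Ω) (μ : Measure CInf) : Prop where
  exchangeable : IsExchangeable μ
  one_eq_zero : μ {oneInf} = 0
  rate : ∀ (n : ℕ+) (γ : CFin n), γ ≠ oneFin n →
    Tendsto (fun s : ℝ≥0 => P {ω | (Γ s ω).toFin n = γ} / (s : ℝ≥0∞)) (𝓝[>] 0)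
      (𝓝 (μ {δ | δ.toFin n = γ}))

/-- The law of a process, on the product space of all paths. -/
def processLaw (Γ : ℝ≥0 → Ω → CInf) (P : Measure Ω) : Measure (ℝ≥0 → CInf) :=
  P.map (fun ω t => Γ t ω)

end Processes

/-- The laws of c-fragmentations. -/
def IsCFragLaw (Q : Measure (ℝ≥0 → CInf)) : Prop :=
  ∃ (Ω : Type u) (_ : MeasurableSpace Ω) (P : Measure Ω) (Γ : ℝ≥0 → Ω → CInf),
    IsProbabilityMeasure P ∧ IsCFragmentation Γ P ∧ processLaw Γ P = Q

/-! ## The Poissonian construction -/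

/-- `M` is a Poisson (random) measure with intensity `ν`. -/
structure IsPoissonMeasure {Ω : Type u} [MeasurableSpace Ω] {E : Type*} [MeasurableSpace E]
    (M : Ω → Measure E) (ν : Measure E) (P : Measure Ω) : Prop where
  measurable : ∀ A, MeasurableSet A → Measurable (fun ω => M ω A)
  integer_valued : ∀ ω A, MeasurableSet A → ∃ k : ℕ∞, M ω A = (k : ℝ≥0∞)
  poisson : ∀ A, MeasurableSet A → ν A ≠ ∞ →
    P.map (fun ω => M ω A) = (poissonMeasure (ν A).toNNReal).map (fun k : ℕ => (k : ℝ≥0∞))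
  infinite : ∀ A, MeasurableSet A → ν A = ∞ → ∀ᵐ ω ∂P, M ω A = ∞
  indep : ∀ (m : ℕ) (A : Fin m → Set E), (∀ i, MeasurableSet (A i)) →
    Pairwise (fun i j => Disjoint (A i) (A j)) → iIndepFun (fun i ω => M ω (A i)) P

/-- The discrete σ-algebra on `ℕ = {1, 2, …}`. -/
instance : MeasurableSpace ℕ+ := ⊤

/-- The space `ℝ_+ × 𝒞 × ℕ`. -/
abbrev Marks : Type := ℝ≥0 × CInf × ℕ+

/-- The intensity `dt ⊗ μ ⊗ ♯`, where `dt` is Lebesgue measure on `ℝ_+`. -/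
def intensity (μ : Measure CInf) : Measure Marks :=
  (Measure.comap ((↑) : ℝ≥0 → ℝ) volume).prod (μ.prod Measure.count)

open scoped Classical in
/-- The sequence `Δ_n^(·)(γ, k)` in `𝒞_n`: `γ_[n]` at the index `k`, and `𝟏_n` elsewhere. -/
def Delta (n : ℕ+) (γ : CInf) (k : ℕ+) : seg n → CFin n :=
  fun i => if (i : ℕ+) = k then γ.toFin n else oneFin n

/-- `(s, γ, k)` is an atom of `m` restricted to `ℝ_+ × 𝒞_n^* × {1, …, n}`. -/
def IsAtom (m : Measure Marks) (n : ℕ+) (s : ℝ≥0) (γ : CInf) (k : ℕ+) : Prop :=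
  m {(s, γ, k)} ≠ 0 ∧ γ.toFin n ≠ oneFin n ∧ k ≤ n

/-- `f` is the pure jump path on `𝒞_n` built from the point measure `m`: it starts from `𝟏_n`,
is piecewise constant and right continuous, is equal to `FRAG(f(s-), Δ_n^(·)(γ, k))` at time `s`
if `(s, γ, k)` is an atom of the restriction of `m`, and has no jumps at other times. -/
structure IsPoissonPathFin (m : Measure Marks) (n : ℕ+) (f : ℝ≥0 → CFin n) : Prop where
  zero : f 0 = oneFin n
  right : ∀ s, ∀ᶠ r in 𝓝[>] s, f r = f s
  left : ∀ s, 0 < s → ∃ f₀ : CFin n, (∀ᶠ r in 𝓝[<] s, f r = f₀) ∧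
    (∀ γ k, IsAtom m n s γ k → f s = f₀.frag (Delta n γ k)) ∧
    ((∀ γ k, ¬ IsAtom m n s γ k) → f s = f₀)

/-- `f` is the path on `𝒞` all of whose restrictions to `[n]` are the paths built from `m`. -/
def IsPoissonPath (m : Measure Marks) (f : ℝ≥0 → CInf) : Prop :=
  ∀ n : ℕ+, IsPoissonPathFin m n (fun t => (f t).toFin n)

/-- `Γ` is (a version of) the process on `𝒞` built from the random point measure `M`. -/
structure IsPoissonConstruction {Ω : Type u} [MeasurableSpace Ω] (Γ : ℝ≥0 → Ω → CInf)
    (M : Ω → Measure Marks) (P : Measure Ω) : Prop where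
  measurable : ∀ t, Measurable (Γ t)
  path : ∀ᵐ ω ∂P, IsPoissonPath (M ω) (fun t => Γ t ω)

end CFrag

end

/-! Everything is decided at the finite levels `[n]`, where the processes are finite Markov chains.
A composition is a total preorder, encoded by the relations `Comp.lt` and `Comp.eqv`; FRAG is then
lexicographic refinement. It is associative and equivariant, up to a reindexing of the family that
is injective on the indices actually read (`frag_frag`, `frag_perm`). For i.i.d. families such a
reindexing is harmless, so the fragmentation kernels `Fr p` are closed under products (`Fr_mul_Fr`),
and the row of `Fr p` at the one-block composition is `p` itself.

If the weights `p_h` start from the Dirac mass at the one-block composition and have derivative `q`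
at 0, only one index can be non-trivial at first order, so `Fr p_h = 1 + h (genM q) + o(h)`
(`hasDerivWithinAt_Fr`). The limit `V(r/N)^N → exp(rQ)` for `V(h) = 1 + hQ + o(h)` is then used
three times: with artificial weights, to see that `exp(r genM q)` is a fragmentation kernel with the
symmetries of `q` (`chain_eq_Fr`, `chain_perm`); with the kernels of a given fragmentation process,
to see that it is the chain with rates `q` (`exists_rates`, `IsFragProcessFin.exists_isChain`); with
the discretized Poissonian dynamics, to find its transition matrices (`tendsto_stepMat_pow`,
`real_inter_path`).

At level `n` the marks that matter have finite rate. If a bounded time interval is cut into `N`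
equal pieces, the probability that some piece holds two such marks is `O(1/N)`. Hence almost surely
the path exists, is unique and is a finite composition of jumps; uniqueness makes the levels
compatible. Independence of the marks before and after a time gives the Markov property, and
cylinders carry it to `𝒞`.

For the bijection, the rates determine the measure away from `𝟏_ℕ` (`measure_ext_of_toFin`) and also
the finite-dimensional distributions (`IsChain.fdd_eq`). A measure with the rates of a given
c-fragmentation is a weak limit of the laws of `Γ(s)` divided by `s`, taken on the clopen sets
`{δ_[N] ≠ 𝟏_N}` of the compact space `𝒞` and then glued (`exists_measure_toFin`). Surjectivity is
the Poissonian construction. -/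

noncomputable section

namespace CFrag

/-! ## The order relations encoded by a composition -/

/-- `i` lies in a block strictly before a block containing `j`. -/
def sltBlocks : List (Finset ℕ+) → ℕ+ → ℕ+ → Prop
  | [], _, _ => False
  | A :: l, i, j => (i ∈ A ∧ ∃ B ∈ l, j ∈ B) ∨ sltBlocks l i j

/-- `i` and `j` lie in a common block. -/
def eqvBlocks (l : List (Finset ℕ+)) (i j : ℕ+) : Prop := ∃ A ∈ l, i ∈ A ∧ j ∈ A

@[simp] theorem sltBlocks_nil (i j : ℕ+) : sltBlocks [] i j ↔ False := Iff.rfl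

theorem sltBlocks_cons (A : Finset ℕ+) (l : List (Finset ℕ+)) (i j : ℕ+) :
    sltBlocks (A :: l) i j ↔ (i ∈ A ∧ ∃ B ∈ l, j ∈ B) ∨ sltBlocks l i j := Iff.rfl

theorem sltBlocks_left {l : List (Finset ℕ+)} {i j : ℕ+} (h : sltBlocks l i j) :
    ∃ A ∈ l, i ∈ A := by
  induction l with
  | nil => exact h.elim
  | cons A l ih =>
    rcases h with h | h
    · exact ⟨A, by simp, h.1⟩
    · obtain ⟨B, hB, hi⟩ := ih h
      exact ⟨B, by simp [hB], hi⟩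

theorem sltBlocks_right {l : List (Finset ℕ+)} {i j : ℕ+} (h : sltBlocks l i j) :
    ∃ A ∈ l, j ∈ A := by
  induction l with
  | nil => exact h.elim
  | cons A l ih =>
    rcases h with ⟨-, B, hB, hj⟩ | h
    · exact ⟨B, by simp [hB], hj⟩
    · obtain ⟨B, hB, hi⟩ := ih h
      exact ⟨B, by simp [hB], hi⟩

/-- The first block consists of the elements that nothing precedes: an element of `A` outside `A'`
would lie in a later block of the second list, hence after an element of `A'`, which is impossible
in the first list. So the heads agree, and the tails are compared by recursion. -/
theorem blocks_ext : ∀ {l l' : List (Finset ℕ+)}, (∀ A ∈ l, A.Nonempty) → (∀ A ∈ l', A.Nonempty) →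
    l.Pairwise Disjoint → l'.Pairwise Disjoint →
    (∀ i j, sltBlocks l i j ↔ sltBlocks l' i j) → (∀ i j, eqvBlocks l i j ↔ eqvBlocks l' i j) →
    l = l'
  | [], [], _, _, _, _, _, _ => rfl
  | [], A :: l', _, h', _, _, _, he => by
    obtain ⟨a, ha⟩ := h' A (by simp)
    have := (he a a).2 ⟨A, by simp, ha, ha⟩
    obtain ⟨B, hB, -⟩ := this
    simp at hB
  | A :: l, [], h, _, _, _, _, he => by
    obtain ⟨a, ha⟩ := h A (by simp)
    have := (he a a).1 ⟨A, by simp, ha, ha⟩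
    obtain ⟨B, hB, -⟩ := this
    simp at hB
  | A :: l, A' :: l', h, h', hd, hd', hs, he => by
    have head : ∀ {A A' : Finset ℕ+} {l l' : List (Finset ℕ+)}, (∀ B ∈ A' :: l', B.Nonempty) →
        (A :: l).Pairwise Disjoint →
        (∀ i j, sltBlocks (A' :: l') i j → sltBlocks (A :: l) i j) →
        (∀ i j, eqvBlocks (A :: l) i j → eqvBlocks (A' :: l') i j) → ∀ a ∈ A, a ∈ A' := by
      intro A A' l l' h' hd hs he a ha
      by_contra hna
      obtain ⟨B, hB, haB, -⟩ := he a a ⟨A, by simp, ha, ha⟩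
      have hB' : B ∈ l' := by
        rcases List.mem_cons.1 hB with rfl | hB
        · exact absurd haB hna
        · exact hB
      obtain ⟨a', ha'⟩ := h' A' (by simp)
      have hnot : ∀ C ∈ l, a ∉ C := fun C hC haC =>
        Finset.disjoint_left.1 ((List.pairwise_cons.1 hd).1 C hC) ha haC
      rcases hs a' a (Or.inl ⟨ha', B, hB', haB⟩) with ⟨-, C, hC, haC⟩ | h2
      · exact hnot C hC haC
      · obtain ⟨C, hC, haC⟩ := sltBlocks_right h2
        exact hnot C hC haC
    have hAA : A = A' := Finset.Subset.antisymm
      (head h' hd (fun i j => (hs i j).2) (fun i j => (he i j).1))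
      (head h hd' (fun i j => (hs i j).1) (fun i j => (he i j).2))
    subst hAA
    -- By disjointness, deleting the head deletes exactly the related pairs whose first element lies
    -- in `A`.
    have tail : ∀ {l : List (Finset ℕ+)}, (A :: l).Pairwise Disjoint →
        (∀ i j, sltBlocks l i j ↔ sltBlocks (A :: l) i j ∧ i ∉ A) ∧
        (∀ i j, eqvBlocks l i j ↔ eqvBlocks (A :: l) i j ∧ i ∉ A) := by
      intro l hd
      have hnot : ∀ C ∈ l, ∀ a ∈ C, a ∉ A := fun C hC a haC ha =>
        Finset.disjoint_left.1 ((List.pairwise_cons.1 hd).1 C hC) ha haC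
      constructor
      · intro i j
        constructor
        · intro h
          obtain ⟨C, hC, hi⟩ := sltBlocks_left h
          exact ⟨Or.inr h, hnot C hC i hi⟩
        · rintro ⟨h | h, hn⟩
          · exact absurd h.1 hn
          · exact h
      · intro i j
        constructor
        · rintro ⟨C, hC, hi, hj⟩
          exact ⟨⟨C, by simp [hC], hi, hj⟩, hnot C hC i hi⟩
        · rintro ⟨⟨C, hC, hi, hj⟩, hn⟩
          rcases List.mem_cons.1 hC with rfl | hC
          · exact absurd hi hn
          · exact ⟨C, hC, hi, hj⟩
    obtain ⟨t1, t2⟩ := tail hd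
    obtain ⟨t1', t2'⟩ := tail hd'
    rw [blocks_ext (fun B hB => h B (by simp [hB])) (fun B hB => h' B (by simp [hB]))
      (List.pairwise_cons.1 hd).2 (List.pairwise_cons.1 hd').2
      (fun i j => by rw [t1, t1', hs]) (fun i j => by rw [t2, t2', he])]

theorem restrictBlocks_cons (A B : Finset ℕ+) (l : List (Finset ℕ+)) :
    restrictBlocks A (B :: l) =
      if B ∩ A = ∅ then restrictBlocks A l else (B ∩ A) :: restrictBlocks A l := by
  by_cases h : B ∩ A = ∅ <;> simp [restrictBlocks, h]

theorem exists_mem_restrictBlocks {A : Finset ℕ+} {l : List (Finset ℕ+)} {j : ℕ+} :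
    (∃ B ∈ restrictBlocks A l, j ∈ B) ↔ (∃ B ∈ l, j ∈ B) ∧ j ∈ A := by
  constructor
  · rintro ⟨B, hB, hj⟩
    obtain ⟨⟨C, hC, rfl⟩, -⟩ := mem_restrictBlocks.1 hB
    exact ⟨⟨C, hC, (Finset.mem_inter.1 hj).1⟩, (Finset.mem_inter.1 hj).2⟩
  · rintro ⟨⟨C, hC, hj⟩, hA⟩
    have : j ∈ C ∩ A := Finset.mem_inter.2 ⟨hj, hA⟩
    exact ⟨C ∩ A, mem_restrictBlocks.2 ⟨⟨C, hC, rfl⟩, ⟨j, this⟩⟩, this⟩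

theorem sltBlocks_restrictBlocks (A : Finset ℕ+) (l : List (Finset ℕ+)) (i j : ℕ+) :
    sltBlocks (restrictBlocks A l) i j ↔ sltBlocks l i j ∧ i ∈ A ∧ j ∈ A := by
  induction l with
  | nil => simp [restrictBlocks]
  | cons B l ih =>
    rw [restrictBlocks_cons]
    split_ifs with h
    · rw [ih, sltBlocks_cons]
      have : i ∈ A → i ∉ B := fun hA hB => by
        have : i ∈ B ∩ A := Finset.mem_inter.2 ⟨hB, hA⟩
        simp [h] at this
      tauto
    · rw [sltBlocks_cons, sltBlocks_cons, ih, exists_mem_restrictBlocks, Finset.mem_inter]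
      grind

theorem eqvBlocks_restrictBlocks (A : Finset ℕ+) (l : List (Finset ℕ+)) (i j : ℕ+) :
    eqvBlocks (restrictBlocks A l) i j ↔ eqvBlocks l i j ∧ i ∈ A ∧ j ∈ A := by
  constructor
  · rintro ⟨B, hB, hi, hj⟩
    obtain ⟨⟨C, hC, rfl⟩, -⟩ := mem_restrictBlocks.1 hB
    rw [Finset.mem_inter] at hi hj
    exact ⟨⟨C, hC, hi.1, hj.1⟩, hi.2, hj.2⟩
  · rintro ⟨⟨C, hC, hi, hj⟩, hiA, hjA⟩
    have : i ∈ C ∩ A := Finset.mem_inter.2 ⟨hi, hiA⟩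
    exact ⟨C ∩ A, mem_restrictBlocks.2 ⟨⟨C, hC, rfl⟩, ⟨i, this⟩⟩, this,
      Finset.mem_inter.2 ⟨hj, hjA⟩⟩

theorem sltBlocks_map (e : Equiv.Perm ℕ+) (l : List (Finset ℕ+)) (i j : ℕ+) :
    sltBlocks (l.map (fun A => A.map e.toEmbedding)) (e i) (e j) ↔ sltBlocks l i j := by
  induction l with
  | nil => rfl
  | cons B l ih =>
    rw [List.map_cons, sltBlocks_cons, sltBlocks_cons, ih]
    simp

theorem eqvBlocks_map (e : Equiv.Perm ℕ+) (l : List (Finset ℕ+)) (i j : ℕ+) :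
    eqvBlocks (l.map (fun A => A.map e.toEmbedding)) (e i) (e j) ↔ eqvBlocks l i j := by
  simp [eqvBlocks]

theorem sltBlocks_append (l l' : List (Finset ℕ+)) (i j : ℕ+) :
    sltBlocks (l ++ l') i j ↔
      sltBlocks l i j ∨ sltBlocks l' i j ∨ (∃ A ∈ l, i ∈ A) ∧ ∃ B ∈ l', j ∈ B := by
  induction l with
  | nil => simp
  | cons A l ih =>
    simp only [List.cons_append, sltBlocks_cons, ih, List.mem_append, or_and_right, exists_or,
      List.mem_cons, exists_eq_left]
    grind

/-- Here `v a` is the union of the blocks of `g a`: two elements of a concatenation are ordered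
either by the pieces they lie in, or inside a common piece. -/
theorem sltBlocks_flatMap {ι : Type*} (L : List ι) (g : ι → List (Finset ℕ+)) (v : ι → Finset ℕ+)
    (h : ∀ a ∈ L, ∀ i, i ∈ v a ↔ ∃ B ∈ g a, i ∈ B) (i j : ℕ+) :
    sltBlocks (L.flatMap g) i j ↔ sltBlocks (L.map v) i j ∨ ∃ a ∈ L, sltBlocks (g a) i j := by
  induction L with
  | nil => simp
  | cons a L ih =>
    have ih' := ih (fun b hb => h b (by simp [hb]))
    have e : (∃ B ∈ L.flatMap g, j ∈ B) ↔ ∃ B ∈ L.map v, j ∈ B := by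
      constructor
      · rintro ⟨B, hB, hj⟩
        obtain ⟨b, hb, hB⟩ := List.mem_flatMap.1 hB
        exact ⟨v b, List.mem_map_of_mem hb, (h b (by simp [hb]) j).2 ⟨B, hB, hj⟩⟩
      · rintro ⟨B, hB, hj⟩
        obtain ⟨b, hb, rfl⟩ := List.mem_map.1 hB
        obtain ⟨C, hC, hj⟩ := (h b (by simp [hb]) j).1 hj
        exact ⟨C, List.mem_flatMap.2 ⟨b, hb, hC⟩, hj⟩
    rw [List.flatMap_cons, sltBlocks_append, ih', List.map_cons, sltBlocks_cons, e,
      ← h a (by simp)]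
    simp only [List.mem_cons, or_and_right, exists_or, exists_eq_left]
    grind

/-! ### Compositions as total preorders; algebra of FRAG and of permutations. -/

namespace Comp

variable {S : Finset ℕ+}

/-- The block of `i` precedes the block of `j`. -/
def lt (γ : Comp S) (i j : S) : Prop := sltBlocks γ.blocks i j

/-- `i` and `j` are in the same block. -/
def eqv (γ : Comp S) (i j : S) : Prop := eqvBlocks γ.blocks i j

/-- This turns the identities about FRAG, restriction and permutations into propositional logic on
two relations, without any manipulation of lists. -/
theorem ext_rel {γ γ' : Comp S} (hl : ∀ i j, γ.lt i j ↔ γ'.lt i j)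
    (he : ∀ i j, γ.eqv i j ↔ γ'.eqv i j) : γ = γ' := by
  ext1
  have mem : ∀ γ : Comp S, ∀ i, (∃ A ∈ γ.blocks, i ∈ A) → i ∈ S := fun γ i => (γ.mem_iff i).2
  refine blocks_ext γ.nonempty γ'.nonempty γ.disjoint γ'.disjoint ?_ ?_
  · intro i j
    constructor
    · intro h
      exact (hl ⟨i, mem γ i (sltBlocks_left h)⟩ ⟨j, mem γ j (sltBlocks_right h)⟩).1 h
    · intro h
      exact (hl ⟨i, mem γ' i (sltBlocks_left h)⟩ ⟨j, mem γ' j (sltBlocks_right h)⟩).2 h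
  · intro i j
    constructor
    · rintro ⟨A, hA, hi, hj⟩
      exact (he ⟨i, mem γ i ⟨A, hA, hi⟩⟩ ⟨j, mem γ j ⟨A, hA, hj⟩⟩).1 ⟨A, hA, hi, hj⟩
    · rintro ⟨A, hA, hi, hj⟩
      exact (he ⟨i, mem γ' i ⟨A, hA, hi⟩⟩ ⟨j, mem γ' j ⟨A, hA, hj⟩⟩).2 ⟨A, hA, hi, hj⟩

instance : Finite (Comp S) := by
  refine Finite.of_injective (fun γ : Comp S => (γ.lt, γ.eqv)) fun γ γ' h => ?_
  simp only [Prod.mk.injEq] at h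
  exact ext_rel (fun i j => by rw [h.1]) (fun i j => by rw [h.2])

instance : Fintype (Comp S) := Fintype.ofFinite _

instance : DecidableEq (Comp S) := Classical.decEq _

theorem eqv_refl (γ : Comp S) (i : S) : γ.eqv i i := by
  obtain ⟨A, hA, hi⟩ := (γ.mem_iff i).1 i.2
  exact ⟨A, hA, hi, hi⟩

theorem eqv_symm {γ : Comp S} {i j : S} (h : γ.eqv i j) : γ.eqv j i := by
  obtain ⟨A, hA, hi, hj⟩ := h
  exact ⟨A, hA, hj, hi⟩

theorem block_unique (γ : Comp S) {A B : Finset ℕ+} (hA : A ∈ γ.blocks) (hB : B ∈ γ.blocks)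
    {i : ℕ+} (hiA : i ∈ A) (hiB : i ∈ B) : A = B := by
  by_contra hne
  exact Finset.disjoint_left.1 (γ.disjoint.forall hA hB hne) hiA hiB

theorem eqv_trans {γ : Comp S} {i j k : S} (h : γ.eqv i j) (h' : γ.eqv j k) : γ.eqv i k := by
  obtain ⟨A, hA, hi, hj⟩ := h
  obtain ⟨B, hB, hj', hk⟩ := h'
  obtain rfl := γ.block_unique hA hB hj hj'
  exact ⟨A, hA, hi, hk⟩

/-- The block containing `i`. -/
def blockOf (γ : Comp S) (i : S) : Finset ℕ+ := ((γ.mem_iff i).1 i.2).choose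

theorem blockOf_mem (γ : Comp S) (i : S) : γ.blockOf i ∈ γ.blocks :=
  ((γ.mem_iff i).1 i.2).choose_spec.1

theorem mem_blockOf (γ : Comp S) (i : S) : (i : ℕ+) ∈ γ.blockOf i :=
  ((γ.mem_iff i).1 i.2).choose_spec.2

/-- The least element of the block of `i`. -/
def rep (γ : Comp S) (i : S) : S :=
  ⟨(γ.blockOf i).min' (γ.nonempty _ (γ.blockOf_mem i)), γ.min'_mem (γ.blockOf_mem i)⟩

theorem rep_eq_min' (γ : Comp S) {A : Finset ℕ+} (hA : A ∈ γ.blocks) {i : S} (hi : (i : ℕ+) ∈ A) :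
    γ.rep i = ⟨A.min' (γ.nonempty A hA), γ.min'_mem hA⟩ := by
  obtain rfl := γ.block_unique hA (γ.blockOf_mem i) hi (γ.mem_blockOf i)
  rfl

theorem eqv_rep (γ : Comp S) (i : S) : γ.eqv i (γ.rep i) :=
  ⟨γ.blockOf i, γ.blockOf_mem i, γ.mem_blockOf i, Finset.min'_mem (γ.blockOf i) (γ.nonempty _ (γ.blockOf_mem i))⟩

theorem rep_le (γ : Comp S) {i j : S} (h : γ.eqv i j) : γ.rep i ≤ j := by
  obtain ⟨A, hA, hi, hj⟩ := h
  rw [γ.rep_eq_min' hA hi]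
  exact Finset.min'_le _ _ hj

theorem rep_eq_rep_iff (γ : Comp S) (i j : S) : γ.rep i = γ.rep j ↔ γ.eqv i j := by
  constructor
  · intro h
    exact eqv_trans (γ.eqv_rep i) (h ▸ eqv_symm (γ.eqv_rep j))
  · rintro ⟨A, hA, hi, hj⟩
    rw [γ.rep_eq_min' hA hi, γ.rep_eq_min' hA hj]

theorem rep_eq_iff (γ : Comp S) (i k : S) :
    γ.rep i = k ↔ γ.eqv i k ∧ ∀ j, γ.eqv i j → k ≤ j := by
  constructor
  · rintro rfl
    exact ⟨γ.eqv_rep i, fun j => γ.rep_le⟩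
  · rintro ⟨h1, h2⟩
    exact le_antisymm (γ.rep_le h1) (h2 _ (γ.eqv_rep i))

theorem rep_rep (γ : Comp S) (i : S) : γ.rep (γ.rep i) = γ.rep i :=
  (γ.rep_eq_rep_iff _ _).2 (eqv_symm (γ.eqv_rep i))

/-- Lexicographic refinement: old strict inequalities survive, and ties are broken by the
composition attached to the least element of the common block. -/
theorem lt_frag (γ : Comp S) (δ : S → Comp S) (i j : S) :
    (γ.frag δ).lt i j ↔ γ.lt i j ∨ γ.eqv i j ∧ (δ (γ.rep i)).lt i j := by
  unfold lt frag
  rw [sltBlocks_flatMap _ _ (fun A => A.1), List.attach_map_subtype_val]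
  · refine or_congr Iff.rfl ?_
    constructor
    · rintro ⟨A, -, h⟩
      obtain ⟨h, hi, hj⟩ := (sltBlocks_restrictBlocks _ _ _ _).1 h
      refine ⟨⟨A.1, A.2, hi, hj⟩, ?_⟩
      rwa [γ.rep_eq_min' A.2 hi]
    · rintro ⟨⟨A, hA, hi, hj⟩, h⟩
      rw [γ.rep_eq_min' hA hi] at h
      exact ⟨⟨A, hA⟩, List.mem_attach _ _, (sltBlocks_restrictBlocks _ _ _ _).2 ⟨h, hi, hj⟩⟩
  · intro A _ i
    exact Comp.mem_iff _ i

theorem eqv_frag (γ : Comp S) (δ : S → Comp S) (i j : S) :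
    (γ.frag δ).eqv i j ↔ γ.eqv i j ∧ (δ (γ.rep i)).eqv i j := by
  constructor
  · rintro ⟨B, hB, hi, hj⟩
    obtain ⟨A, -, hB⟩ := List.mem_flatMap.1 hB
    obtain ⟨h, hi, hj⟩ := (eqvBlocks_restrictBlocks _ _ _ _).1 ⟨B, hB, hi, hj⟩
    refine ⟨⟨A.1, A.2, hi, hj⟩, ?_⟩
    rw [γ.rep_eq_min' A.2 hi]
    exact h
  · rintro ⟨⟨A, hA, hi, hj⟩, h⟩
    rw [γ.rep_eq_min' hA hi] at h
    obtain ⟨B, hB, hi, hj⟩ := (eqvBlocks_restrictBlocks _ _ _ _).2 ⟨h, hi, hj⟩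
    exact ⟨B, List.mem_flatMap.2 ⟨⟨A, hA⟩, List.mem_attach _ _, hB⟩, hi, hj⟩

@[simp] theorem lt_one (hS : S.Nonempty) (i j : S) : (one S hS).lt i j ↔ False := by
  simp [lt, one, sltBlocks_cons]

@[simp] theorem eqv_one (hS : S.Nonempty) (i j : S) : (one S hS).eqv i j ↔ True := by
  simp [eqv, eqvBlocks, one]

theorem lt_restrict (γ : Comp S) {A : Finset ℕ+} (hA : A ⊆ S) (i j : A) :
    (γ.restrict hA).lt i j ↔ γ.lt ⟨i, hA i.2⟩ ⟨j, hA j.2⟩ := by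
  unfold lt restrict
  rw [sltBlocks_restrictBlocks]
  simp

theorem eqv_restrict (γ : Comp S) {A : Finset ℕ+} (hA : A ⊆ S) (i j : A) :
    (γ.restrict hA).eqv i j ↔ γ.eqv ⟨i, hA i.2⟩ ⟨j, hA j.2⟩ := by
  unfold eqv restrict
  rw [eqvBlocks_restrictBlocks]
  simp

theorem lt_perm (σ : Equiv.Perm S) (γ : Comp S) (i j : S) :
    (γ.perm σ).lt (σ i) (σ j) ↔ γ.lt i j := by
  have := sltBlocks_map (Equiv.Perm.ofSubtype σ) γ.blocks i j
  rwa [Equiv.Perm.ofSubtype_apply_coe, Equiv.Perm.ofSubtype_apply_coe] at this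

theorem eqv_perm (σ : Equiv.Perm S) (γ : Comp S) (i j : S) :
    (γ.perm σ).eqv (σ i) (σ j) ↔ γ.eqv i j := by
  have := eqvBlocks_map (Equiv.Perm.ofSubtype σ) γ.blocks i j
  rwa [Equiv.Perm.ofSubtype_apply_coe, Equiv.Perm.ofSubtype_apply_coe] at this

theorem lt_perm' (σ : Equiv.Perm S) (γ : Comp S) (i j : S) :
    (γ.perm σ).lt i j ↔ γ.lt (σ⁻¹ i) (σ⁻¹ j) := by
  have := lt_perm σ γ (σ⁻¹ i) (σ⁻¹ j)
  rwa [← Equiv.Perm.mul_apply, ← Equiv.Perm.mul_apply, mul_inv_cancel] at this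

theorem eqv_perm' (σ : Equiv.Perm S) (γ : Comp S) (i j : S) :
    (γ.perm σ).eqv i j ↔ γ.eqv (σ⁻¹ i) (σ⁻¹ j) := by
  have := eqv_perm σ γ (σ⁻¹ i) (σ⁻¹ j)
  rwa [← Equiv.Perm.mul_apply, ← Equiv.Perm.mul_apply, mul_inv_cancel] at this

theorem perm_mul (σ τ : Equiv.Perm S) (γ : Comp S) : γ.perm (σ * τ) = (γ.perm τ).perm σ := by
  refine ext_rel (fun i j => ?_) (fun i j => ?_)
  · rw [lt_perm', lt_perm', lt_perm']; rfl
  · rw [eqv_perm', eqv_perm', eqv_perm']; rfl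

theorem perm_one (γ : Comp S) : γ.perm 1 = γ :=
  ext_rel (fun i j => by rw [lt_perm']; rfl) (fun i j => by rw [eqv_perm']; rfl)

/-- The action of a permutation of `S` as a permutation of the compositions. -/
def permEquiv (σ : Equiv.Perm S) : Equiv.Perm (Comp S) where
  toFun := perm σ
  invFun := perm σ⁻¹
  left_inv γ := by rw [← perm_mul, inv_mul_cancel, perm_one]
  right_inv γ := by rw [← perm_mul, mul_inv_cancel, perm_one]

@[simp] theorem permEquiv_apply (σ : Equiv.Perm S) (γ : Comp S) : permEquiv σ γ = γ.perm σ := rfl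

theorem perm_one_comp (hS : S.Nonempty) (σ : Equiv.Perm S) : (one S hS).perm σ = one S hS :=
  ext_rel (fun i j => by rw [lt_perm']; simp) (fun i j => by rw [eqv_perm']; simp)

/-- `frag γ δ` only depends on the values of `δ` at the least elements of the blocks. -/
theorem frag_congr (γ : Comp S) {δ δ' : S → Comp S} (h : ∀ i, δ (γ.rep i) = δ' (γ.rep i)) :
    γ.frag δ = γ.frag δ' :=
  ext_rel (fun i j => by rw [lt_frag, lt_frag, h]) (fun i j => by rw [eqv_frag, eqv_frag, h])

theorem frag_one_right (γ : Comp S) (hS : S.Nonempty) : γ.frag (fun _ => one S hS) = γ :=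
  ext_rel (fun i j => by rw [lt_frag]; simp) (fun i j => by rw [eqv_frag]; simp)

theorem rep_one (hS : S.Nonempty) (i : S) :
    (one S hS).rep i = ⟨S.min' hS, S.min'_mem hS⟩ := by
  rw [rep_eq_iff]
  exact ⟨by simp, fun j _ => S.min'_le _ j.2⟩

theorem frag_one_left (hS : S.Nonempty) (δ : S → Comp S) :
    (one S hS).frag δ = δ ⟨S.min' hS, S.min'_mem hS⟩ :=
  ext_rel (fun i j => by rw [lt_frag, rep_one]; simp) (fun i j => by rw [eqv_frag, rep_one]; simp)

/-- Associativity of the fragmentation operator. -/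
theorem frag_frag (γ : Comp S) (δ : S → Comp S) (ε : S → S → Comp S) :
    γ.frag (fun i => (δ i).frag (ε i)) =
      (γ.frag δ).frag (fun j => ε (γ.rep j) ((δ (γ.rep j)).rep j)) := by
  -- A block of `γ.frag δ` lies inside one block of `γ` and inside one block of the composition
  -- attached to it, so both representatives are constant on it.
  have key : ∀ i, γ.rep ((γ.frag δ).rep i) = γ.rep i ∧
      (δ (γ.rep i)).rep ((γ.frag δ).rep i) = (δ (γ.rep i)).rep i := by
    intro i
    obtain ⟨h1, h2⟩ := (eqv_frag γ δ _ _).1 ((γ.frag δ).eqv_rep i)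
    exact ⟨((γ.rep_eq_rep_iff _ _).2 h1).symm, (((δ _).rep_eq_rep_iff _ _).2 h2).symm⟩
  refine ext_rel (fun i j => ?_) (fun i j => ?_)
  · simp only [lt_frag, eqv_frag]
    rw [(key i).1, (key i).2]
    tauto
  · simp only [eqv_frag]
    rw [(key i).1, (key i).2]
    tauto

/-- The second-stage family of `frag_frag` is read at these pairs. Since different blocks read
different pairs, an i.i.d. family indexed by `S × S` still looks i.i.d. to the blocks of `γ.frag δ`.
-/
theorem injOn_rep_rep (γ : Comp S) (δ : S → Comp S) :
    Set.InjOn (fun j => (γ.rep j, (δ (γ.rep j)).rep j)) (Set.range (γ.frag δ).rep) := by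
  rintro _ ⟨i, rfl⟩ _ ⟨j, rfl⟩ h
  simp only [Prod.mk.injEq] at h
  obtain ⟨h1, h2⟩ := h
  rw [← h1] at h2
  have : (γ.frag δ).eqv ((γ.frag δ).rep i) ((γ.frag δ).rep j) := by
    rw [eqv_frag]
    exact ⟨(γ.rep_eq_rep_iff _ _).1 h1, ((δ _).rep_eq_rep_iff _ _).1 h2⟩
  rw [← rep_eq_rep_iff, rep_rep, rep_rep] at this
  exact this

/-- Equivariance of the fragmentation operator. -/
theorem frag_perm (σ : Equiv.Perm S) (γ : Comp S) (δ : S → Comp S) :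
    (γ.frag δ).perm σ = (γ.perm σ).frag (fun j => (δ (γ.rep (σ⁻¹ j))).perm σ) := by
  -- A permutation does not send least elements of blocks to least elements, so the family has to be
  -- reindexed: the block `σ(A)` must read the composition that `A` was reading.
  have key : ∀ i, γ.rep (σ⁻¹ ((γ.perm σ).rep i)) = γ.rep (σ⁻¹ i) := by
    intro i
    rw [rep_eq_rep_iff, ← eqv_perm']
    exact eqv_symm (eqv_rep _ i)
  refine ext_rel (fun i j => ?_) (fun i j => ?_)
  · rw [lt_perm', lt_frag, lt_frag, lt_perm', eqv_perm', lt_perm', key]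
  · rw [eqv_perm', eqv_frag, eqv_frag, eqv_perm', eqv_perm', key]

/-- Distinct blocks of `γ.perm σ` come from distinct blocks of `γ`, so the reindexing in `frag_perm`
does not disturb i.i.d. families. -/
theorem injOn_rep_perm (σ : Equiv.Perm S) (γ : Comp S) :
    Set.InjOn (fun j => γ.rep (σ⁻¹ j)) (Set.range (γ.perm σ).rep) := by
  rintro _ ⟨i, rfl⟩ _ ⟨j, rfl⟩ h
  simp only [rep_eq_rep_iff] at h
  rwa [← eqv_perm', ← rep_eq_rep_iff, rep_rep, rep_rep] at h

end Comp

/-- The least element of the block of `i` is at most `i ≤ m`, so it survives the restriction. This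
is why FRAG with marks at least elements is compatible with restriction to initial segments. -/
theorem Comp.rep_restrict_seg {m n : ℕ+} (h : m ≤ n) (x : CFin n) (i : seg m) :
    (((x.restrict (seg_subset h)).rep i : seg m) : ℕ+) = x.rep ⟨i, seg_subset h i.2⟩ := by
  set i' : seg n := ⟨i, seg_subset h i.2⟩
  have hle : x.rep i' ≤ i' := x.rep_le (x.eqv_refl _)
  have hm : ((x.rep i' : seg n) : ℕ+) ∈ seg m := by
    rw [Finset.mem_Icc]
    exact ⟨one_le, le_trans hle (Finset.mem_Icc.1 i.2).2⟩
  have : (x.restrict (seg_subset h)).rep i = ⟨x.rep i', hm⟩ := by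
    rw [Comp.rep_eq_iff]
    refine ⟨(Comp.eqv_restrict _ _ _ _).2 (x.eqv_rep i'), fun j hj => ?_⟩
    have := x.rep_le ((Comp.eqv_restrict _ _ _ _).1 hj)
    exact this
  rw [this]

theorem CInf.restrict_toFin (γ : CInf) {m n : ℕ+} (h : m ≤ n) :
    (γ.toFin n).restrict (seg_subset h) = γ.toFin m := γ.2 m n h

/-- Restriction keeps the least elements of the surviving blocks, so the mark `k` hits the same
block at both levels. This yields the compatibility of the paths at different levels. -/
theorem restrict_frag_Delta {m n : ℕ+} (h : m ≤ n) (x : CFin n) (γ : CInf) (k : ℕ+) :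
    (x.frag (Delta n γ k)).restrict (seg_subset h) =
      (x.restrict (seg_subset h)).frag (Delta m γ k) := by
  have hl : ∀ (i : seg n) (i' : seg m) (_ : (i : ℕ+) = i') (a b : seg m),
      (Delta n γ k i).restrict (seg_subset h) = Delta m γ k i' := by
    intro i i' hi a b
    unfold Delta
    rw [hi]
    split_ifs
    · exact γ.restrict_toFin h
    · exact restrict_oneFin h
  refine Comp.ext_rel (fun i j => ?_) (fun i j => ?_)
  · rw [Comp.lt_restrict, Comp.lt_frag, Comp.lt_frag, Comp.lt_restrict, Comp.eqv_restrict,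
      ← hl _ _ (Comp.rep_restrict_seg h x i).symm i j, Comp.lt_restrict]
  · rw [Comp.eqv_restrict, Comp.eqv_frag, Comp.eqv_frag, Comp.eqv_restrict,
      ← hl _ _ (Comp.rep_restrict_seg h x i).symm i j, Comp.eqv_restrict]

theorem Delta_eq_one_of_lt {n k : ℕ+} (γ : CInf) (h : n < k) :
    Delta n γ k = fun _ => oneFin n := by
  funext i
  have : (i : ℕ+) ≠ k := ne_of_lt (lt_of_le_of_lt (Finset.mem_Icc.1 i.2).2 h)
  simp [Delta, this]

theorem Delta_eq_one_of_eq {n k : ℕ+} {γ : CInf} (h : γ.toFin n = oneFin n) :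
    Delta n γ k = fun _ => oneFin n := by
  funext i
  simp [Delta, h]

theorem Comp.frag_oneFin {n : ℕ+} (x : CFin n) : x.frag (fun _ => oneFin n) = x :=
  x.frag_one_right _


/-! ## Products of infinitesimal steps and semigroups in Banach algebras -/

section Banach

variable {A : Type*} [NormedRing A]

/-- Telescoping `a ^ n - b ^ n`, one factor at a time. -/
theorem norm_pow_sub_pow_le_mul [NormOneClass A] (a b : A) {M : ℝ} (hM : 1 ≤ M) (ha : ‖a‖ ≤ M) (hb : ‖b‖ ≤ M)
    (n : ℕ) : ‖a ^ n - b ^ n‖ ≤ n * M ^ n * ‖a - b‖ := by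
  induction n with
  | zero => simp
  | succ n ih =>
    have e : a ^ (n + 1) - b ^ (n + 1) = a ^ n * (a - b) + (a ^ n - b ^ n) * b := by
      rw [pow_succ, pow_succ]; noncomm_ring
    have hM0 : 0 ≤ M := zero_le_one.trans hM
    have h1 : ‖a ^ n * (a - b)‖ ≤ M ^ (n + 1) * ‖a - b‖ := by
      refine (norm_mul_le _ _).trans ?_
      gcongr
      refine (norm_pow_le a n).trans ((pow_le_pow_left₀ (norm_nonneg _) ha n).trans ?_)
      exact pow_le_pow_right₀ hM (Nat.le_succ n)
    have h2 : ‖(a ^ n - b ^ n) * b‖ ≤ n * M ^ n * ‖a - b‖ * M := by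
      refine (norm_mul_le _ _).trans ?_
      gcongr
    rw [e]
    refine (norm_add_le _ _).trans ((add_le_add h1 h2).trans (le_of_eq ?_))
    push_cast
    ring

variable [NormedAlgebra ℝ A]

/-- Write `V h = 1 + h • D` with `‖D‖ < ‖Q‖ + 1` and use `1 + x ≤ exp x`. The exponential form keeps
the `N`-th powers of `V (r / N)` bounded uniformly in `N`. -/
theorem eventually_norm_le_exp [NormOneClass A] {V : ℝ → A} {Q : A}
    (hV : Tendsto (fun h : ℝ => h⁻¹ • (V h - 1)) (𝓝[>] 0) (𝓝 Q)) :
    ∀ᶠ h in 𝓝[>] (0 : ℝ), ‖V h‖ ≤ Real.exp (h * (‖Q‖ + 1)) := by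
  have h1 : ∀ᶠ h in 𝓝[>] (0 : ℝ), ‖h⁻¹ • (V h - 1)‖ < ‖Q‖ + 1 :=
    hV.norm.eventually_lt_const (lt_add_one _)
  filter_upwards [h1, self_mem_nhdsWithin] with h hh hpos
  have hpos : 0 < h := hpos
  have e : V h = 1 + h • (h⁻¹ • (V h - 1)) := by
    rw [smul_smul, mul_inv_cancel₀ hpos.ne', one_smul]; abel
  calc ‖V h‖ ≤ ‖(1 : A)‖ + ‖h • (h⁻¹ • (V h - 1))‖ := by
        conv_lhs => rw [e]
        exact norm_add_le _ _
    _ ≤ 1 + h * (‖Q‖ + 1) := by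
        rw [norm_one, norm_smul, Real.norm_of_nonneg hpos.le]
        gcongr
    _ ≤ _ := by rw [add_comm]; exact Real.add_one_le_exp _

variable [CompleteSpace A]

theorem tendsto_exp_sub_one (Q : A) :
    Tendsto (fun h : ℝ => h⁻¹ • (NormedSpace.exp (h • Q) - 1)) (𝓝[>] 0) (𝓝 Q) := by
  have h := (hasDerivAt_exp_smul_const (𝕂 := ℝ) Q (0 : ℝ)).hasDerivWithinAt (s := Set.Ioi 0)
  rw [hasDerivWithinAt_iff_tendsto_slope' (by simp)] at h
  have h' : Tendsto (slope (fun u : ℝ => NormedSpace.exp (u • Q)) 0) (𝓝[>] 0) (𝓝 Q) := by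
    simpa using h
  exact h'.congr fun x => by simp [slope_def_module]

/-- If `V h = 1 + h Q + o(h)`, then `V (r / N) ^ N` converges to `exp (r Q)`. -/
theorem tendsto_pow_exp [NormOneClass A] {V : ℝ → A} {Q : A}
    (hV : Tendsto (fun h : ℝ => h⁻¹ • (V h - 1)) (𝓝[>] 0) (𝓝 Q)) {r : ℝ} (hr : 0 < r) :
    Tendsto (fun N : ℕ => V (r / N) ^ N) atTop (𝓝 (NormedSpace.exp (r • Q))) := by
  have hseq : Tendsto (fun N : ℕ => r / (N : ℝ)) atTop (𝓝[>] 0) := by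
    refine tendsto_nhdsWithin_iff.2 ⟨tendsto_const_div_atTop_nhds_zero_nat r, ?_⟩
    filter_upwards [eventually_gt_atTop 0] with N hN
    exact div_pos hr (by exact_mod_cast hN)
  have hB := tendsto_exp_sub_one Q
  have hd : Tendsto (fun h : ℝ => ‖h⁻¹ • (V h - NormedSpace.exp (h • Q))‖) (𝓝[>] 0) (𝓝 0) := by
    have := (hV.sub hB).norm
    simp only [sub_self, norm_zero] at this
    refine this.congr fun h => ?_
    rw [← smul_sub]; congr 2; abel
  have key : Tendsto (fun N : ℕ => ‖V (r / N) ^ N - NormedSpace.exp (r • Q)‖) atTop (𝓝 0) := by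
    have hlim : Tendsto (fun N : ℕ => r * Real.exp (r * (‖Q‖ + 1)) *
        ‖(r / (N : ℝ))⁻¹ • (V (r / N) - NormedSpace.exp ((r / (N : ℝ)) • Q))‖) atTop (𝓝 0) := by
      have := (hd.comp hseq).const_mul (r * Real.exp (r * (‖Q‖ + 1)))
      simpa using this
    refine squeeze_zero' (Eventually.of_forall fun _ => norm_nonneg _) ?_ hlim
    filter_upwards [hseq.eventually (eventually_norm_le_exp hV),
      hseq.eventually (eventually_norm_le_exp hB), eventually_gt_atTop 0] with N h1 h2 hN
    have hN' : (0 : ℝ) < N := by exact_mod_cast hN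
    have hh : 0 < r / (N : ℝ) := div_pos hr hN'
    have hpow : NormedSpace.exp (r • Q) = NormedSpace.exp ((r / (N : ℝ)) • Q) ^ N := by
      let _ := NormedAlgebra.restrictScalars ℚ ℝ A
      rw [← NormedSpace.exp_nsmul, ← Nat.cast_smul_eq_nsmul ℝ, smul_smul,
        mul_div_cancel₀ _ hN'.ne']
    rw [hpow]
    -- The common bound raised to the power `N` no longer depends on `N`, and the remaining factor
    -- `N = r (r / N)⁻¹` turns the difference into a difference of quotients, which tends to 0
    -- because `V` and the exponential have the same derivative `Q`.
    refine (norm_pow_sub_pow_le_mul _ _ (Real.one_le_exp (by positivity)) h1 h2 N).trans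
      (le_of_eq ?_)
    rw [← Real.exp_nat_mul, norm_smul, Real.norm_of_nonneg (inv_pos.2 hh).le]
    have : (N : ℝ) * (r / N * (‖Q‖ + 1)) = r * (‖Q‖ + 1) := by field_simp
    rw [this]
    field_simp
  exact tendsto_iff_norm_sub_tendsto_zero.2 key

/-- A continuous semigroup is differentiable at the origin. -/
theorem exists_generator {K : ℝ → A} (hK : Continuous K) (h0 : K 0 = 1)
    (hmul : ∀ s t, 0 ≤ s → 0 ≤ t → K (s + t) = K s * K t) :
    ∃ Q, Tendsto (fun h : ℝ => h⁻¹ • (K h - 1)) (𝓝[>] 0) (𝓝 Q) := by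
  have hint : ∀ a b : ℝ, IntervalIntegrable K volume a b := fun a b => hK.intervalIntegrable a b
  -- the averages of `K` near the origin are invertible
  have hder : ∀ c : ℝ, HasDerivAt (fun x => ∫ u in (0 : ℝ)..x, K u) (K c) c := fun c =>
    intervalIntegral.integral_hasDerivAt_right (hint _ _)
      (hK.stronglyMeasurableAtFilter _ _) hK.continuousAt
  have hslope : ∀ c : ℝ, Tendsto (fun h : ℝ => h⁻¹ • ∫ u in c..(c + h), K u) (𝓝[>] 0)
      (𝓝 (K c)) := by
    intro c
    have h1 := (hder c).tendsto_slope_zero_right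
    refine h1.congr fun h => ?_
    rw [intervalIntegral.integral_interval_sub_left (hint _ _) (hint _ _)]
  have hunit : ∃ a : ℝ, 0 < a ∧ IsUnit (a⁻¹ • ∫ u in (0 : ℝ)..a, K u) := by
    have h1 := hslope 0
    rw [h0] at h1
    have h2 := h1.eventually (Units.isOpen.mem_nhds isUnit_one)
    obtain ⟨a, ha, hpos⟩ := (h2.and self_mem_nhdsWithin).exists
    refine ⟨a, hpos, ?_⟩
    simpa using ha
  obtain ⟨a, ha, w, hw⟩ := hunit
  set J : A := ∫ u in (0 : ℝ)..a, K u with hJ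
  -- By the semigroup property `(K h - 1) J` is the integral of `K` over `[a, a + h]` minus that
  -- over `[0, h]`. Dividing by `h` and multiplying by the inverse `a⁻¹ w⁻¹` of `J` gives the
  -- derivative.
  refine ⟨(K a - K 0) * (a⁻¹ • (↑w⁻¹ : A)), ?_⟩
  have hJw : J * (a⁻¹ • (↑w⁻¹ : A)) = 1 := by
    rw [mul_smul_comm, ← smul_mul_assoc, ← hw, Units.mul_inv]
  have hlim := (((hslope a).sub (hslope 0)).mul_const (a⁻¹ • (↑w⁻¹ : A)))
  refine hlim.congr' ?_
  filter_upwards [self_mem_nhdsWithin] with h hh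
  have hh : 0 < h := hh
  have e1 : K h * J = ∫ u in h..(a + h), K u := by
    have e0 := (ContinuousLinearMap.mul ℝ A (K h)).intervalIntegral_comp_comm (hint 0 a)
    simp only [ContinuousLinearMap.mul_apply'] at e0
    rw [hJ, ← e0]
    have e3 := intervalIntegral.integral_comp_add_left (a := 0) (b := a) (fun u => K u) h
    rw [add_zero, add_comm h a] at e3
    rw [← e3]
    refine intervalIntegral.integral_congr fun u hu => ?_
    rw [Set.uIcc_of_le ha.le] at hu
    exact (hmul h u hh.le hu.1).symm
  have e2 : (∫ u in a..(a + h), K u) - ∫ u in (0 : ℝ)..(0 + h), K u = (K h - 1) * J := by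
    rw [sub_mul, one_mul, e1, hJ, zero_add]
    rw [← intervalIntegral.integral_add_adjacent_intervals (hint 0 h) (hint h a),
      ← intervalIntegral.integral_add_adjacent_intervals (hint h a) (hint a (a + h))]
    abel
  rw [← smul_sub, e2, smul_mul_assoc, mul_assoc, hJw, mul_one]

end Banach

/-! ## Expectations with respect to finite families of i.i.d. variables -/

section Weights

variable {X J T : Type*} [Fintype X] [Fintype J] [DecidableEq J] [Fintype T] [DecidableEq T]

/-- The expectation of `G` under the product of the weights `p`. -/
def expW (p : X → ℝ) (G : (J → X) → ℝ) : ℝ := ∑ ε : J → X, (∏ j, p (ε j)) * G ε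

theorem sum_prod_weights (p : X → ℝ) (hp : ∑ x, p x = 1) : ∑ ε : J → X, ∏ j, p (ε j) = 1 := by
  have := Finset.prod_univ_sum (fun _ : J => (Finset.univ : Finset X)) (fun _ x => p x)
  rw [Fintype.piFinset_univ] at this
  rw [← this]
  simp [hp]

/-- A subfamily of an i.i.d. family is i.i.d. -/
theorem expW_comp_injective (p : X → ℝ) (hp : ∑ x, p x = 1) {ρ : T → J}
    (hρ : Function.Injective ρ) (G : (T → X) → ℝ) :
    expW p (fun ε : J → X => G (ε ∘ ρ)) = expW p G := by
  classical
  -- The coordinates outside the range of `ρ` do not enter `G`, and their weights sum to 1.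
  let e1 : T ≃ {j // j ∈ Set.range ρ} := Equiv.ofInjective ρ hρ
  let C := {j // j ∉ Set.range ρ}
  let e : (J → X) ≃ (T → X) × (C → X) :=
    (Equiv.piEquivPiSubtypeProd (fun j => j ∈ Set.range ρ) (fun _ => X)).trans
      (Equiv.prodCongr (Equiv.arrowCongr e1.symm (Equiv.refl X)) (Equiv.refl _))
  have he1 : ∀ ε, (e ε).1 = ε ∘ ρ := fun ε => by
    funext t; simp [e, e1, Equiv.piEquivPiSubtypeProd, Equiv.arrowCongr]
  have he2 : ∀ ε c, (e ε).2 c = ε c := fun ε c => by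
    simp [e, Equiv.piEquivPiSubtypeProd]
  have hprod : ∀ ε : J → X, ∏ j, p (ε j) = (∏ t, p ((e ε).1 t)) * ∏ c, p ((e ε).2 c) := by
    intro ε
    rw [← Fintype.prod_subtype_mul_prod_subtype (fun j => j ∈ Set.range ρ)]
    congr 1
    symm
    convert Fintype.prod_equiv e1 (fun t => p ((e ε).1 t)) (fun i => p (ε i))
      (fun t => by simp [he1, e1])
  unfold expW
  rw [Fintype.sum_equiv e (fun ε => (∏ j, p (ε j)) * G (ε ∘ ρ))
    (fun y => (∏ t, p (y.1 t)) * (∏ c, p (y.2 c)) * G y.1)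
    (fun ε => by rw [hprod, ← he1]), Fintype.sum_prod_type]
  refine Finset.sum_congr rfl fun y _ => ?_
  simp only
  rw [← Finset.sum_mul, ← Finset.mul_sum, sum_prod_weights p hp, mul_one]

/-- Only the coordinates in `R` matter, so `G` factors through the restriction to `R`, where `ρ` is
injective. -/
theorem expW_comp_injOn [Nonempty X] (p : X → ℝ) (hp : ∑ x, p x = 1) {ρ : T → J} {R : Set T}
    (hρ : Set.InjOn ρ R) (G : (T → X) → ℝ)
    (hG : ∀ ε ε' : T → X, (∀ t ∈ R, ε t = ε' t) → G ε = G ε') :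
    expW p (fun ε : J → X => G (ε ∘ ρ)) = expW p G := by
  classical
  let x0 : X := Classical.arbitrary X
  let G0 : (R → X) → ℝ := fun ε => G (fun t => if h : t ∈ R then ε ⟨t, h⟩ else x0)
  have h1 : ∀ ε : T → X, G ε = G0 (ε ∘ (Subtype.val : R → T)) := fun ε =>
    hG _ _ fun t ht => by simp [ht]
  have h2 := expW_comp_injective p hp (ρ := (Subtype.val : R → T)) Subtype.val_injective G0
  have h3 := expW_comp_injective p hp (ρ := fun t : R => ρ t)
    (fun a b h => Subtype.ext (hρ a.2 b.2 h)) G0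
  have h4 : expW p G = expW p G0 := by rw [← h2]; congr 1; exact funext h1
  rw [h4, ← h3]
  congr 1
  funext ε
  rw [h1]
  rfl

/-- Expectations of functions of i.i.d. images `φ (y j)`. -/
theorem expW_map {Y : Type*} [Fintype Y] [DecidableEq X] (w : Y → ℝ) (φ : Y → X)
    (H : (J → X) → ℝ) :
    expW (fun x => ∑ y, w y * if φ y = x then 1 else 0) H = expW w (fun y => H (φ ∘ y)) := by
  unfold expW
  have h1 : ∀ η : J → X, (∏ j, ∑ y, w y * if φ y = η j then (1 : ℝ) else 0) =
      ∑ y : J → Y, (∏ j, w (y j)) * if φ ∘ y = η then 1 else 0 := by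
    intro η
    rw [Finset.prod_univ_sum, Fintype.piFinset_univ]
    refine Finset.sum_congr rfl fun y _ => ?_
    rw [Finset.prod_mul_distrib]
    congr 1
    rw [Finset.prod_ite_zero]
    simp [funext_iff]
  simp only [h1, Finset.sum_mul]
  rw [Finset.sum_comm]
  refine Finset.sum_congr rfl fun y _ => ?_
  simp only [mul_assoc, ← Finset.mul_sum]
  congr 1
  simp

/-- Two-stage expectations. -/
theorem expW_expW (p p' : X → ℝ) (G : (J → X) → (J × T → X) → ℝ) :
    expW (fun y : X × (T → X) => p y.1 * ∏ t, p' (y.2 t))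
      (fun y : J → X × (T → X) => G (fun j => (y j).1) (fun a => (y a.1).2 a.2)) =
    expW p (fun δ => expW p' (fun ε => G δ ε)) := by
  unfold expW
  let e : (J → X × (T → X)) ≃ (J → X) × (J × T → X) :=
    (Equiv.arrowProdEquivProdArrow J (fun _ => X) (fun _ => T → X)).trans
      (Equiv.prodCongr (Equiv.refl _) (Equiv.curry J T X).symm)
  rw [Fintype.sum_equiv e _
    (fun z => (∏ j, p (z.1 j)) * (∏ a, p' (z.2 a)) * G z.1 z.2), Fintype.sum_prod_type]
  · refine Finset.sum_congr rfl fun y _ => ?_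
    rw [Finset.mul_sum]
    exact Finset.sum_congr rfl fun z _ => by ring
  · intro y
    rw [Finset.prod_mul_distrib, Fintype.prod_prod_type]
    rfl

theorem expW_equiv (p : X → ℝ) (e : Equiv.Perm X) (he : ∀ x, p (e x) = p x)
    (G : (J → X) → ℝ) : expW p (fun ε => G (fun j => e (ε j))) = expW p G := by
  unfold expW
  refine Fintype.sum_equiv (Equiv.arrowCongr (Equiv.refl J) e) _ _ fun ε => ?_
  simp only [Equiv.arrowCongr_apply, Equiv.refl_symm, Equiv.coe_refl, Function.comp_id,
    Function.comp_apply, he]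
  rfl

end Weights

/-! ## Fragmentation kernels -/

section Kernels

variable {S : Finset ℕ+}

/-- The transition matrix of `γ ↦ FRAG(γ, γ^(·))` with i.i.d. `γ^(i)` of weights `p`. -/
def Fr (p : Comp S → ℝ) : Matrix (Comp S) (Comp S) ℝ :=
  fun γ γ' => expW p (fun δ : S → Comp S => if γ.frag δ = γ' then 1 else 0)

theorem Fr_mulVec (p : Comp S → ℝ) (f : Comp S → ℝ) (γ : Comp S) :
    ∑ γ', Fr p γ γ' * f γ' = expW p (fun δ : S → Comp S => f (γ.frag δ)) := by
  unfold Fr expW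
  simp only [Finset.sum_mul]
  rw [Finset.sum_comm]
  refine Finset.sum_congr rfl fun δ _ => ?_
  simp

theorem sum_Fr (p : Comp S → ℝ) (hp : ∑ x, p x = 1) (γ : Comp S) : ∑ γ', Fr p γ γ' = 1 := by
  have := Fr_mulVec p (fun _ => 1) γ
  simp only [mul_one] at this
  rw [this]
  simp only [expW, mul_one]
  exact sum_prod_weights p hp

/-- Associativity of FRAG: given the first stage `δ`, the second-stage compositions may be taken
from an i.i.d. family indexed by `S × S`, by `injOn_rep_rep`. Each index `i` then carries an
independent copy of `FRAG(y, i.i.d.)` with `y` of weights `p`, whose weights are those on the right.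
-/
theorem Fr_mul_Fr (p p' : Comp S → ℝ) (hp' : ∑ x, p' x = 1) :
    Fr p * Fr p' = Fr (fun x => ∑ y, p y * Fr p' y x) := by
  ext γ γ''
  have : Nonempty (Comp S) := ⟨γ⟩
  rw [Matrix.mul_apply, Fr_mulVec p (fun y => Fr p' y γ'')]
  have h1 : ∀ δ : S → Comp S, Fr p' (γ.frag δ) γ'' = expW p' (fun ε : S × S → Comp S =>
      if γ.frag (fun i => (δ i).frag (fun k => ε (i, k))) = γ'' then 1 else 0) := by
    intro δ
    unfold Fr
    rw [← expW_comp_injOn p' hp' (γ.injOn_rep_rep δ)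
      (fun ε => if (γ.frag δ).frag ε = γ'' then (1 : ℝ) else 0)]
    · congr 1
      funext ε
      rw [Comp.frag_frag γ δ (fun i k => ε (i, k))]
      rfl
    · intro ε ε' h
      rw [Comp.frag_congr _ (fun i => h _ ⟨i, rfl⟩)]
  simp only [h1]
  rw [← expW_expW p p' (fun (δ : S → Comp S) (ε : S × S → Comp S) =>
    if γ.frag (fun i => (δ i).frag (fun k => ε (i, k))) = γ'' then (1 : ℝ) else 0)]
  -- The weights of the product kernel are the image, under `z ↦ z.1.frag z.2`, of product weights
  -- on a pair (composition, family).
  have h2 : (fun x => ∑ y, p y * Fr p' y x) = fun x => ∑ z : Comp S × (S → Comp S),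
      (p z.1 * ∏ t, p' (z.2 t)) * if z.1.frag z.2 = x then 1 else 0 := by
    funext x
    rw [Fintype.sum_prod_type]
    refine Finset.sum_congr rfl fun y _ => ?_
    simp only [Fr, expW, Finset.mul_sum, mul_assoc]
  rw [h2]
  unfold Fr
  rw [expW_map (fun z : Comp S × (S → Comp S) => p z.1 * ∏ t, p' (z.2 t))
    (fun z => z.1.frag z.2)]
  rfl

/-- By `frag_perm`, permuting the result amounts to permuting and reindexing the family; the first
is harmless by invariance of `p`, the second by `injOn_rep_perm`. -/
theorem Fr_perm (p : Comp S → ℝ) (hp : ∑ x, p x = 1) (σ : Equiv.Perm S)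
    (hσ : ∀ x, p (x.perm σ) = p x) (γ γ' : Comp S) :
    Fr p (γ.perm σ) (γ'.perm σ) = Fr p γ γ' := by
  have : Nonempty (Comp S) := ⟨γ⟩
  unfold Fr
  rw [← expW_comp_injOn p hp (γ.injOn_rep_perm σ)
      (fun ε => if (γ.perm σ).frag ε = γ'.perm σ then (1 : ℝ) else 0),
    ← expW_equiv p (Comp.permEquiv σ) hσ]
  · congr 1
    funext ε
    have h := Comp.frag_perm σ γ ε
    have h2 : ((γ.frag ε).perm σ = γ'.perm σ) ↔ γ.frag ε = γ' :=
      (Comp.permEquiv σ).injective.eq_iff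
    rw [← if_congr h2 rfl rfl, h]
    rfl
  · intro ε ε' h
    rw [Comp.frag_congr _ (fun i => h _ ⟨i, rfl⟩)]

variable (hS : S.Nonempty)

theorem expW_single {X J : Type*} [Fintype X] [DecidableEq X] [Fintype J] [DecidableEq J] (a : X)
    (G : (J → X) → ℝ) : expW (fun x => if x = a then (1 : ℝ) else 0) G = G (fun _ => a) := by
  unfold expW
  rw [Finset.sum_eq_single (fun _ => a)]
  · simp
  · intro ε _ h
    obtain ⟨j, hj⟩ := Function.ne_iff.1 h
    rw [Finset.prod_eq_zero (Finset.mem_univ j) (by simp [hj]), zero_mul]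
  · simp

theorem Fr_single : Fr (fun x => if x = Comp.one S hS then (1 : ℝ) else 0) = 1 := by
  ext γ γ'
  unfold Fr
  rw [expW_single, Comp.frag_one_right, Matrix.one_apply]

/-- The single block reads only the index `min S`. Hence the weights of a fragmentation kernel can
be recovered from one of its rows. -/
theorem Fr_one_left (p : Comp S → ℝ) (hp : ∑ x, p x = 1) (γ : Comp S) :
    Fr p (Comp.one S hS) γ = p γ := by
  unfold Fr
  simp only [Comp.frag_one_left]
  have h := expW_comp_injective (J := S) p hp
    (ρ := fun _ : Unit => (⟨S.min' hS, S.min'_mem hS⟩ : S)) (fun _ _ _ => rfl)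
    (fun ε => if ε () = γ then (1 : ℝ) else 0)
  simp only [Function.comp_apply] at h
  rw [h]
  unfold expW
  rw [Fintype.sum_equiv (Equiv.funUnique Unit (Comp S)) _ (fun x => p x * if x = γ then 1 else 0)
    (fun ε => by simp)]
  simp

/-- The generator with jump rates `q` of a fragmentation chain. -/
def genM (q : Comp S → ℝ) : Matrix (Comp S) (Comp S) ℝ := fun γ γ' =>
  ∑ k : S, ∑ x, q x *
    if γ.frag (Function.update (fun _ => Comp.one S hS) k x) = γ' then 1 else 0

theorem tendsto_Fr {α : Type*} {l : Filter α} {p : α → Comp S → ℝ} {q : Comp S → ℝ}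
    (h : ∀ x, Tendsto (fun a => p a x) l (𝓝 (q x))) : Tendsto (fun a => Fr (p a)) l (𝓝 (Fr q)) := by
  refine tendsto_pi_nhds.2 fun γ => tendsto_pi_nhds.2 fun γ' => ?_
  unfold Fr expW
  exact tendsto_finsetSum _ fun δ _ => (tendsto_finsetProd _ fun j _ => h _).mul_const _

/-- Product rule at the Dirac weights: in the term that differentiates the index `k`, all other
factors force the trivial composition, so only families that are trivial off `k` contribute. -/
theorem hasDerivWithinAt_Fr {p : ℝ → Comp S → ℝ} {q : Comp S → ℝ}
    (hq : ∀ x, HasDerivWithinAt (fun h => p h x) (q x) (Set.Ioi 0) 0)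
    (hp0 : p 0 = fun x => if x = Comp.one S hS then (1 : ℝ) else 0) (γ γ' : Comp S) :
    HasDerivWithinAt (fun h => Fr (p h) γ γ') (genM hS q γ γ') (Set.Ioi 0) 0 := by
  have h1 : ∀ δ : S → Comp S, HasDerivWithinAt (fun h => ∏ j, p h (δ j))
      (∑ k, (∏ j ∈ Finset.univ.erase k, p 0 (δ j)) * q (δ k)) (Set.Ioi 0) 0 := by
    intro δ
    have := HasDerivWithinAt.fun_finsetProd (u := Finset.univ) (f := fun j h => p h (δ j))
      (f' := fun j => q (δ j)) (s := Set.Ioi (0 : ℝ)) (x := 0) (fun j _ => hq (δ j))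
    simpa only [smul_eq_mul] using this
  have h2 : HasDerivWithinAt (fun h => Fr (p h) γ γ')
      (∑ δ : S → Comp S, (∑ k, (∏ j ∈ Finset.univ.erase k, p 0 (δ j)) * q (δ k)) *
        if γ.frag δ = γ' then 1 else 0) (Set.Ioi 0) 0 := by
    unfold Fr expW
    exact HasDerivWithinAt.fun_sum fun δ _ => (h1 δ).mul_const _
  refine h2.congr_deriv ?_
  simp only [Finset.sum_mul]
  rw [Finset.sum_comm]
  unfold genM
  refine Finset.sum_congr rfl fun k _ => ?_
  symm
  refine Finset.sum_of_injOn (fun x => Function.update (fun _ => Comp.one S hS) k x) ?_ ?_ ?_ ?_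
  · exact (Function.update_injective (fun _ : S => Comp.one S hS) k).injOn
  · intro x _; simp
  -- A family that is not such an update has a non-trivial value at some `j ≠ k`, where the initial
  -- weight vanishes.
  · intro δ _ hδ
    have : ∃ j ∈ Finset.univ.erase k, δ j ≠ Comp.one S hS := by
      by_contra hcon
      push Not at hcon
      refine hδ ⟨δ k, by simp, ?_⟩
      funext j
      by_cases hj : j = k
      · subst hj; simp
      · beta_reduce
        rw [Function.update_of_ne hj, hcon j (by simp [hj])]
    obtain ⟨j, hj, hne⟩ := this
    rw [Finset.prod_eq_zero hj (by simp [hp0, hne]), zero_mul, zero_mul]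
  · intro x _
    rw [Finset.prod_eq_one, one_mul, Function.update_self]
    intro j hj
    rw [hp0, Function.update_of_ne (Finset.ne_of_mem_erase hj)]
    simp

/-! ### The semigroup generated by the rates `q` -/

attribute [local instance] Matrix.linftyOpNormedRing Matrix.linftyOpNormedAlgebra

/-- The transition matrices of the fragmentation chain with jump rates `q`. -/
def chain (q : Comp S → ℝ) (r : ℝ) : Matrix (Comp S) (Comp S) ℝ :=
  NormedSpace.exp (r • genM hS q)

theorem linftyOp_normOneClass (hS : S.Nonempty) : @NormOneClass (Matrix (Comp S) (Comp S) ℝ)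
    Matrix.linftyOpNormedRing.toNorm _ := by
  have : Nonempty (Comp S) := ⟨Comp.one S hS⟩
  exact Matrix.linfty_opNormOneClass

/-- Powers of matrices with the infinitesimal behaviour of the chain converge to the chain. -/
theorem tendsto_pow_chain {V : ℝ → Matrix (Comp S) (Comp S) ℝ} {q : Comp S → ℝ}
    (hV : ∀ γ γ', HasDerivWithinAt (fun h => V h γ γ') (genM hS q γ γ') (Set.Ioi 0) 0)
    (h0 : V 0 = 1) {r : ℝ} (hr : 0 < r) :
    Tendsto (fun N : ℕ => V (r / N) ^ N) atTop (𝓝 (chain hS q r)) := by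
  have := linftyOp_normOneClass hS
  refine tendsto_pow_exp ?_ hr
  -- The operator norm only serves to have a Banach algebra: its topology on matrices is that of
  -- entrywise convergence.
  refine tendsto_pi_nhds.2 fun γ => tendsto_pi_nhds.2 fun γ' => ?_
  have h := hV γ γ'
  rw [hasDerivWithinAt_iff_tendsto_slope' (by simp)] at h
  refine h.congr fun x => ?_
  simp [slope_def_field, h0, div_eq_inv_mul]

theorem chain_zero (q : Comp S → ℝ) : chain hS q 0 = 1 := by
  simp [chain, NormedSpace.exp_zero]

theorem hasDerivWithinAt_chain (q : Comp S → ℝ) (γ γ' : Comp S) :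
    HasDerivWithinAt (fun h => chain hS q h γ γ') (genM hS q γ γ') (Set.Ioi 0) 0 := by
  have := linftyOp_normOneClass hS
  have h := tendsto_exp_sub_one (genM hS q)
  have h := tendsto_pi_nhds.1 (tendsto_pi_nhds.1 h γ) γ'
  rw [hasDerivWithinAt_iff_tendsto_slope' (by simp)]
  refine h.congr fun x => ?_
  rw [slope_def_field, chain_zero]
  simp only [chain, div_eq_inv_mul, sub_zero, Matrix.smul_apply, Matrix.sub_apply, smul_eq_mul]
  rfl

theorem continuous_chain (q : Comp S → ℝ) : Continuous (chain hS q) := by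
  have := linftyOp_normOneClass hS
  have : Continuous (fun r : ℝ => NormedSpace.exp (r • genM hS q)) :=
    continuous_iff_continuousAt.2 fun r =>
      (hasDerivAt_exp_smul_const (𝕂 := ℝ) (genM hS q) r).continuousAt
  exact this

/-- The weights `(1 - h ∑ q) δ_𝟏 + h q`. -/
theorem exists_Fr_tendsto_chain (q : Comp S → ℝ) (hq : ∑ x, q x = 0) {r : ℝ} (hr : 0 < r) :
    ∃ w : ℕ → Comp S → ℝ, (∀ N, ∑ x, w N x = 1) ∧
      Tendsto (fun N => Fr (w N)) atTop (𝓝 (chain hS q r)) ∧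
      (∀ σ : Equiv.Perm S, (∀ x, q (x.perm σ) = q x) → ∀ N x, w N (x.perm σ) = w N x) := by
  -- These weights can be negative when `h` is large. The algebra of the kernels `Fr` only uses that
  -- they sum to 1.
  let v : ℝ → Comp S → ℝ := fun h x => (if x = Comp.one S hS then 1 else 0) + h * q x
  have hv1 : ∀ h, ∑ x, v h x = 1 := fun h => by
    simp [v, Finset.sum_add_distrib, ← Finset.mul_sum, hq]
  have hv0 : v 0 = fun x => if x = Comp.one S hS then (1 : ℝ) else 0 := by simp [v]
  have hlim := tendsto_pow_chain hS (V := fun h => Fr (v h)) (q := q)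
    (fun γ γ' => hasDerivWithinAt_Fr hS (fun x => by
      have := ((hasDerivWithinAt_id (0 : ℝ) (Set.Ioi 0)).mul_const (q x)).const_add
        (if x = Comp.one S hS then (1 : ℝ) else 0)
      simpa [v] using this) hv0 γ γ') (by rw [hv0, Fr_single]) hr
  -- Fragmentation kernels are closed under products, and each symmetry of `q` is inherited by the
  -- weights of the powers.
  have hpow : ∀ h, ∀ N : ℕ, ∃ w : Comp S → ℝ, ∑ x, w x = 1 ∧ Fr (v h) ^ N = Fr w ∧
      (∀ σ : Equiv.Perm S, (∀ x, q (x.perm σ) = q x) → ∀ x, w (x.perm σ) = w x) := by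
    intro h N
    have hvσ : ∀ σ : Equiv.Perm S, (∀ x, q (x.perm σ) = q x) → ∀ x, v h (x.perm σ) = v h x := by
      intro σ hσ x
      have : x.perm σ = Comp.one S hS ↔ x = Comp.one S hS := by
        conv_lhs => rw [← Comp.perm_one_comp hS σ]
        exact (Comp.permEquiv σ).injective.eq_iff
      simp only [v, this, hσ]
    induction N with
    | zero =>
      refine ⟨v 0, hv1 0, by rw [pow_zero, hv0, Fr_single], fun σ _ x => ?_⟩
      have : x.perm σ = Comp.one S hS ↔ x = Comp.one S hS := by
        conv_lhs => rw [← Comp.perm_one_comp hS σ]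
        exact (Comp.permEquiv σ).injective.eq_iff
      simp only [hv0, this]
    | succ N ih =>
      obtain ⟨w, hw1, hw2, hw3⟩ := ih
      refine ⟨fun x => ∑ y, w y * Fr (v h) y x, ?_, ?_, ?_⟩
      · rw [Finset.sum_comm]
        simp only [← Finset.mul_sum, sum_Fr _ (hv1 h), mul_one, hw1]
      · rw [pow_succ, hw2, Fr_mul_Fr _ _ (hv1 h)]
      · intro σ hσ x
        beta_reduce
        rw [← Equiv.sum_comp (Comp.permEquiv σ)]
        refine Finset.sum_congr rfl fun y _ => ?_
        rw [Comp.permEquiv_apply, hw3 σ hσ, Fr_perm _ (hv1 h) σ (hvσ σ hσ)]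
  choose w hw1 hw2 hw3 using hpow
  refine ⟨fun N => w (r / N) N, fun N => hw1 _ _, ?_, fun σ hσ N => hw3 _ _ σ hσ⟩
  simpa only [hw2] using hlim

theorem tendsto_entry {α : Type*} {l : Filter α} {V : α → Matrix (Comp S) (Comp S) ℝ}
    {W : Matrix (Comp S) (Comp S) ℝ} (h : Tendsto V l (𝓝 W)) (γ γ' : Comp S) :
    Tendsto (fun a => V a γ γ') l (𝓝 (W γ γ')) :=
  tendsto_pi_nhds.1 (tendsto_pi_nhds.1 h γ) γ'

/-- The transition matrices of the chain are fragmentation kernels. -/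
theorem chain_eq_Fr (q : Comp S → ℝ) (hq : ∑ x, q x = 0) {r : ℝ} (hr : 0 < r) :
    chain hS q r = Fr (chain hS q r (Comp.one S hS)) := by
  obtain ⟨w, hw1, hw2, -⟩ := exists_Fr_tendsto_chain hS q hq hr
  -- The approximating weights are the rows at the one-block composition, so they converge as soon
  -- as the kernels do; then `Fr` is continuous in its weights.
  have h1 : ∀ x, Tendsto (fun N => w N x) atTop (𝓝 (chain hS q r (Comp.one S hS) x)) := by
    intro x
    refine (tendsto_entry hw2 (Comp.one S hS) x).congr fun N => ?_
    rw [Fr_one_left hS _ (hw1 N)]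
  exact tendsto_nhds_unique hw2 (tendsto_Fr h1)

/-- The approximating weights of `exists_Fr_tendsto_chain` have the symmetry, which passes to the
limit. -/
theorem chain_perm (q : Comp S → ℝ) (hq : ∑ x, q x = 0) {r : ℝ} (hr : 0 < r)
    (σ : Equiv.Perm S) (hσ : ∀ x, q (x.perm σ) = q x) (γ : Comp S) :
    chain hS q r (Comp.one S hS) (γ.perm σ) = chain hS q r (Comp.one S hS) γ := by
  obtain ⟨w, hw1, hw2, hw3⟩ := exists_Fr_tendsto_chain hS q hq hr
  have h1 := tendsto_entry hw2 (Comp.one S hS) (γ.perm σ)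
  have h2 := tendsto_entry hw2 (Comp.one S hS) γ
  refine tendsto_nhds_unique h1 (h2.congr fun N => ?_)
  rw [Fr_one_left hS _ (hw1 N), Fr_one_left hS _ (hw1 N), hw3 σ hσ]

/-- From a single block only the index `min S` acts, so the jump rates out of the initial state are
`q`. -/
theorem genM_one_left (q : Comp S → ℝ) {γ : Comp S} (hγ : γ ≠ Comp.one S hS) :
    genM hS q (Comp.one S hS) γ = q γ := by
  unfold genM
  simp only [Comp.frag_one_left]
  rw [Finset.sum_eq_single (⟨S.min' hS, S.min'_mem hS⟩ : S)]
  · simp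
  · intro k _ hk
    refine Finset.sum_eq_zero fun x _ => ?_
    rw [Function.update_of_ne hk.symm, if_neg hγ.symm, mul_zero]
  · simp

/-- A continuous semigroup of fragmentation kernels is the chain with rates the derivative at the
origin of its weights. -/
theorem exists_rates {p : ℝ → Comp S → ℝ} (hp1 : ∀ t, ∑ x, p t x = 1)
    (hp0 : p 0 = fun x => if x = Comp.one S hS then (1 : ℝ) else 0)
    (hc : ∀ x, Continuous fun t => p t x)
    (hmul : ∀ s t, 0 ≤ s → 0 ≤ t → ∀ x, p (s + t) x = ∑ y, p s y * Fr (p t) y x) :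
    ∃ q : Comp S → ℝ, (∀ x, HasDerivWithinAt (fun h => p h x) (q x) (Set.Ioi 0) 0) ∧
      ∀ r, 0 < r → Fr (p r) = chain hS q r := by
  have := linftyOp_normOneClass hS
  have hK0 : Fr (p 0) = 1 := by rw [hp0, Fr_single]
  -- The hypothesis concerns the row at the one-block composition only; `Fr_mul_Fr` extends it to
  -- the whole matrices.
  have hsemi : ∀ s t, 0 ≤ s → 0 ≤ t → Fr (p (s + t)) = Fr (p s) * Fr (p t) := fun s t hs ht => by
    rw [Fr_mul_Fr _ _ (hp1 t), ← funext (hmul s t hs ht)]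
  have hcont : Continuous fun t => Fr (p t) :=
    continuous_iff_continuousAt.2 fun t => tendsto_Fr fun x => (hc x).continuousAt
  obtain ⟨Q, hQ⟩ := exists_generator hcont hK0 hsemi
  have hder : ∀ x, HasDerivWithinAt (fun h => p h x) (Q (Comp.one S hS) x) (Set.Ioi 0) 0 := by
    intro x
    rw [hasDerivWithinAt_iff_tendsto_slope' (by simp)]
    refine (tendsto_entry hQ (Comp.one S hS) x).congr fun h => ?_
    rw [slope_def_field]
    simp only [sub_zero, Matrix.smul_apply, Matrix.sub_apply, smul_eq_mul, div_eq_inv_mul]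
    rw [Fr_one_left hS _ (hp1 h), ← hK0, Fr_one_left hS _ (hp1 0)]
  refine ⟨fun x => Q (Comp.one S hS) x, hder, fun r hr => ?_⟩
  -- By the semigroup property the powers `Fr (p (r / N)) ^ N` are all equal to `Fr (p r)`, so their
  -- limit identifies it.
  have hlim := tendsto_pow_chain hS (V := fun h => Fr (p h))
    (fun γ γ' => hasDerivWithinAt_Fr hS hder hp0 γ γ') hK0 hr
  refine tendsto_nhds_unique (tendsto_const_nhds.congr' ?_) hlim
  filter_upwards [eventually_gt_atTop 0] with N hN
  have hpow : ∀ h, 0 ≤ h → ∀ N : ℕ, Fr (p h) ^ N = Fr (p (N * h)) := by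
    intro h hh N
    induction N with
    | zero => simp [hK0]
    | succ N ih =>
      rw [pow_succ, ih, ← hsemi _ _ (by positivity) hh]
      congr 2; push_cast; ring
  have hN' : (0 : ℝ) < N := by exact_mod_cast hN
  rw [hpow _ (by positivity), mul_div_cancel₀ _ hN'.ne']

end Kernels

/-! ## A criterion for the Markov property -/

section Markov

variable {Ω : Type*} {m F m0 : MeasurableSpace Ω} {P : Measure Ω} [IsProbabilityMeasure P]

theorem integrable_indicator_one {B : Set Ω} (hB : MeasurableSet B) :
    Integrable (B.indicator (fun _ => (1 : ℝ))) P :=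
  (integrable_const 1).indicator hB

/-- Both sides are the integral of the product of the two conditional probabilities: conditioning on
`m` is self-adjoint. -/
theorem setIntegral_condExp_symm (hm : m ≤ m0) {B D : Set Ω} (hB : MeasurableSet B)
    (hD : MeasurableSet D) :
    ∫ ω in D, (P[B.indicator (fun _ => (1 : ℝ)) | m]) ω ∂P =
      ∫ ω in B, (P[D.indicator (fun _ => (1 : ℝ)) | m]) ω ∂P := by
  have key : ∀ {B D : Set Ω}, MeasurableSet B → MeasurableSet D →
      ∫ ω in D, (P[B.indicator (fun _ => (1 : ℝ)) | m]) ω ∂P =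
        ∫ ω, (P[B.indicator (fun _ => (1 : ℝ)) | m]) ω *
          (P[D.indicator (fun _ => (1 : ℝ)) | m]) ω ∂P := by
    intro B D hB hD
    have hprod : (P[B.indicator (fun _ => (1 : ℝ)) | m]) * D.indicator (fun _ => (1 : ℝ)) =
        D.indicator (P[B.indicator (fun _ => (1 : ℝ)) | m]) := by
      funext ω
      by_cases h : ω ∈ D <;> simp [h]
    have hint : Integrable ((P[B.indicator (fun _ => (1 : ℝ)) | m]) *
        D.indicator (fun _ => (1 : ℝ))) P := by
      rw [hprod]
      exact integrable_condExp.indicator hD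
    have h1 := condExp_mul_of_stronglyMeasurable_left (μ := P)
      (stronglyMeasurable_condExp (m := m) (μ := P) (f := B.indicator (fun _ => (1 : ℝ))))
      hint (integrable_indicator_one hD)
    rw [← integral_indicator hD, ← hprod, ← integral_condExp hm, integral_congr_ae h1]
    rfl
  rw [key hB hD, key hD hB]
  simp only [mul_comm]

/-- The Markov property at the times `s ≤ t` follows from its validity on a generating
π-system. -/
theorem condExp_eq_of_piSystem {E : Type*} [mE : MeasurableSpace E]
    (hmF : m ≤ F) (hF : F ≤ m0) {Y : Ω → E} (hY : Measurable Y) {C : Set (Set E)}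
    (hC : mE = MeasurableSpace.generateFrom C) (hCpi : IsPiSystem C)
    (h : ∀ A ∈ C, ∃ g : Ω → ℝ, StronglyMeasurable[m] g ∧ Integrable g P ∧
      ∀ B, MeasurableSet[F] B → ∫ ω in B, g ω ∂P = P.real (B ∩ Y ⁻¹' A))
    {A : Set E} (hA : MeasurableSet A) :
    P[(Y ⁻¹' A).indicator (fun _ => (1 : ℝ)) | F] =ᵐ[P]
      P[(Y ⁻¹' A).indicator (fun _ => (1 : ℝ)) | m] := by
  have hm : m ≤ m0 := hmF.trans hF
  have hCm : ∀ A ∈ C, MeasurableSet A := fun A hA => by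
    rw [hC]; exact MeasurableSpace.measurableSet_generateFrom hA
  -- Without a regular version, the conditional probability of `Y ∈ A` is not a measure in `A`.
  -- Self-adjointness moves the conditioning onto the fixed event `B`; both sides are then finite
  -- measures in `A`, and they agree on the π-system.
  have hstar : ∀ B, MeasurableSet[F] B → ∀ A, MeasurableSet A →
      ∫ ω in Y ⁻¹' A, (P[B.indicator (fun _ => (1 : ℝ)) | m]) ω ∂P = P.real (B ∩ Y ⁻¹' A) := by
    intro B hB
    have hB0 : MeasurableSet B := hF _ hB
    set f := P[B.indicator (fun _ => (1 : ℝ)) | m] with hf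
    have hf0 : 0 ≤ᵐ[P] f := condExp_nonneg (Eventually.of_forall fun ω =>
      Set.indicator_nonneg (fun _ _ => zero_le_one) ω)
    have hfi : Integrable f P := integrable_condExp
    have hlint : ∀ A, MeasurableSet A → ((P.withDensity fun ω => ENNReal.ofReal (f ω)).map Y) A =
        ENNReal.ofReal (∫ ω in Y ⁻¹' A, f ω ∂P) := by
      intro A hA
      rw [Measure.map_apply hY hA, withDensity_apply _ (hY hA),
        ofReal_integral_eq_lintegral_ofReal hfi.integrableOn (ae_restrict_of_ae hf0)]
    have hbasic : ∀ A ∈ C, ∫ ω in Y ⁻¹' A, f ω ∂P = P.real (B ∩ Y ⁻¹' A) := by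
      intro A hA
      have hYA := hY (hCm A hA)
      obtain ⟨g, hgm, hgi, hg⟩ := h A hA
      rw [hf, setIntegral_condExp_symm hm hB0 hYA, ← hg B hB]
      refine setIntegral_congr_ae hB0 ?_
      have : g =ᵐ[P] P[(Y ⁻¹' A).indicator (fun _ => (1 : ℝ)) | m] := by
        refine ae_eq_condExp_of_forall_setIntegral_eq hm (integrable_indicator_one hYA)
          (fun _ _ _ => hgi.integrableOn) (fun B' hB' _ => ?_) hgm.aestronglyMeasurable
        rw [hg B' (hmF _ hB'), setIntegral_indicator hYA]
        simp
      filter_upwards [this] with ω hω _ using hω.symm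
    have hfin : IsFiniteMeasure (P.withDensity fun ω => ENNReal.ofReal (f ω)) :=
      isFiniteMeasure_withDensity_ofReal hfi.2
    have huniv : ∫ ω, f ω ∂P = P.real B := by
      rw [hf, integral_condExp hm, integral_indicator hB0]
      simp
    have hmeas : ((P.restrict B).map Y) = (P.withDensity fun ω => ENNReal.ofReal (f ω)).map Y := by
      refine ext_of_generate_finite C hC hCpi (fun A hA => ?_) ?_
      · rw [hlint A (hCm A hA), hbasic A hA, Measure.map_apply hY (hCm A hA),
          Measure.restrict_apply (hY (hCm A hA)), Set.inter_comm, ofReal_measureReal]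
      · rw [hlint _ MeasurableSet.univ, Measure.map_apply hY MeasurableSet.univ]
        simp [huniv]
    intro A hA
    have h2 := hlint A hA
    rw [← hmeas, Measure.map_apply hY hA, Measure.restrict_apply (hY hA), Set.inter_comm] at h2
    rw [measureReal_def, h2, ENNReal.toReal_ofReal]
    exact setIntegral_nonneg_of_ae hf0
  have hYA := hY hA
  symm
  refine ae_eq_condExp_of_forall_setIntegral_eq hF (integrable_indicator_one hYA)
    (fun _ _ _ => integrable_condExp.integrableOn) (fun B hB _ => ?_)
    (stronglyMeasurable_condExp.mono hmF).aestronglyMeasurable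
  rw [setIntegral_condExp_symm hm hYA (hF _ hB), hstar B hB A hA, setIntegral_indicator hYA]
  simp

end Markov

/-! ## Generating π-systems of cylinders -/

theorem CInf.measurable_toFin (n : ℕ+) : Measurable (fun γ : CInf => γ.toFin n) :=
  (measurable_pi_apply n).comp measurable_subtype_coe

theorem CInf.ext_toFin {γ γ' : CInf} (h : ∀ n, γ.toFin n = γ'.toFin n) : γ = γ' :=
  Subtype.ext (funext h)

theorem measurable_toCInf {Ω : Type*} [MeasurableSpace Ω] {f : Ω → CInf}
    (h : ∀ n, Measurable fun ω => (f ω).toFin n) : Measurable f :=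
  Measurable.subtype_mk (h := fun ω => (f ω).2) (measurable_pi_lambda _ h)

/-- The cylinder sets of `𝒞`. -/
def cylinders : Set (Set CInf) := {A | ∃ (n : ℕ+) (D : Set (CFin n)), A = {γ | γ.toFin n ∈ D}}

/-- Conditions at two levels are both conditions at the larger level, by restriction. -/
theorem isPiSystem_cylinders : IsPiSystem cylinders := by
  rintro _ ⟨n, D, rfl⟩ _ ⟨m, D', rfl⟩ -
  refine ⟨max n m, {x | x.restrict (seg_subset (le_max_left n m)) ∈ D ∧
    x.restrict (seg_subset (le_max_right n m)) ∈ D'}, ?_⟩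
  ext γ
  have e1 := γ.restrict_toFin (le_max_left n m)
  have e2 := γ.restrict_toFin (le_max_right n m)
  change _ ↔ (γ.toFin (max n m)).restrict _ ∈ D ∧ (γ.toFin (max n m)).restrict _ ∈ D'
  rw [e1, e2]
  rfl

theorem generateFrom_cylinders :
    (inferInstance : MeasurableSpace CInf) = MeasurableSpace.generateFrom cylinders := by
  refine le_antisymm ?_ ?_
  · have : @Measurable CInf CInf (MeasurableSpace.generateFrom cylinders) _ id := by
      let _ : MeasurableSpace CInf := MeasurableSpace.generateFrom cylinders
      refine @measurable_toCInf CInf (MeasurableSpace.generateFrom cylinders) id fun n => ?_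
      intro D _
      exact MeasurableSpace.measurableSet_generateFrom ⟨n, D, rfl⟩
    exact fun A hA => this hA
  · refine MeasurableSpace.generateFrom_le ?_
    rintro _ ⟨n, D, rfl⟩
    exact CInf.measurable_toFin n (MeasurableSpace.measurableSet_top (s := D))


/-! ## Existence of Poisson random measures -/

theorem iIndepFun_comp_measurePreserving {Ω Ω' ι : Type*} [MeasurableSpace Ω] [MeasurableSpace Ω']
    {P : Measure Ω} {P' : Measure Ω'} {β : ι → Type*} [∀ i, MeasurableSpace (β i)]
    {X : ∀ i, Ω → β i} {T : Ω' → Ω} (hT : MeasurePreserving T P' P) (hX : ∀ i, Measurable (X i))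
    (h : iIndepFun X P) : iIndepFun (fun i ω => X i (T ω)) P' := by
  rw [iIndepFun_iff_measure_inter_preimage_eq_mul] at h ⊢
  intro s sets hs
  have h1 := h s hs
  have e : ∀ A, MeasurableSet A → P' (T ⁻¹' A) = P A := fun A hA =>
    hT.measure_preimage hA.nullMeasurableSet
  rw [← e _ (s.measurableSet_biInter fun i hi => hX i (hs i hi))] at h1
  rw [Finset.prod_congr rfl fun i hi => (e _ (hX i (hs i hi))).symm] at h1
  simp only [Set.preimage_iInter] at h1
  exact h1

/-! ### A Poisson number of i.i.d. points: the case of a finite intensity. -/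

section Cell

variable {E : Type} [MeasurableSpace E]

/-- A Poisson number of i.i.d. points. -/
def cellLaw (r : ℝ≥0) (π : Measure E) : Measure (ℕ × (ℕ → E)) :=
  (poissonMeasure r).prod (Measure.infinitePi fun _ : ℕ => π)

/-- The point measure of the first `N` points. -/
def cellMeasure (ω : ℕ × (ℕ → E)) : Measure E := ∑ i ∈ Finset.range ω.1, Measure.dirac (ω.2 i)

/-- The number of points in a set. -/
def cellCount (A : Set E) (ω : ℕ × (ℕ → E)) : ℝ :=
  ∑ i ∈ Finset.range ω.1, A.indicator (fun _ => (1 : ℝ)) (ω.2 i)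

theorem measurable_cell {G : Type*} [MeasurableSpace G] {f : ℕ × (ℕ → E) → G}
    (h : ∀ N, Measurable fun x => f (N, x)) : Measurable f :=
  measurable_from_prod_countable_right h

theorem measurable_cellCount {A : Set E} (hA : MeasurableSet A) : Measurable (cellCount A) :=
  measurable_cell fun N => Finset.measurable_sum (Finset.range N) fun i _ =>
    (measurable_const.indicator hA).comp (measurable_pi_apply (X := fun _ : ℕ => E) i)

theorem cellMeasure_apply {A : Set E} (hA : MeasurableSet A) (ω : ℕ × (ℕ → E)) :
    cellMeasure ω A = ENNReal.ofReal (cellCount A ω) := by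
  unfold cellMeasure cellCount
  rw [Measure.finsetSum_apply, ENNReal.ofReal_sum_of_nonneg
    fun i _ => Set.indicator_nonneg (fun _ _ => zero_le_one) _]
  refine Finset.sum_congr rfl fun i _ => ?_
  rw [Measure.dirac_apply' _ hA]
  by_cases h : ω.2 i ∈ A <;> simp [h]

theorem cellMeasure_integer {A : Set E} (hA : MeasurableSet A) (ω : ℕ × (ℕ → E)) :
    ∃ k : ℕ, cellMeasure ω A = k := by
  classical
  refine ⟨((Finset.range ω.1).filter fun i => ω.2 i ∈ A).card, ?_⟩
  unfold cellMeasure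
  rw [Measure.finsetSum_apply, Finset.card_filter]
  push_cast
  refine Finset.sum_congr rfl fun i _ => ?_
  rw [Measure.dirac_apply' _ hA]
  by_cases h : ω.2 i ∈ A <;> simp [h]

variable (r : ℝ≥0) (π : Measure E) [IsProbabilityMeasure π]

instance : IsProbabilityMeasure (cellLaw r π) := by unfold cellLaw; infer_instance

/-- Given the number `N` of points the expectation is `z ^ N`, with `z` the integral of `g`; the
generating function of the Poisson law does the rest. -/
theorem integral_cell_prod {g : E → ℂ} (hg : Measurable g) (hb : ∀ x, ‖g x‖ ≤ 1) :
    ∫ ω, ∏ i ∈ Finset.range ω.1, g (ω.2 i) ∂(cellLaw r π) =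
      Complex.exp (r * (∫ x, g x ∂π - 1)) := by
  have hmeas : Measurable fun ω : ℕ × (ℕ → E) => ∏ i ∈ Finset.range ω.1, g (ω.2 i) :=
    measurable_cell fun N => Finset.measurable_prod (Finset.range N) fun i _ =>
      hg.comp (measurable_pi_apply (X := fun _ : ℕ => E) i)
  have hint : Integrable (fun ω : ℕ × (ℕ → E) => ∏ i ∈ Finset.range ω.1, g (ω.2 i))
      (cellLaw r π) := by
    refine Integrable.of_bound hmeas.aestronglyMeasurable 1 (Eventually.of_forall fun ω => ?_)
    rw [norm_prod]
    exact Finset.prod_le_one (fun _ _ => norm_nonneg _) fun i _ => hb _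
  unfold cellLaw at hint ⊢
  rw [integral_prod _ hint]
  have hinner : ∀ N : ℕ, ∫ x : ℕ → E, ∏ i ∈ Finset.range N, g (x i)
      ∂(Measure.infinitePi fun _ : ℕ => π) = (∫ x, g x ∂π) ^ N := by
    intro N
    have hind : iIndepFun (fun (i : ℕ) (x : ℕ → E) => x i) (Measure.infinitePi fun _ : ℕ => π) :=
      iIndepFun_infinitePi (X := fun _ x => x) fun _ => measurable_id
    have h1 := (hind.precomp (g := fun i : Fin N => (i : ℕ)) Fin.val_injective)
      |>.integral_fun_prod_comp (f := fun _ => g) (fun i => (measurable_pi_apply _).aemeasurable)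
      (fun i => hg.aestronglyMeasurable)
    have h2 : ∀ i : ℕ, ∫ x : ℕ → E, g (x i) ∂(Measure.infinitePi fun _ : ℕ => π) = ∫ x, g x ∂π := by
      intro i
      have h3 := integral_map (μ := Measure.infinitePi fun _ : ℕ => π)
        (measurable_pi_apply i).aemeasurable (f := g) hg.aestronglyMeasurable
      rw [← h3, Measure.infinitePi_map_eval]
    calc ∫ x : ℕ → E, ∏ i ∈ Finset.range N, g (x i) ∂(Measure.infinitePi fun _ : ℕ => π)
        = ∫ x : ℕ → E, ∏ i : Fin N, g (x i) ∂(Measure.infinitePi fun _ : ℕ => π) := by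
          congr 1; funext x
          exact (Fin.prod_univ_eq_prod_range (fun i => g (x i)) N).symm
      _ = _ := by rw [h1]; simp [h2]
  simp only [hinner]
  rw [integral_poissonMeasure]
  set z := ∫ x, g x ∂π
  calc ∑' n : ℕ, (Real.exp (-r) * r ^ n / n.factorial) • z ^ n
      = ∑' n : ℕ, (Real.exp (-r) : ℂ) * ((r * z) ^ n / n.factorial) := by
        congr with n
        rw [Complex.real_smul]
        push_cast
        rw [mul_pow]
        ring
    _ = (Real.exp (-r) : ℂ) * Complex.exp (r * z) := by
        rw [tsum_mul_left, (NormedSpace.expSeries_div_hasSum_exp ((r : ℂ) * z)).tsum_eq,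
          Complex.exp_eq_exp_ℂ]
    _ = Complex.exp (r * (z - 1)) := by
        rw [Complex.ofReal_exp, ← Complex.exp_add]
        push_cast
        ring_nf

/-- The joint characteristic function of the counts is the expectation of a product over the points.
Its factorization gives at once the Poisson laws and the independence of counts in disjoint sets. -/
theorem integral_exp_cellCount {m : ℕ} {A : Fin m → Set E} (hA : ∀ l, MeasurableSet (A l))
    (hd : Pairwise fun l l' => Disjoint (A l) (A l')) (t : Fin m → ℝ) :
    ∫ ω, Complex.exp ((∑ l, t l * cellCount (A l) ω : ℝ) * Complex.I) ∂(cellLaw r π) =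
      ∏ l, Complex.exp (r * π.real (A l) * (Complex.exp (t l * Complex.I) - 1)) := by
  let g : E → ℂ := fun x =>
    Complex.exp ((∑ l, t l * (A l).indicator (fun _ => (1 : ℝ)) x : ℝ) * Complex.I)
  have hg : Measurable g := by
    have : Measurable fun x => ∑ l, t l * (A l).indicator (fun _ => (1 : ℝ)) x :=
      Finset.measurable_sum _ fun l _ => (measurable_const.indicator (hA l)).const_mul _
    fun_prop
  -- The sets are disjoint, so at most one term of the sum is non-zero at each point.
  have hg1 : ∀ x, g x = 1 + ∑ l, (A l).indicator (fun _ => Complex.exp (t l * Complex.I) - 1) x := by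
    intro x
    by_cases hx : ∃ l, x ∈ A l
    · obtain ⟨l, hl⟩ := hx
      have hne : ∀ l', l' ≠ l → x ∉ A l' := fun l' h hx' =>
        Set.disjoint_left.1 (hd h) hx' hl
      simp only [g]
      rw [Finset.sum_eq_single l, Finset.sum_eq_single l]
      · simp [hl]
      · intro l' _ h; simp [hne l' h]
      · simp
      · intro l' _ h; simp [hne l' h]
      · simp
    · push Not at hx
      simp [g, hx]
  have hprod : ∀ ω : ℕ × (ℕ → E), Complex.exp ((∑ l, t l * cellCount (A l) ω : ℝ) * Complex.I) =
      ∏ i ∈ Finset.range ω.1, g (ω.2 i) := by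
    intro ω
    simp only [g, cellCount]
    rw [← Complex.exp_sum, ← Finset.sum_mul, ← Complex.ofReal_sum, Finset.sum_comm]
    simp only [Finset.mul_sum]
  simp only [hprod]
  rw [integral_cell_prod r π hg (fun x => by
    simp only [g]; rw [Complex.norm_exp_ofReal_mul_I]), ← Complex.exp_sum]
  congr 1
  have hI : ∀ l, Integrable ((A l).indicator fun _ => Complex.exp (t l * Complex.I) - 1) π :=
    fun l => (integrable_const _).indicator (hA l)
  have : ∫ x, g x ∂π = 1 + ∑ l, (π.real (A l) : ℂ) * (Complex.exp (t l * Complex.I) - 1) := by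
    simp only [hg1]
    rw [integral_add (integrable_const _) (integrable_finsetSum _ fun l _ => hI l),
      integral_finsetSum _ fun l _ => hI l]
    congr 1
    · simp
    · refine Finset.sum_congr rfl fun l _ => ?_
      rw [integral_indicator (hA l), setIntegral_const, Complex.real_smul]
  rw [this, add_sub_cancel_left, Finset.mul_sum]
  exact Finset.sum_congr rfl fun l _ => by ring

theorem map_cellCount {A : Set E} (hA : MeasurableSet A) :
    (cellLaw r π).map (cellCount A) =
      (poissonMeasure (r * (π A).toNNReal)).map (Nat.cast : ℕ → ℝ) := by
  have := Measure.isProbabilityMeasure_map (μ := cellLaw r π) (measurable_cellCount hA).aemeasurable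
  refine Measure.ext_of_charFun ?_
  ext t
  rw [charFun_map_cast_poissonMeasure, charFun_apply_real,
    integral_map (measurable_cellCount hA).aemeasurable (by fun_prop)]
  have h := integral_exp_cellCount r π (A := fun _ : Fin 1 => A) (fun _ => hA)
    (fun l l' h => absurd (Subsingleton.elim l l') h) (fun _ => t)
  simp only [Finset.univ_unique, Finset.sum_singleton, Finset.prod_singleton] at h
  push_cast at h ⊢
  rw [h]
  rfl

theorem iIndepFun_cellCount {m : ℕ} {A : Fin m → Set E} (hA : ∀ l, MeasurableSet (A l))
    (hd : Pairwise fun l l' => Disjoint (A l) (A l')) :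
    iIndepFun (fun l => cellCount (A l)) (cellLaw r π) := by
  rw [iIndepFun_iff_charFun_pi fun l => (measurable_cellCount (hA l)).aemeasurable]
  intro t
  have hm : Measurable fun ω => WithLp.toLp 2 fun l => cellCount (A l) ω :=
    (WithLp.measurable_toLp 2 _).comp
      (measurable_pi_lambda _ fun l => measurable_cellCount (hA l))
  rw [charFun_apply, integral_map hm.aemeasurable (by fun_prop)]
  have h := integral_exp_cellCount r π hA hd t.ofLp
  simp only [PiLp.inner_apply, Real.inner_apply]
  simp only [mul_comm] at h ⊢
  rw [h]
  refine Finset.prod_congr rfl fun l _ => ?_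
  rw [map_cellCount r π (hA l), charFun_map_cast_poissonMeasure]
  congr 1
  push_cast
  rw [measureReal_def]
  simp only [mul_comm]

end Cell

/-! ### Sums of independent Poisson variables -/

/-- `x` is a natural number or `∞`. -/
def IsENat (x : ℝ≥0∞) : Prop := ∃ k : ℕ∞, x = (k : ℝ≥0∞)

theorem isENat_natCast (k : ℕ) : IsENat k := ⟨k, by simp⟩

theorem isENat_tsum {a : ℕ → ℝ≥0∞} (h : ∀ j, IsENat (a j)) : IsENat (∑' j, a j) := by
  choose k hk using h
  refine ⟨⨆ n, ∑ j ∈ Finset.range n, k j, ?_⟩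
  rw [ENNReal.tsum_eq_iSup_nat, ENat.toENNReal_iSup]
  congr 1
  funext n
  rw [Finset.sum_congr rfl fun j _ => hk j]
  exact (map_sum ENat.toENNRealRingHom k (Finset.range n)).symm

/-- Thresholds can be rounded down to integers, so the sets `{X ≤ k}` with `k` natural determine the
law. -/
theorem IsENat.le_iff {x a : ℝ≥0∞} (hx : IsENat x) (ha : a ≠ ∞) :
    x ≤ a ↔ x ≤ (⌊a.toReal⌋₊ : ℝ≥0∞) := by
  obtain ⟨k, rfl⟩ := hx
  induction k using ENat.recTopCoe with
  | top => simp [ha]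
  | coe k =>
    rw [ENat.toENNReal_coe, Nat.cast_le, Nat.le_floor_iff ENNReal.toReal_nonneg,
      ← ENNReal.toReal_natCast, ENNReal.toReal_le_toReal (by simp) ha]

theorem IsENat.eq_top {x : ℝ≥0∞} (hx : IsENat x) (h : ∀ k : ℕ, ¬ x ≤ k) : x = ∞ := by
  obtain ⟨k, rfl⟩ := hx
  induction k using ENat.recTopCoe with
  | top => simp
  | coe k => exact absurd (by simp) (h k)

theorem IsENat.one_le {x : ℝ≥0∞} (hx : IsENat x) (h : x ≠ 0) : 1 ≤ x := by
  obtain ⟨k, rfl⟩ := hx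
  have : k ≠ 0 := by rintro rfl; simp at h
  exact_mod_cast Order.one_le_iff_ne_zero.2 this

theorem poissonMeasure_Iic (r : ℝ≥0) (k : ℕ) : poissonMeasure r (Set.Iic k) =
    ∑ n ∈ Finset.range (k + 1), ENNReal.ofReal (Real.exp (-r) * r ^ n / n.factorial) := by
  have : (Set.Iic k : Set ℕ) = ↑(Finset.range (k + 1)) := by ext n; simp
  rw [this, ← sum_measure_singleton]
  simp only [poissonMeasure_singleton]

theorem tendsto_poissonMeasure_Iic {r : ℕ → ℝ≥0} {r' : ℝ≥0} (h : Tendsto r atTop (𝓝 r')) (k : ℕ) :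
    Tendsto (fun n => poissonMeasure (r n) (Set.Iic k)) atTop
      (𝓝 (poissonMeasure r' (Set.Iic k))) := by
  simp only [poissonMeasure_Iic]
  have h' : Tendsto (fun n => (r n : ℝ)) atTop (𝓝 r') := NNReal.tendsto_coe.2 h
  refine tendsto_finsetSum _ fun n _ => ENNReal.tendsto_ofReal ?_
  exact (((Real.continuous_exp.tendsto _).comp h'.neg).mul (h'.pow n)).div_const _

theorem tendsto_poissonMeasure_Iic_atTop {r : ℕ → ℝ≥0} (h : Tendsto (fun n => (r n : ℝ)) atTop atTop)
    (k : ℕ) : Tendsto (fun n => poissonMeasure (r n) (Set.Iic k)) atTop (𝓝 0) := by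
  simp only [poissonMeasure_Iic]
  have h0 : (0 : ℝ≥0∞) = ∑ n ∈ Finset.range (k + 1), ENNReal.ofReal (0 / n.factorial) := by simp
  rw [h0]
  refine tendsto_finsetSum _ fun n _ => ENNReal.tendsto_ofReal ?_
  refine Tendsto.div_const ?_ _
  refine ((Real.tendsto_pow_mul_exp_neg_atTop_nhds_zero n).comp h).congr fun m => ?_
  simp [mul_comm]

theorem map_natCast_Iic (μ : Measure ℕ) (k : ℕ) :
    μ.map (Nat.cast : ℕ → ℝ≥0∞) (Set.Iic (k : ℝ≥0∞)) = μ (Set.Iic k) := by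
  rw [Measure.map_apply .of_discrete measurableSet_Iic]
  congr 1
  ext n
  simp

theorem measurable_finset_sum {Ω : Type*} [MeasurableSpace Ω] {X : ℕ → Ω → ℝ≥0∞}
    (hX : ∀ j, Measurable (X j)) (n : ℕ) : Measurable (∑ j ∈ Finset.range n, X j) := by
  have h : (∑ j ∈ Finset.range n, X j) = fun ω => ∑ j ∈ Finset.range n, X j ω := by
    funext ω; simp
  rw [h]
  exact Finset.measurable_sum _ fun j _ => hX j

section Sum

variable {Ω : Type*} [MeasurableSpace Ω] {P : Measure Ω} [IsProbabilityMeasure P]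

/-- Laws of `ℕ∞`-valued variables are determined by their values on the sets `{0, …, k}`. -/
theorem map_eq_of_Iic {X : Ω → ℝ≥0∞} (hX : Measurable X) (hint : ∀ ω, IsENat (X ω)) (r : ℝ≥0)
    (h : ∀ k : ℕ, P {ω | X ω ≤ k} = poissonMeasure r (Set.Iic k)) :
    P.map X = (poissonMeasure r).map (fun k : ℕ => (k : ℝ≥0∞)) := by
  have := Measure.isProbabilityMeasure_map (μ := P) hX.aemeasurable
  have := Measure.isProbabilityMeasure_map (μ := poissonMeasure r)
    (f := fun k : ℕ => (k : ℝ≥0∞)) .of_discrete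
  refine Measure.ext_of_Iic _ _ fun a => ?_
  by_cases ha : a = ∞
  · subst ha
    simp
  · have e1 : P.map X (Set.Iic a) = P {ω | X ω ≤ (⌊a.toReal⌋₊ : ℝ≥0∞)} := by
      rw [Measure.map_apply hX measurableSet_Iic]
      congr 1
      ext ω
      exact (hint ω).le_iff ha
    have e2 : (poissonMeasure r).map (fun k : ℕ => (k : ℝ≥0∞)) (Set.Iic a) =
        (poissonMeasure r).map (fun k : ℕ => (k : ℝ≥0∞)) (Set.Iic (⌊a.toReal⌋₊ : ℝ≥0∞)) := by
      rw [Measure.map_apply .of_discrete measurableSet_Iic,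
        Measure.map_apply .of_discrete measurableSet_Iic]
      congr 1
      ext n
      exact (isENat_natCast n).le_iff ha
    rw [e1, e2, h, map_natCast_Iic]

variable {X : ℕ → Ω → ℝ≥0∞} (hX : ∀ j, Measurable (X j)) (hint : ∀ j ω, IsENat (X j ω))
  (hind : iIndepFun X P) {r : ℕ → ℝ≥0}
  (hlaw : ∀ j, P.map (X j) = (poissonMeasure (r j)).map (fun k : ℕ => (k : ℝ≥0∞)))
include hX hind hlaw

theorem map_sum_poisson (n : ℕ) : P.map (∑ j ∈ Finset.range n, X j) =
    (poissonMeasure (∑ j ∈ Finset.range n, r j)).map (fun k : ℕ => (k : ℝ≥0∞)) := by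
  induction n with
  | zero =>
    simp only [Finset.range_zero, Finset.sum_empty]
    -- The empty sum is 0, which is Poisson with parameter 0.
    have h0 : poissonMeasure 0 = Measure.dirac 0 := by
      refine Measure.ext_of_singleton fun n => ?_
      rw [poissonMeasure_singleton]
      cases n <;> simp
    rw [h0, Measure.map_dirac' .of_discrete]
    change P.map (fun _ => (0 : ℝ≥0∞)) = _
    rw [Measure.map_const]
    simp
  | succ n ih =>
    rw [Finset.sum_range_succ, Finset.sum_range_succ]
    have h1 : HasLaw (∑ j ∈ Finset.range n, X j)
        ((poissonMeasure (∑ j ∈ Finset.range n, r j)).map (Nat.cast : ℕ → ℝ≥0∞)) P :=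
      ⟨(measurable_finset_sum hX n).aemeasurable, ih⟩
    have h2 : HasLaw (X n) ((poissonMeasure (r n)).map (Nat.cast : ℕ → ℝ≥0∞)) P :=
      ⟨(hX n).aemeasurable, hlaw n⟩
    exact ((hind.indepFun_sum_range_succ hX n).hasLaw_add_map_cast_poissonMeasure h1 h2).map_eq

/-- The event that the whole sum is at most `k` is the decreasing intersection of the same events
for the partial sums. This treats finite and infinite total parameters together. -/
theorem tendsto_poisson_sum_Iic (k : ℕ) :
    Tendsto (fun n => poissonMeasure (∑ j ∈ Finset.range n, r j) (Set.Iic k)) atTop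
      (𝓝 (P {ω | ∑' j, X j ω ≤ k})) := by
  have hm : ∀ n, Measurable (∑ j ∈ Finset.range n, X j) := fun n =>
    measurable_finset_sum hX n
  have h1 : ∀ n, poissonMeasure (∑ j ∈ Finset.range n, r j) (Set.Iic k) =
      P {ω | (∑ j ∈ Finset.range n, X j) ω ≤ k} := by
    intro n
    rw [← map_natCast_Iic, ← map_sum_poisson hX hind hlaw n,
      Measure.map_apply (hm n) measurableSet_Iic]
    rfl
  simp only [h1]
  have h2 : {ω | ∑' j, X j ω ≤ k} = ⋂ n, {ω | (∑ j ∈ Finset.range n, X j) ω ≤ k} := by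
    ext ω
    simp [ENNReal.tsum_eq_iSup_nat]
  rw [h2]
  refine tendsto_measure_iInter_atTop (fun n => ?_) ?_ ⟨0, measure_ne_top _ _⟩
  · exact (measurableSet_le (hm n) measurable_const).nullMeasurableSet
  · intro n m hnm ω hω
    have hω' : (∑ j ∈ Finset.range m, X j) ω ≤ k := hω
    change (∑ j ∈ Finset.range n, X j) ω ≤ k
    refine le_trans ?_ hω'
    simp only [Finset.sum_apply]
    exact Finset.sum_le_sum_of_subset (Finset.range_mono hnm)

include hint

theorem map_tsum_poisson {r' : ℝ≥0} (hr : ∑' j, (r j : ℝ≥0∞) = r') :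
    P.map (fun ω => ∑' j, X j ω) = (poissonMeasure r').map (fun k : ℕ => (k : ℝ≥0∞)) := by
  refine map_eq_of_Iic (Measurable.tsum hX)
    (fun ω => isENat_tsum fun j => hint j ω) r' fun k => ?_
  have hs : Tendsto (fun n => ∑ j ∈ Finset.range n, r j) atTop (𝓝 r') := by
    have h := ENNReal.tendsto_nat_tsum (fun j => (r j : ℝ≥0∞))
    rw [hr] at h
    exact_mod_cast h
  exact tendsto_nhds_unique (tendsto_poisson_sum_Iic hX hind hlaw k)
    (tendsto_poissonMeasure_Iic hs k)

/-- A Poisson law whose parameter tends to infinity gives vanishing mass to each `{0, …, k}`. -/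
theorem tsum_poisson_eq_top (hr : ∑' j, (r j : ℝ≥0∞) = ∞) : ∀ᵐ ω ∂P, ∑' j, X j ω = ∞ := by
  have h0 : ∀ k : ℕ, P {ω | ∑' j, X j ω ≤ k} = 0 := by
    intro k
    have hs : Tendsto (fun n => ((∑ j ∈ Finset.range n, r j : ℝ≥0) : ℝ)) atTop atTop := by
      have h := ENNReal.tendsto_nat_tsum (fun j => (r j : ℝ≥0∞))
      rw [hr] at h
      rw [NNReal.tendsto_coe_atTop, ← ENNReal.tendsto_coe_nhds_top]
      exact_mod_cast h
    exact tendsto_nhds_unique (tendsto_poisson_sum_Iic hX hind hlaw k)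
      (tendsto_poissonMeasure_Iic_atTop hs k)
  have : ∀ᵐ ω ∂P, ∀ k : ℕ, ¬ ∑' j, X j ω ≤ k := by
    rw [ae_all_iff]
    intro k
    rw [ae_iff]
    simpa using h0 k
  filter_upwards [this] with ω hω
  exact (isENat_tsum fun j => hint j ω).eq_top hω

end Sum

/-! ### The construction -/

section Construction

variable {E : Type} [MeasurableSpace E]

/-- Independent rows with independent entries make all entries of the array independent; regrouping
them by columns makes the column sums independent. -/
theorem iIndepFun_tsum_prod {Ω : Type*} [MeasurableSpace Ω] {P : Measure Ω}
    {m : ℕ} {X : ℕ → Fin m → Ω → ℝ≥0∞} (hX : ∀ j l, Measurable (X j l))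
    (h1 : iIndepFun (fun j ω l => X j l ω) P) (h2 : ∀ j, iIndepFun (X j) P) :
    iIndepFun (fun l ω => ∑' j, X j l ω) P := by
  have := h1.isProbabilityMeasure
  have h3 := iIndepFun_uncurry' hX h1 h2
  have h4 : iIndepFun (fun (p : (_ : Fin m) × ℕ) ω => X p.2 p.1 ω) P :=
    h3.precomp (g := fun p : (_ : Fin m) × ℕ => (p.2, p.1)) (by
      rintro ⟨a, b⟩ ⟨c, d⟩ h
      simp only [Prod.mk.injEq] at h
      obtain ⟨rfl, rfl⟩ := h
      rfl)
  have : ∀ l j, IsProbabilityMeasure (P.map (X j l)) := fun l j =>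
    Measure.isProbabilityMeasure_map (hX j l).aemeasurable
  have h5 : iIndepFun (fun (l : Fin m) ω (j : ℕ) => X j l ω) P := by
    have hm : ∀ l : Fin m, Measurable fun ω (j : ℕ) => X j l ω := fun l =>
      measurable_pi_lambda _ fun j => hX j l
    rw [iIndepFun_iff_map_fun_eq_infinitePi_map hm]
    have h6 := (iIndepFun_iff_map_fun_eq_infinitePi_map
      (X := fun (p : (_ : Fin m) × ℕ) ω => X p.2 p.1 ω) fun p => hX p.2 p.1).1 h4
    have hm' : Measurable fun ω (p : (_ : Fin m) × ℕ) => X p.2 p.1 ω :=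
      measurable_pi_lambda _ fun p => hX p.2 p.1
    have h7 : (fun ω (l : Fin m) (j : ℕ) => X j l ω) =
        (MeasurableEquiv.piCurry fun (_ : Fin m) (_ : ℕ) => ℝ≥0∞) ∘
          (fun ω (p : (_ : Fin m) × ℕ) => X p.2 p.1 ω) := by
      funext ω; rfl
    rw [h7, ← Measure.map_map (MeasurableEquiv.measurable _) hm', h6,
      Measure.infinitePi_map_piCurry (fun (l : Fin m) (j : ℕ) => P.map (X j l))]
    congr 1
    funext l
    have h8 : iIndepFun (fun j ω => X j l ω) P :=
      h4.precomp (g := fun j : ℕ => (⟨l, j⟩ : (_ : Fin m) × ℕ)) (by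
        intro a b h; simpa using h)
    exact ((iIndepFun_iff_map_fun_eq_infinitePi_map fun j => hX j l).1 h8).symm
  exact h5.comp (fun _ (x : ℕ → ℝ≥0∞) => ∑' j, x j)
    (fun _ => Measurable.tsum fun j => measurable_pi_apply j)

theorem IsPoissonMeasure.comp {Ω Ω' : Type*} [MeasurableSpace Ω] [MeasurableSpace Ω']
    {P : Measure Ω} {P' : Measure Ω'} {M : Ω → Measure E} {ν : Measure E} {T : Ω' → Ω}
    (h : IsPoissonMeasure M ν P) (hT : MeasurePreserving T P' P) :
    IsPoissonMeasure (fun ω => M (T ω)) ν P' where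
  measurable A hA := (h.measurable A hA).comp hT.measurable
  integer_valued ω A hA := h.integer_valued (T ω) A hA
  poisson A hA hν := by
    rw [← h.poisson A hA hν, ← hT.map_eq, Measure.map_map (h.measurable A hA) hT.measurable]
    rfl
  infinite A hA hν := hT.quasiMeasurePreserving.ae (h.infinite A hA hν)
  indep m A hA hd := iIndepFun_comp_measurePreserving hT
    (fun i => h.measurable (A i) (hA i)) (h.indep m A hA hd)

theorem measurable_cellMeasure {A : Set E} (hA : MeasurableSet A) :
    Measurable fun w : ℕ × (ℕ → E) => cellMeasure w A := by
  simp only [cellMeasure_apply hA]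
  exact (measurable_cellCount hA).ennreal_ofReal

theorem iIndepFun_pi_cellMeasure (r : ℕ → ℝ≥0) (π : ℕ → Measure E)
    [∀ j, IsProbabilityMeasure (π j)] {m : ℕ} {A : Fin m → Set E}
    (hA : ∀ l, MeasurableSet (A l)) :
    iIndepFun (fun j (ω : ℕ → ℕ × (ℕ → E)) l => cellMeasure (ω j) (A l))
      (Measure.infinitePi fun j => cellLaw (r j) (π j)) := by
  have hm : Measurable fun (w : ℕ × (ℕ → E)) (l : Fin m) => cellMeasure w (A l) :=
    measurable_pi_lambda _ fun l => measurable_cellMeasure (hA l)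
  exact iIndepFun_infinitePi (P := fun j => cellLaw (r j) (π j))
    (X := fun _ w l => cellMeasure w (A l)) fun _ => hm

theorem iIndepFun_tsum_cellMeasure (r : ℕ → ℝ≥0) (π : ℕ → Measure E)
    [∀ j, IsProbabilityMeasure (π j)] {m : ℕ} {A : Fin m → Set E}
    (hA : ∀ l, MeasurableSet (A l)) (hd : Pairwise fun l l' => Disjoint (A l) (A l')) :
    iIndepFun (fun l (ω : ℕ → ℕ × (ℕ → E)) => ∑' j, cellMeasure (ω j) (A l))
      (Measure.infinitePi fun j => cellLaw (r j) (π j)) := by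
  have h0 := iIndepFun_pi_cellMeasure r π hA
  refine iIndepFun_tsum_prod (X := fun j l (ω : ℕ → ℕ × (ℕ → E)) => cellMeasure (ω j) (A l))
    (fun j l => (measurable_cellMeasure (hA l)).comp (measurable_pi_apply j)) h0 fun j => ?_
  have h1 := (iIndepFun_cellCount (r j) (π j) hA hd).comp (fun _ => ENNReal.ofReal)
    fun _ => ENNReal.measurable_ofReal
  have e2 : (fun l (w : ℕ × (ℕ → E)) => cellMeasure w (A l)) =
      fun l => ENNReal.ofReal ∘ cellCount (A l) := by
    funext l w; exact cellMeasure_apply (hA l) w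
  refine iIndepFun_comp_measurePreserving
    (measurePreserving_eval_infinitePi (fun j => cellLaw (r j) (π j)) j)
    (X := fun l w => cellMeasure w (A l)) (fun l => measurable_cellMeasure (hA l)) ?_
  rw [e2]
  exact h1

variable [Nonempty E]

theorem exists_normalized (ρ : Measure E) [IsFiniteMeasure ρ] :
    ∃ π : Measure E, IsProbabilityMeasure π ∧ ρ = ρ Set.univ • π := by
  by_cases h : ρ = 0
  -- For the zero measure any probability will do, since it is multiplied by 0.
  · exact ⟨Measure.dirac (Classical.arbitrary E), inferInstance, by simp [h]⟩
  · have h0 : ρ Set.univ ≠ 0 := by simpa using h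
    refine ⟨(ρ Set.univ)⁻¹ • ρ, ⟨?_⟩, ?_⟩
    · simp [ENNReal.inv_mul_cancel h0 (measure_ne_top _ _)]
    · rw [smul_smul, ENNReal.mul_inv_cancel h0 (measure_ne_top _ _), one_smul]

/-- An s-finite intensity is a countable sum of finite measures. Superpose independent clouds, one
for each of them: counts add up to Poisson variables, and the counts in disjoint sets remain
independent. -/
theorem exists_isPoissonMeasure_type_zero (ν : Measure E) [SFinite ν] :
    ∃ (Ω : Type) (_ : MeasurableSpace Ω) (P : Measure Ω) (M : Ω → Measure E),
      IsProbabilityMeasure P ∧ IsPoissonMeasure M ν P := by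
  have hn : ∀ j, ∃ π : Measure E, IsProbabilityMeasure π ∧
      sfiniteSeq ν j = sfiniteSeq ν j Set.univ • π := fun j => exists_normalized _
  choose π hπ hρ using hn
  let r : ℕ → ℝ≥0 := fun j => (sfiniteSeq ν j Set.univ).toNNReal
  have hr : ∀ j A, ((r j * (π j A).toNNReal : ℝ≥0) : ℝ≥0∞) = sfiniteSeq ν j A := by
    intro j A
    rw [ENNReal.coe_mul, ENNReal.coe_toNNReal (measure_ne_top _ _),
      ENNReal.coe_toNNReal (measure_ne_top _ _)]
    conv_rhs => rw [hρ j]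
    rfl
  have hν : ∀ A, MeasurableSet A →
      ∑' j, ((r j * (π j A).toNNReal : ℝ≥0) : ℝ≥0∞) = ν A := by
    intro A hA
    simp only [hr]
    rw [← Measure.sum_apply _ hA, sum_sfiniteSeq]
  let Ω := ℕ → ℕ × (ℕ → E)
  let P : Measure Ω := Measure.infinitePi fun j => cellLaw (r j) (π j)
  let M : Ω → Measure E := fun ω => Measure.sum fun j => cellMeasure (ω j)
  have hMA : ∀ ω A, MeasurableSet A → M ω A = ∑' j, cellMeasure (ω j) A := fun ω A hA =>
    Measure.sum_apply _ hA
  have hcm : ∀ A, MeasurableSet A → Measurable fun w : ℕ × (ℕ → E) => cellMeasure w A :=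
    fun A hA => measurable_cellMeasure hA
  have hX : ∀ A, MeasurableSet A → ∀ j, Measurable fun ω : Ω => cellMeasure (ω j) A :=
    fun A hA j => (hcm A hA).comp (measurable_pi_apply j)
  have hi : ∀ A, MeasurableSet A → ∀ j (ω : Ω), IsENat (cellMeasure (ω j) A) := by
    intro A hA j ω
    obtain ⟨k, hk⟩ := cellMeasure_integer hA (ω j)
    rw [hk]; exact isENat_natCast k
  have hind : ∀ A, MeasurableSet A → iIndepFun (fun j (ω : Ω) => cellMeasure (ω j) A) P :=
    fun A hA => iIndepFun_infinitePi (X := fun _ w => cellMeasure w A) fun _ => hcm A hA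
  have hmp : ∀ j, MeasurePreserving (fun ω : Ω => ω j) P (cellLaw (r j) (π j)) := fun j =>
    measurePreserving_eval_infinitePi _ j
  have hlaw : ∀ A, MeasurableSet A → ∀ j, P.map (fun ω : Ω => cellMeasure (ω j) A) =
      (poissonMeasure (r j * (π j A).toNNReal)).map (fun k : ℕ => (k : ℝ≥0∞)) := by
    intro A hA j
    have h1 : (fun ω : Ω => cellMeasure (ω j) A) =
        ENNReal.ofReal ∘ cellCount A ∘ (fun ω : Ω => ω j) := by
      funext ω; exact cellMeasure_apply hA _
    rw [h1, ← Measure.map_map ENNReal.measurable_ofReal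
        ((measurable_cellCount hA).comp (measurable_pi_apply j)),
      ← Measure.map_map (measurable_cellCount hA) (measurable_pi_apply j), (hmp j).map_eq,
      map_cellCount _ _ hA, Measure.map_map ENNReal.measurable_ofReal .of_discrete]
    congr 1
    funext k
    simp
  have main : IsPoissonMeasure M ν P :=
    { measurable := fun A hA => by
        simp only [hMA _ A hA]
        exact Measurable.tsum (hX A hA)
      integer_valued := fun ω A hA => by
        rw [hMA ω A hA]
        exact isENat_tsum fun j => hi A hA j ω
      poisson := fun A hA hfin => by
        simp only [hMA _ A hA]
        refine map_tsum_poisson (hX A hA) (hi A hA) (hind A hA) (hlaw A hA) ?_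
        rw [hν A hA, ENNReal.coe_toNNReal hfin]
      infinite := fun A hA hinf => by
        simp only [hMA _ A hA]
        exact tsum_poisson_eq_top (hX A hA) (hi A hA) (hind A hA) (hlaw A hA) (by rw [hν A hA, hinf])
      indep := fun m A hA hd => by
        have e : (fun i (ω : Ω) => M ω (A i)) = fun i ω => ∑' j, cellMeasure (ω j) (A i) := by
          funext i ω; exact hMA ω _ (hA i)
        rw [e]
        exact iIndepFun_tsum_cellMeasure r π hA hd }
  exact ⟨Ω, inferInstance, P, M, inferInstance, main⟩

/-- The probability space is transported to an arbitrary universe through `ULift`. -/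
theorem exists_isPoissonMeasure (ν : Measure E) [SFinite ν] :
    ∃ (Ω : Type u) (_ : MeasurableSpace Ω) (P : Measure Ω) (M : Ω → Measure E),
      IsProbabilityMeasure P ∧ IsPoissonMeasure M ν P := by
  obtain ⟨Ω, mΩ, P, M, hP, main⟩ := exists_isPoissonMeasure_type_zero ν
  have hu : Measurable (ULift.up.{u} : Ω → ULift.{u} Ω) := measurable_up
  have hd : MeasurePreserving (ULift.down : ULift.{u} Ω → Ω) (P.map ULift.up) P := by
    refine ⟨measurable_down, ?_⟩
    rw [Measure.map_map measurable_down hu]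
    exact Measure.map_id
  exact ⟨ULift.{u} Ω, inferInstance, P.map ULift.up, fun ω => M ω.down,
    Measure.isProbabilityMeasure_map hu.aemeasurable, main.comp hd⟩

end Construction

/-! ### The topology of `𝒞` -/

instance (S : Finset ℕ+) : TopologicalSpace (Comp S) := ⊥

instance (S : Finset ℕ+) : DiscreteTopology (Comp S) := ⟨rfl⟩

instance (S : Finset ℕ+) : BorelSpace (Comp S) := ⟨borel_eq_top_of_discrete.symm⟩

instance : TopologicalSpace CInf :=
  inferInstanceAs (TopologicalSpace {γ : (n : ℕ+) → CFin n //
    ∀ (m n : ℕ+) (h : m ≤ n), (γ n).restrict (seg_subset h) = γ m})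

/-- The space `𝒞` is closed in a product of finite discrete spaces. Its compactness gives weak
limits of measures, and its being Polish makes it standard Borel, so that point measures have atoms.
-/
theorem isClosed_projective : IsClosed {γ : (n : ℕ+) → CFin n |
    ∀ (m n : ℕ+) (h : m ≤ n), (γ n).restrict (seg_subset h) = γ m} := by
  simp only [Set.ofPred_forall]
  refine isClosed_iInter fun m => isClosed_iInter fun n => isClosed_iInter fun h => ?_
  exact isClosed_eq ((continuous_of_discreteTopology
    (f := fun x : CFin n => x.restrict (seg_subset h))).comp (continuous_apply n))
    (continuous_apply m)

instance : BorelSpace CInf :=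
  inferInstanceAs (BorelSpace {γ : (n : ℕ+) → CFin n //
    ∀ (m n : ℕ+) (h : m ≤ n), (γ n).restrict (seg_subset h) = γ m})

instance : CompactSpace CInf := isCompact_iff_compactSpace.1 isClosed_projective.isCompact

instance : PolishSpace CInf := isClosed_projective.polishSpace

instance : T2Space CInf :=
  inferInstanceAs (T2Space {γ : (n : ℕ+) → CFin n //
    ∀ (m n : ℕ+) (h : m ≤ n), (γ n).restrict (seg_subset h) = γ m})

instance : StandardBorelSpace CInf := inferInstance

instance : StandardBorelSpace Marks := inferInstance

theorem CInf.continuous_toFin (n : ℕ+) : Continuous fun γ : CInf => γ.toFin n :=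
  (continuous_apply n).comp continuous_subtype_val

/-! ### Point measures -/

/-- A measure whose values are natural numbers or `∞`. -/
def IsPointMeasure {E : Type*} [MeasurableSpace E] (m : Measure E) : Prop :=
  ∀ A, MeasurableSet A → IsENat (m A)

theorem IsENat.eq_zero_or_one {x : ℝ≥0∞} (hx : IsENat x) (h : x ≤ 1) : x = 0 ∨ x = 1 := by
  by_cases h0 : x = 0
  · exact .inl h0
  · exact .inr (le_antisymm h (hx.one_le h0))

/-- The restriction to `B` takes only the values 0 and 1, and on a standard Borel space such a
non-zero measure is a Dirac mass. -/
theorem IsPointMeasure.exists_atom {E : Type*} [MeasurableSpace E] [StandardBorelSpace E]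
    {m : Measure E} (hm : IsPointMeasure m) {B : Set E} (hB : MeasurableSet B) (h : m B = 1) :
    ∃ x ∈ B, m {x} = 1 ∧ ∀ A ⊆ B, x ∉ A → m A = 0 := by
  have : IsZeroOneMeasure (m.restrict B) := ⟨fun {s} hs => by
    refine (?_ : IsENat (m.restrict B s)).eq_zero_or_one ?_
    · rw [Measure.restrict_apply hs]
      exact hm _ (hs.inter hB)
    · rw [Measure.restrict_apply hs, ← h]
      exact measure_mono Set.inter_subset_right⟩
  have : NeZero (m.restrict B) := ⟨fun h0 => by
    have := congrArg (fun ν : Measure E => ν B) h0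
    simp [h] at this⟩
  obtain ⟨x, hx⟩ := IsZeroOneMeasure.exists_eq_dirac (μ := m.restrict B)
  have h1 : ∀ A, MeasurableSet A → m (A ∩ B) = A.indicator 1 x := by
    intro A hA
    rw [← Measure.restrict_apply hA, hx, Measure.dirac_apply' _ hA]
  have hxB : x ∈ B := by
    have := h1 B hB
    rw [Set.inter_self, h] at this
    by_contra hc
    simp [hc] at this
  refine ⟨x, hxB, ?_, ?_⟩
  · have := h1 {x} (measurableSet_singleton x)
    rw [Set.inter_eq_left.2 (by simpa using hxB)] at this
    simpa using this
  · intro A hA hxA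
    have h2 := h1 (B \ {x}) (hB.diff (measurableSet_singleton x))
    rw [Set.inter_eq_left.2 Set.sdiff_subset] at h2
    refine measure_mono_null (t := B \ {x}) (fun y hy => ⟨hA hy, ?_⟩) (by simpa using h2)
    rintro rfl
    exact hxA hy

/-! ### Jump types -/

section Jumps

variable {n : ℕ+}

/-- The marks that can change a composition of `[n]`. -/
def activeMarks (n : ℕ+) : Set (CInf × ℕ+) := {x | x.1.toFin n ≠ oneFin n ∧ x.2 ≤ n}

/-- The non-trivial jumps of a composition of `[n]`: fragmentation of the block with a given least
element by a given composition. -/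
abbrev JumpType (n : ℕ+) : Type := {p : CFin n × seg n // p.1 ≠ oneFin n}

/-- The marks that induce the given jump. -/
def typeMarks (p : JumpType n) : Set (CInf × ℕ+) := {x | x.1.toFin n = p.1.1 ∧ x.2 = p.1.2}

/-- The jump of the given type. -/
def jump (p : JumpType n) (γ : CFin n) : CFin n :=
  γ.frag (Function.update (fun _ => oneFin n) p.1.2 p.1.1)

theorem measurableSet_typeMarks (p : JumpType n) : MeasurableSet (typeMarks p) :=
  ((CInf.measurable_toFin n).comp measurable_fst (measurableSet_singleton _)).inter
    (measurable_snd (measurableSet_singleton _))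

theorem measurableSet_activeMarks (n : ℕ+) : MeasurableSet (activeMarks n) :=
  ((CInf.measurable_toFin n).comp measurable_fst (measurableSet_singleton (oneFin n)).compl).inter
    (measurable_snd (MeasurableSet.of_discrete (s := Set.Iic n)))

theorem typeMarks_subset (p : JumpType n) : typeMarks p ⊆ activeMarks n := by
  rintro ⟨γ, k⟩ ⟨h1, h2⟩
  exact ⟨by rw [h1]; exact p.2, by rw [h2]; exact (Finset.mem_Icc.1 p.1.2.2).2⟩

/-- The jump type of an active mark. -/
def typeOf {x : CInf × ℕ+} (hx : x ∈ activeMarks n) : JumpType n :=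
  ⟨(x.1.toFin n, ⟨x.2, Finset.mem_Icc.2 ⟨one_le, hx.2⟩⟩), hx.1⟩

theorem mem_typeMarks_typeOf {x : CInf × ℕ+} (hx : x ∈ activeMarks n) :
    x ∈ typeMarks (typeOf hx) := ⟨rfl, rfl⟩

theorem typeOf_eq {x : CInf × ℕ+} {p : JumpType n} (hx : x ∈ activeMarks n)
    (hp : x ∈ typeMarks p) : typeOf hx = p :=
  Subtype.ext (Prod.ext hp.1 (Subtype.ext hp.2))

theorem disjoint_typeMarks {p p' : JumpType n} (h : p ≠ p') :
    Disjoint (typeMarks p) (typeMarks p') :=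
  Set.disjoint_left.2 fun _ hx hx' => h <|
    (typeOf_eq (typeMarks_subset p hx) hx).symm.trans (typeOf_eq _ hx')

theorem activeMarks_eq (n : ℕ+) : activeMarks n = ⋃ p : JumpType n, typeMarks p :=
  Set.Subset.antisymm (fun _ hx => Set.mem_iUnion.2 ⟨_, mem_typeMarks_typeOf hx⟩)
    (Set.iUnion_subset typeMarks_subset)

theorem frag_Delta {x : CInf × ℕ+} (hx : x ∈ activeMarks n) (γ : CFin n) :
    γ.frag (Delta n x.1 x.2) = jump (typeOf hx) γ := by
  refine γ.frag_congr fun i => ?_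
  by_cases h : (γ.rep i : ℕ+) = x.2
  · have : γ.rep i = (typeOf hx).1.2 := Subtype.ext h
    rw [this, Function.update_self]
    exact if_pos rfl
  · have : γ.rep i ≠ (typeOf hx).1.2 := fun h' => h (congrArg Subtype.val h')
    simp [Delta, h, Function.update_of_ne this]

/-- The point measure `m` has marks in `J`, and they are all of type `p`. -/
def OnlyType (m : Measure Marks) (J : Set ℝ≥0) (p : JumpType n) : Prop :=
  m (J ×ˢ (activeMarks n \ typeMarks p)) = 0 ∧ m (J ×ˢ activeMarks n) ≠ 0

/-- An active mark cannot have two types, so if both types were imposed there would be no mark at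
all in `J`. -/
theorem OnlyType.eq {m : Measure Marks} {J : Set ℝ≥0} {p p' : JumpType n} (h : OnlyType m J p)
    (h' : OnlyType m J p') : p = p' := by
  by_contra hne
  refine h.2 (measure_mono_null ?_ (measure_union_null h.1 h'.1))
  rintro ⟨s, x⟩ ⟨hs, hx⟩
  by_cases hp : x ∈ typeMarks p
  · exact .inr ⟨hs, hx, fun hp' => Set.disjoint_left.1 (disjoint_typeMarks hne) hp hp'⟩
  · exact .inl ⟨hs, hx, hp⟩

open scoped Classical in
/-- The effect of the marks in `J`, if there is at most one such mark. -/
def step (m : Measure Marks) (n : ℕ+) (J : Set ℝ≥0) (γ : CFin n) : CFin n :=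
  if h : ∃ p : JumpType n, OnlyType m J p then jump h.choose γ else γ

theorem step_of_onlyType {m : Measure Marks} {J : Set ℝ≥0} {p : JumpType n} (h : OnlyType m J p)
    (γ : CFin n) : step m n J γ = jump p γ := by
  have h' : ∃ p : JumpType n, OnlyType m J p := ⟨p, h⟩
  rw [step, dif_pos h', h'.choose_spec.eq h]

theorem step_of_not {m : Measure Marks} {J : Set ℝ≥0} (h : ¬ ∃ p : JumpType n, OnlyType m J p)
    (γ : CFin n) : step m n J γ = γ := by
  rw [step, dif_neg h]

/-! ### Paths -/

section Path

variable {m : Measure Marks} {f : ℝ≥0 → CFin n}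

/-- Without atoms the path is locally constant on the connected set `[a, b]`; at `a`, right
continuity suffices. -/
theorem IsPoissonPathFin.eq_of_no_atom (hf : IsPoissonPathFin m n f) {a b : ℝ≥0} (hab : a ≤ b)
    (h : ∀ s ∈ Set.Ioc a b, ∀ γ k, ¬ IsAtom m n s γ k) : f b = f a := by
  refine (isPreconnected_Icc (a := a) (b := b)).constant (f := f) ?_
    (Set.right_mem_Icc.2 hab) (Set.left_mem_Icc.2 hab)
  intro x hx
  rw [ContinuousWithinAt, nhds_discrete, tendsto_pure]
  rcases eq_or_lt_of_le hx.1 with rfl | hax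
  · have h1 : ∀ᶠ r in 𝓝[≥] a, f r = f a := by
      rw [← Set.Ioi_insert, nhdsWithin_insert, eventually_sup]
      exact ⟨by simp, hf.right a⟩
    exact h1.filter_mono (nhdsWithin_mono _ fun y hy => hy.1)
  · obtain ⟨f₀, h1, -, h2⟩ := hf.left x (pos_of_gt hax)
    have h3 := h2 (h x ⟨hax, hx.2⟩)
    have h4 : ∀ᶠ r in 𝓝 x, f r = f x := by
      have e : 𝓝 x = 𝓝[<] x ⊔ (pure x ⊔ 𝓝[>] x) := by
        rw [← nhdsWithin_univ, ← Set.Iio_union_Ici (a := x), nhdsWithin_union,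
          ← Set.Ioi_insert (a := x), nhdsWithin_insert]
      rw [e, eventually_sup, eventually_sup]
      exact ⟨by rwa [h3], by simp, hf.right x⟩
    exact h4.filter_mono nhdsWithin_le_nhds

theorem IsPoissonPathFin.eq_of_atom (hf : IsPoissonPathFin m n f) {a b s : ℝ≥0}
    (hs : s ∈ Set.Ioc a b) {γ : CInf} {k : ℕ+} (hat : IsAtom m n s γ k)
    (h : ∀ r ∈ Set.Ioc a b, r ≠ s → ∀ γ k, ¬ IsAtom m n r γ k) :
    f b = (f a).frag (Delta n γ k) := by
  obtain ⟨f₀, h1, h2, -⟩ := hf.left s (pos_of_gt hs.1)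
  have hb : f b = f s := hf.eq_of_no_atom hs.2 fun r hr =>
    h r ⟨hs.1.trans hr.1, hr.2⟩ hr.1.ne'
  have := nhdsLT_neBot_of_exists_lt ⟨a, hs.1⟩
  obtain ⟨r, hr, har⟩ := (h1.and (Ioo_mem_nhdsLT hs.1)).exists
  have ha : f r = f a := hf.eq_of_no_atom har.1.le fun r' hr' =>
    h r' ⟨hr'.1, hr'.2.trans (har.2.le.trans hs.2)⟩ (hr'.2.trans_lt har.2).ne
  rw [hb, h2 γ k hat, ← hr, ha]

/-- A point measure with mass at most 1 has no atom, or exactly one; in the second case the path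
jumps once and is constant before and after. -/
theorem IsPoissonPathFin.eq_step (hm : IsPointMeasure m) (hf : IsPoissonPathFin m n f)
    {a b : ℝ≥0} (hab : a ≤ b) (h : m (Set.Ioc a b ×ˢ activeMarks n) ≤ 1) :
    f b = step m n (Set.Ioc a b) (f a) := by
  have hmeas : MeasurableSet (Set.Ioc a b ×ˢ activeMarks n) :=
    measurableSet_Ioc.prod (measurableSet_activeMarks n)
  rcases (hm _ hmeas).eq_zero_or_one h with h0 | h1
  · rw [step_of_not (by rintro ⟨p, hp⟩; exact hp.2 h0)]
    refine hf.eq_of_no_atom hab fun s hs γ k hat => hat.1 (measure_mono_null ?_ h0)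
    exact Set.singleton_subset_iff.2 ⟨hs, hat.2⟩
  · obtain ⟨⟨s, x⟩, hx, hx1, hx2⟩ := hm.exists_atom hmeas h1
    have ho : OnlyType m (Set.Ioc a b) (typeOf hx.2) := by
      refine ⟨hx2 _ (Set.prod_mono_right Set.sdiff_subset) fun hc => hc.2.2 ?_, by simp [h1]⟩
      exact mem_typeMarks_typeOf hx.2
    rw [step_of_onlyType ho, ← frag_Delta hx.2]
    refine hf.eq_of_atom hx.1 ⟨by rw [hx1]; simp, hx.2⟩ fun r hr hrs γ k hat => hat.1 ?_
    refine hx2 _ (Set.singleton_subset_iff.2 ⟨hr, hat.2⟩) fun hc => hrs ?_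
    exact (congrArg Prod.fst (Set.mem_singleton_iff.1 hc)).symm

/-- An atom that is active at level `n` but not at level `n'` has either `k > n'` or a trivial
restriction to `[n']`; in both cases its effect disappears after restriction. -/
theorem IsPoissonPathFin.restrict {n' : ℕ+} (hn : n' ≤ n) (hf : IsPoissonPathFin m n f) :
    IsPoissonPathFin m n' fun t => (f t).restrict (seg_subset hn) where
  zero := by rw [hf.zero]; exact restrict_oneFin hn
  right s := (hf.right s).mono fun r hr => by rw [hr]
  left s hs := by
    obtain ⟨f₀, h1, h2, h3⟩ := hf.left s hs
    have hup : ∀ γ k, IsAtom m n' s γ k → IsAtom m n s γ k := by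
      rintro γ k ⟨ha, hb, hc⟩
      refine ⟨ha, fun h => hb ?_, hc.trans hn⟩
      rw [← γ.restrict_toFin hn, h, restrict_oneFin hn]
    refine ⟨f₀.restrict (seg_subset hn), h1.mono fun r hr => by rw [hr], ?_, ?_⟩
    · intro γ k hat
      rw [h2 γ k (hup γ k hat), restrict_frag_Delta hn]
    · intro hno
      by_cases hat : ∃ γ k, IsAtom m n s γ k
      · obtain ⟨γ, k, hat⟩ := hat
        rw [h2 γ k hat, restrict_frag_Delta hn]
        have : Delta n' γ k = fun _ => oneFin n' := by
          by_cases hk : k ≤ n'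
          · refine Delta_eq_one_of_eq (not_not.1 fun hγ => hno γ k ⟨hat.1, hγ, hk⟩)
          · exact Delta_eq_one_of_lt γ (not_le.1 hk)
        rw [this, Comp.frag_oneFin]
      · push Not at hat
        rw [h3 hat]

end Path

/-! ### Discretization of time -/

/-- The `i`-th interval of length `h` after time `a`. -/
def slab (a h : ℝ≥0) (i : ℕ) : Set ℝ≥0 := Set.Ioc (a + i * h) (a + (i + 1 : ℕ) * h)

/-- Each of the first `N` intervals of length `h` after time `a` has at most one active mark. -/
def Sparse (m : Measure Marks) (n : ℕ+) (a h : ℝ≥0) (N : ℕ) : Prop :=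
  ∀ i < N, m (slab a h i ×ˢ activeMarks n) ≤ 1

/-- The composition of the effects of the marks in the first intervals of length `h` after `a`. -/
def steps (m : Measure Marks) (n : ℕ+) (a h : ℝ≥0) : ℕ → CFin n → CFin n
  | 0, γ => γ
  | i + 1, γ => step m n (slab a h i) (steps m n a h i γ)

theorem slab_le (a h : ℝ≥0) (i : ℕ) : a + i * h ≤ a + (i + 1 : ℕ) * h := by
  gcongr
  simp

section Sparse

variable {m : Measure Marks}

theorem IsPoissonPathFin.eq_steps (hm : IsPointMeasure m) {f : ℝ≥0 → CFin n}
    (hf : IsPoissonPathFin m n f) {a h : ℝ≥0} {N : ℕ} (hS : Sparse m n a h N) :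
    f (a + N * h) = steps m n a h N (f a) := by
  induction N with
  | zero => simp [steps]
  | succ N ih =>
    rw [steps, ← ih fun i hi => hS i (hi.trans N.lt_succ_self)]
    exact hf.eq_step hm (slab_le a h N) (hS N N.lt_succ_self)

/-- Every bounded time interval can be divided into finitely many intervals with at most one active
mark each. -/
def LocallySparse (m : Measure Marks) (n : ℕ+) : Prop :=
  ∀ T : ℝ≥0, ∃ (h : ℝ≥0) (N : ℕ), T ≤ N * h ∧ Sparse m n 0 h N

theorem Sparse.exists_slab {a h : ℝ≥0} {N : ℕ} {s : ℝ≥0} (hs : a < s) (hs' : s ≤ a + N * h) :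
    ∃ i < N, s ∈ slab a h i := by
  induction N with
  | zero => simp at hs'; exact absurd hs (not_lt.2 hs')
  | succ N ih =>
    by_cases hc : s ≤ a + N * h
    · obtain ⟨i, hi, h'⟩ := ih hc
      exact ⟨i, hi.trans N.lt_succ_self, h'⟩
    · exact ⟨N, N.lt_succ_self, not_le.1 hc, hs'⟩

/-- The value at `t` is forced: a sequence of steps up to the last grid point before `t`, then one
step on the remaining part of the interval. -/
theorem IsPoissonPathFin.unique (hm : IsPointMeasure m) (hS : LocallySparse m n)
    {f g : ℝ≥0 → CFin n} (hf : IsPoissonPathFin m n f) (hg : IsPoissonPathFin m n g) : f = g := by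
  funext t
  rcases eq_or_ne t 0 with rfl | ht
  · rw [hf.zero, hg.zero]
  obtain ⟨h, N, hT, hN⟩ := hS t
  obtain ⟨i, hi, hti⟩ := Sparse.exists_slab (pos_of_ne_zero ht) (a := 0) (h := h) (by simpa using hT)
  have hle : m (Set.Ioc (0 + i * h) t ×ˢ activeMarks n) ≤ 1 :=
    (measure_mono (Set.prod_mono_left (Set.Ioc_subset_Ioc_right hti.2))).trans (hN i hi)
  have hS' : Sparse m n 0 h i := fun j hj => hN j (hj.trans hi)
  rw [hf.eq_step hm hti.1.le hle, hg.eq_step hm hti.1.le hle, hf.eq_steps hm hS',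
    hg.eq_steps hm hS', hf.zero, hg.zero]

/-- Each atom of a point measure has mass at least 1, so two of them would give mass at least 2. -/
theorem IsPointMeasure.atom_unique (hm : IsPointMeasure m) {J : Set ℝ≥0}
    (h : m (J ×ˢ activeMarks n) ≤ 1) {s s' : ℝ≥0} (hs : s ∈ J) (hs' : s' ∈ J) {γ γ' : CInf}
    {k k' : ℕ+} (ha : IsAtom m n s γ k) (ha' : IsAtom m n s' γ' k') :
    (s, γ, k) = (s', γ', k') := by
  by_contra hne
  have h1 : m ({(s, γ, k)} ∪ {(s', γ', k')}) = m {(s, γ, k)} + m {(s', γ', k')} :=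
    measure_union (by simpa using hne) (measurableSet_singleton _)
  have h2 : (1 : ℝ≥0∞) + 1 ≤ 1 := by
    refine le_trans (add_le_add ((hm _ (measurableSet_singleton _)).one_le ha.1)
      ((hm _ (measurableSet_singleton _)).one_le ha'.1)) (h1.symm.le.trans (le_trans ?_ h))
    refine measure_mono (Set.union_subset ?_ ?_) <;> refine Set.singleton_subset_iff.2 ?_
    · exact ⟨hs, ha.2⟩
    · exact ⟨hs', ha'.2⟩
  norm_num at h2

/-! ### Construction of the path -/

/-- The composition of the maps `J s`, in increasing order of `s`. -/
def foldJumps {X : Type*} (J : ℝ≥0 → X → X) (x : X) (S : Finset ℝ≥0) : X :=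
  if h : S.Nonempty then J (S.max' h) (foldJumps J x (S.erase (S.max' h))) else x
termination_by S.card
decreasing_by exact Finset.card_erase_lt_of_mem (S.max'_mem h)

theorem foldJumps_empty {X : Type*} (J : ℝ≥0 → X → X) (x : X) : foldJumps J x ∅ = x := by
  rw [foldJumps]; simp

theorem foldJumps_insert {X : Type*} (J : ℝ≥0 → X → X) (x : X) {S : Finset ℝ≥0} {a : ℝ≥0}
    (h : ∀ b ∈ S, b < a) : foldJumps J x (insert a S) = J a (foldJumps J x S) := by
  have hne : (insert a S).Nonempty := Finset.insert_nonempty a S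
  have hmax : (insert a S).max' hne = a := by
    refine le_antisymm (Finset.max'_le _ _ _ ?_) (Finset.le_max' _ _ (Finset.mem_insert_self a S))
    intro y hy
    rcases Finset.mem_insert.1 hy with rfl | hy
    · exact le_rfl
    · exact (h y hy).le
  rw [foldJumps, dif_pos hne, hmax, Finset.erase_insert fun ha => lt_irrefl a (h a ha)]

/-- The times of the active marks. -/
def atomTimes (m : Measure Marks) (n : ℕ+) : Set ℝ≥0 := {s | ∃ γ k, IsAtom m n s γ k}

theorem LocallySparse.finite (hm : IsPointMeasure m) (hS : LocallySparse m n) (t : ℝ≥0) :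
    (atomTimes m n ∩ Set.Ioc 0 t).Finite := by
  obtain ⟨h, N, hT, hN⟩ := hS t
  refine Set.Finite.subset (Set.Finite.biUnion (Finset.finite_toSet (Finset.range N))
    (t := fun i => atomTimes m n ∩ slab 0 h i) ?_) ?_
  · intro i hi
    refine Set.Subsingleton.finite ?_
    rintro s ⟨⟨γ, k, ha⟩, hs⟩ s' ⟨⟨γ', k', ha'⟩, hs'⟩
    exact congrArg Prod.fst (hm.atom_unique (hN i (by simpa using hi)) hs hs' ha ha')
  · rintro s ⟨hs, hs0, hst⟩
    obtain ⟨i, hi, hsi⟩ := Sparse.exists_slab hs0 (h := h) (by simpa using hst.trans hT)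
    exact Set.mem_biUnion (by simpa using hi) ⟨hs, hsi⟩

open scoped Classical in
/-- The jump at a given time. -/
def jumpAt (m : Measure Marks) (n : ℕ+) (s : ℝ≥0) (γ : CFin n) : CFin n :=
  if h : ∃ x : CInf × ℕ+, IsAtom m n s x.1 x.2 then γ.frag (Delta n h.choose.1 h.choose.2) else γ

open scoped Classical in
/-- The composition of the jumps in a finite set of times. -/
def jumpsIn (m : Measure Marks) (n : ℕ+) (S : Set ℝ≥0) : CFin n :=
  if h : S.Finite then foldJumps (jumpAt m n) (oneFin n) h.toFinset else oneFin n

theorem jumpsIn_insert {S : Set ℝ≥0} (hS : S.Finite) {a : ℝ≥0} (h : ∀ b ∈ S, b < a) :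
    jumpsIn m n (insert a S) = jumpAt m n a (jumpsIn m n S) := by
  classical
  rw [jumpsIn, jumpsIn, dif_pos hS, dif_pos (hS.insert a), Set.Finite.toFinset_insert,
    foldJumps_insert _ _ (by simpa using h)]

/-- There are finitely many atom times in `(0, t]`, so the jumps can be composed in order of time;
the set of these times is constant just after each time and just before it. -/
theorem isPoissonPathFin_jumpsIn (hm : IsPointMeasure m) (hS : LocallySparse m n) :
    IsPoissonPathFin m n fun t => jumpsIn m n (atomTimes m n ∩ Set.Ioc 0 t) where
  zero := by
    simp [jumpsIn, foldJumps_empty]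
  right s := by
    -- To the right of `s`, stay below the next atom time. Only times up to `s + 1` are considered,
    -- so that finitely many conditions are imposed.
    have h1 : ∀ᶠ r in 𝓝[>] s, ∀ x ∈ atomTimes m n ∩ Set.Ioc 0 (s + 1), s < x → r < x := by
      refine (eventually_all_finite (hS.finite hm (s + 1))).2 fun x _ => ?_
      by_cases hx : s < x
      · exact ((eventually_lt_nhds hx).filter_mono nhdsWithin_le_nhds).mono fun r hr _ => hr
      · exact Eventually.of_forall fun r h => absurd h hx
    have h2 : ∀ᶠ r in 𝓝[>] s, r < s + 1 :=
      (eventually_lt_nhds (lt_add_one s)).filter_mono nhdsWithin_le_nhds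
    filter_upwards [h1, h2, self_mem_nhdsWithin] with r hr1 hr2 hr3
    congr 1
    ext x
    refine ⟨fun ⟨hx, hx0, hxr⟩ => ⟨hx, hx0, not_lt.1 fun hc => ?_⟩,
      fun ⟨hx, hx0, hxr⟩ => ⟨hx, hx0, hxr.trans (le_of_lt hr3)⟩⟩
    exact absurd (hr1 x ⟨hx, hx0, hxr.trans hr2.le⟩ hc) (not_lt.2 hxr)
  left s hs := by
    have hfin : (atomTimes m n ∩ Set.Ioo 0 s).Finite :=
      (hS.finite hm s).subset (Set.inter_subset_inter_right _ Set.Ioo_subset_Ioc_self)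
    refine ⟨jumpsIn m n (atomTimes m n ∩ Set.Ioo 0 s), ?_, ?_, ?_⟩
    · have h1 : ∀ᶠ r in 𝓝[<] s, ∀ x ∈ atomTimes m n ∩ Set.Ioo 0 s, x < r :=
        (eventually_all_finite hfin).2 fun x hx =>
          (eventually_gt_nhds hx.2.2).filter_mono nhdsWithin_le_nhds
      filter_upwards [h1, self_mem_nhdsWithin] with r hr1 hr2
      congr 1
      ext x
      exact ⟨fun ⟨hx, hx0, hxr⟩ => ⟨hx, hx0, hxr.trans_lt hr2⟩,
        fun ⟨hx, hx0, hxr⟩ => ⟨hx, hx0, (hr1 x ⟨hx, hx0, hxr⟩).le⟩⟩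
    · intro γ k hat
      have e : atomTimes m n ∩ Set.Ioc 0 s = insert s (atomTimes m n ∩ Set.Ioo 0 s) := by
        ext x
        simp only [Set.mem_inter_iff, Set.mem_Ioc, Set.mem_insert_iff, Set.mem_Ioo]
        constructor
        · rintro ⟨hx, hx0, hxs⟩
          rcases eq_or_lt_of_le hxs with rfl | hlt
          · exact .inl rfl
          · exact .inr ⟨hx, hx0, hlt⟩
        · rintro (rfl | ⟨hx, hx0, hxs⟩)
          · exact ⟨⟨γ, k, hat⟩, hs, le_rfl⟩
          · exact ⟨hx, hx0, hxs.le⟩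
      rw [e, jumpsIn_insert hfin fun b hb => hb.2.2]
      have hex : ∃ x : CInf × ℕ+, IsAtom m n s x.1 x.2 := ⟨(γ, k), hat⟩
      rw [jumpAt, dif_pos hex]
      -- The interval of the grid containing `s` has at most one active mark, so the mark chosen in
      -- `jumpAt` is the given one.
      obtain ⟨h, N, hT, hN⟩ := hS s
      obtain ⟨i, hi, hsi⟩ := Sparse.exists_slab hs (h := h) (by simpa using hT)
      have hu := congrArg Prod.snd (hm.atom_unique (hN i hi) hsi hsi hex.choose_spec hat)
      simp only at hu
      rw [show hex.choose.1 = γ from congrArg Prod.fst hu,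
        show hex.choose.2 = k from congrArg Prod.snd hu]
    · intro hno
      congr 1
      ext x
      refine ⟨fun ⟨hx, hx0, hxs⟩ => ⟨hx, hx0, lt_of_le_of_ne hxs ?_⟩,
        fun ⟨hx, hx0, hxs⟩ => ⟨hx, hx0, hxs.le⟩⟩
      rintro rfl
      obtain ⟨γ, k, hat⟩ := hx
      exact hno γ k hat

theorem existsUnique_poissonPathFin (hm : IsPointMeasure m) (hS : LocallySparse m n) :
    ∃! f, IsPoissonPathFin m n f :=
  ⟨_, isPoissonPathFin_jumpsIn hm hS, fun _ hg => hg.unique hm hS (isPoissonPathFin_jumpsIn hm hS)⟩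

/-- The restriction of the path at level `n` satisfies the conditions of level `m'`, so by
uniqueness the finite paths are compatible and define a path in the projective limit. -/
theorem existsUnique_poissonPath (hm : IsPointMeasure m) (hS : ∀ n, LocallySparse m n) :
    ∃! f, IsPoissonPath m f := by
  choose f hf using fun n => (existsUnique_poissonPathFin hm (hS n)).exists
  have hc : ∀ (t : ℝ≥0) (m' n : ℕ+) (h : m' ≤ n), (f n t).restrict (seg_subset h) = f m' t :=
    fun t m' n h => congrFun (((hf n).restrict h).unique hm (hS m') (hf m')) t
  refine ⟨fun t => ⟨fun n => f n t, hc t⟩, hf, fun g hg => ?_⟩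
  funext t
  exact CInf.ext_toFin fun n => congrFun ((hg n).unique hm (hS n) (hf n)) t

end Sparse

end Jumps


/-! ### The intensity measure -/

section Intensity

variable {μ : Measure CInf}

theorem CInf.eq_oneInf_of_toFin {γ : CInf} (h : ∀ n, γ.toFin n = oneFin n) : γ = oneInf :=
  CInf.ext_toFin h

theorem CInf.measurableSet_toFin {n : ℕ+} (D : Set (CFin n)) :
    MeasurableSet {γ : CInf | γ.toFin n ∈ D} :=
  CInf.measurable_toFin n (MeasurableSet.of_discrete (s := D))

/-- A composition other than `𝟏_ℕ` is already non-trivial at some finite level, where the mass is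
finite, and `𝟏_ℕ` itself is not charged. -/
theorem IsFragMeasure.sigmaFinite (hμ : IsFragMeasure μ) : SigmaFinite μ := by
  refine ⟨⟨⟨fun k => {γ | γ.toFin k.succPNat ≠ oneFin k.succPNat} ∪ {oneInf}, fun _ => trivial,
    fun k => ?_, ?_⟩⟩⟩
  · refine (measure_union_le _ _).trans_lt ?_
    rw [hμ.one_eq_zero, add_zero]
    exact hμ.lt_top _
  · refine Set.eq_univ_of_forall fun γ => ?_
    by_cases h : γ = oneInf
    · exact Set.mem_iUnion.2 ⟨0, .inr h⟩
    · have : ∃ n, γ.toFin n ≠ oneFin n := by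
        by_contra hc
        push Not at hc
        exact h (CInf.eq_oneInf_of_toFin hc)
      obtain ⟨n, hn⟩ := this
      exact Set.mem_iUnion.2 ⟨n.natPred, .inl (by
        change γ.toFin _ ≠ _; rwa [PNat.succPNat_natPred])⟩

theorem comap_volume_Ioc (a b : ℝ≥0) :
    Measure.comap ((↑) : ℝ≥0 → ℝ) volume (Set.Ioc a b) = (b - a : ℝ≥0) := by
  have he : MeasurableEmbedding ((↑) : ℝ≥0 → ℝ) := MeasurableEmbedding.subtype_coe measurableSet_Ici
  rw [he.comap_apply]
  have : ((↑) : ℝ≥0 → ℝ) '' Set.Ioc a b = Set.Ioc (a : ℝ) b := by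
    ext x
    constructor
    · rintro ⟨y, hy, rfl⟩
      exact ⟨by exact_mod_cast hy.1, by exact_mod_cast hy.2⟩
    · rintro ⟨h1, h2⟩
      exact ⟨⟨x, a.2.trans h1.le⟩, ⟨h1, h2⟩, rfl⟩
  rw [this, Real.volume_Ioc, ← ENNReal.ofReal_coe_nnreal]
  by_cases hab : a ≤ b
  · rw [NNReal.coe_sub hab]
  · rw [tsub_eq_zero_of_le (not_le.1 hab).le, NNReal.coe_zero, ENNReal.ofReal_zero,
      ENNReal.ofReal_of_nonpos]
    have : (b : ℝ) ≤ a := by exact_mod_cast (not_le.1 hab).le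
    linarith

/-- The intensity of the marks per unit of time. -/
def markMeasure (μ : Measure CInf) : Measure (CInf × ℕ+) := μ.prod Measure.count

instance [SFinite μ] : SFinite (markMeasure μ) := inferInstanceAs (SFinite (μ.prod Measure.count))

theorem intensity_slab [SFinite μ] (a b : ℝ≥0) (C : Set (CInf × ℕ+)) :
    intensity μ (Set.Ioc a b ×ˢ C) = (b - a : ℝ≥0) * markMeasure μ C := by
  have : SFinite (markMeasure μ) := inferInstance
  change ((Measure.comap ((↑) : ℝ≥0 → ℝ) volume).prod (markMeasure μ)) _ = _
  rw [Measure.prod_prod, comap_volume_Ioc]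

instance : SigmaFinite (Measure.comap ((↑) : ℝ≥0 → ℝ) volume) := by
  refine ⟨⟨⟨fun k => Set.Ioc 0 (k : ℝ≥0) ∪ {0}, fun _ => trivial, fun k => ?_, ?_⟩⟩⟩
  · refine (measure_union_le _ _).trans_lt (ENNReal.add_lt_top.2 ⟨?_, ?_⟩)
    · rw [comap_volume_Ioc]; simp
    · have he : MeasurableEmbedding ((↑) : ℝ≥0 → ℝ) :=
        MeasurableEmbedding.subtype_coe measurableSet_Ici
      rw [he.comap_apply]
      simp
  · refine Set.eq_univ_of_forall fun x => ?_
    obtain ⟨k, hk⟩ := exists_nat_ge x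
    rcases eq_or_ne x 0 with rfl | h0
    · exact Set.mem_iUnion.2 ⟨0, .inr rfl⟩
    · exact Set.mem_iUnion.2 ⟨k, .inl ⟨pos_of_ne_zero h0, hk⟩⟩

theorem sFinite_intensity [SFinite μ] : SFinite (intensity μ) := by
  have : SFinite (markMeasure μ) := inferInstance
  exact inferInstanceAs (SFinite ((Measure.comap ((↑) : ℝ≥0 → ℝ) volume).prod (markMeasure μ)))

variable {n : ℕ+}

theorem markMeasure_typeMarks [SFinite μ] (p : JumpType n) :
    markMeasure μ (typeMarks p) = μ {γ | γ.toFin n = p.1.1} := by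
  have : (typeMarks p : Set (CInf × ℕ+)) = {γ | γ.toFin n = p.1.1} ×ˢ {(p.1.2 : ℕ+)} := rfl
  rw [this, markMeasure, Measure.prod_prod, Measure.count_singleton, mul_one]

theorem markMeasure_activeMarks [SFinite μ] :
    markMeasure μ (activeMarks n) = ∑ p : JumpType n, μ {γ | γ.toFin n = p.1.1} := by
  rw [activeMarks_eq, measure_iUnion (fun p p' h => disjoint_typeMarks h) measurableSet_typeMarks,
    tsum_fintype]
  simp only [markMeasure_typeMarks]

theorem IsFragMeasure.lt_top_of_ne (hμ : IsFragMeasure μ) {δ : CFin n} (h : δ ≠ oneFin n) :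
    μ {γ | γ.toFin n = δ} < ∞ := by
  refine (measure_mono ?_).trans_lt (hμ.lt_top n)
  rintro γ rfl
  exact h

theorem IsFragMeasure.markMeasure_ne_top (hμ : IsFragMeasure μ) :
    markMeasure μ (activeMarks n) ≠ ∞ := by
  have := hμ.sigmaFinite
  rw [markMeasure_activeMarks]
  exact ENNReal.sum_ne_top.2 fun p _ => (hμ.lt_top_of_ne p.2).ne

/-- The rate at which a jump occurs. -/
def jumpRate (μ : Measure CInf) (p : JumpType n) : ℝ := μ.real {γ | γ.toFin n = p.1.1}

/-- The total rate of the jumps in `𝒞_n`. -/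
def totalRate (μ : Measure CInf) (n : ℕ+) : ℝ := (markMeasure μ).real (activeMarks n)

theorem IsFragMeasure.real_diff_typeMarks (hμ : IsFragMeasure μ) (p : JumpType n) :
    (markMeasure μ).real (activeMarks n \ typeMarks p) = totalRate μ n - jumpRate μ p := by
  have := hμ.sigmaFinite
  rw [measureReal_sdiff (typeMarks_subset p) (measurableSet_typeMarks p) hμ.markMeasure_ne_top]
  congr 1
  rw [measureReal_def, markMeasure_typeMarks]
  rfl

end Intensity

/-! ### Counting marks -/

section Poisson

variable {Ω : Type u} [MeasurableSpace Ω] {P : Measure Ω}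
  {M : Ω → Measure Marks} {μ : Measure CInf} {n : ℕ+}

theorem IsPoissonMeasure.isPointMeasure {E : Type*} [MeasurableSpace E] {M : Ω → Measure E}
    {ν : Measure E} (hM : IsPoissonMeasure M ν P) (ω : Ω) : IsPointMeasure (M ω) :=
  fun A hA => hM.integer_valued ω A hA

theorem IsPoissonMeasure.measure_le {E : Type*} [MeasurableSpace E] {M : Ω → Measure E}
    {ν : Measure E} (hM : IsPoissonMeasure M ν P) {A : Set E} (hA : MeasurableSet A)
    (hν : ν A ≠ ∞) (k : ℕ) : P {ω | M ω A ≤ k} = poissonMeasure (ν A).toNNReal (Set.Iic k) := by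
  rw [← map_natCast_Iic, ← hM.poisson A hA hν, Measure.map_apply (hM.measurable A hA)
    measurableSet_Iic]
  rfl

theorem IsPoissonMeasure.real_eq_zero {E : Type*} [MeasurableSpace E] {M : Ω → Measure E}
    {ν : Measure E} (hM : IsPoissonMeasure M ν P) {A : Set E} (hA : MeasurableSet A)
    (hν : ν A ≠ ∞) : P.real {ω | M ω A = 0} = Real.exp (-(ν.real A)) := by
  have h := hM.measure_le hA hν 0
  have e : {ω | M ω A ≤ (0 : ℕ)} = {ω | M ω A = 0} := by ext ω; simp
  rw [e, poissonMeasure_Iic] at h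
  rw [measureReal_def, h]
  simp [ENNReal.toReal_ofReal (Real.exp_nonneg _)]
  rfl

/-- With `x` the intensity of `A`, `1 - (1 + x) exp (-x) ≤ 1 - (1 + x)(1 - x) = x ^ 2`. -/
theorem IsPoissonMeasure.real_two_le [IsProbabilityMeasure P] {E : Type*} [MeasurableSpace E] {M : Ω → Measure E}
    {ν : Measure E} (hM : IsPoissonMeasure M ν P) {A : Set E} (hA : MeasurableSet A)
    (hν : ν A ≠ ∞) : P.real {ω | ¬ M ω A ≤ 1} ≤ ν.real A ^ 2 := by
  have h := hM.measure_le hA hν 1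
  have hm : MeasurableSet {ω | M ω A ≤ (1 : ℕ)} :=
    measurableSet_le (hM.measurable A hA) measurable_const
  have e : {ω | ¬ M ω A ≤ 1} = {ω | M ω A ≤ (1 : ℕ)}ᶜ := by ext ω; simp
  have hx : ((ν A).toNNReal : ℝ) = ν.real A := rfl
  have hx0 : 0 ≤ ν.real A := measureReal_nonneg
  rw [e, probReal_compl_eq_one_sub hm, measureReal_def, h, poissonMeasure_Iic,
    ENNReal.toReal_sum fun _ _ => ENNReal.ofReal_ne_top]
  simp only [Finset.sum_range_succ, Finset.range_zero, Finset.sum_empty, hx]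
  rw [ENNReal.toReal_ofReal (by positivity), ENNReal.toReal_ofReal (by positivity)]
  have := Real.one_sub_le_exp_neg (ν.real A)
  simp only [pow_zero, Nat.factorial, pow_one, zero_add, mul_one, Nat.cast_one, div_one]
  nlinarith

theorem IsFragMeasure.intensity_real_slab (hμ : IsFragMeasure μ) (a h : ℝ≥0) (i : ℕ) (C : Set (CInf × ℕ+)) :
    (intensity μ).real (slab a h i ×ˢ C) = h * (markMeasure μ).real C := by
  have := hμ.sigmaFinite
  have e : a + (i + 1 : ℕ) * h - (a + i * h) = h := by
    rw [add_tsub_add_eq_tsub_left]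
    push_cast
    rw [add_mul, one_mul, add_tsub_cancel_left]
  rw [measureReal_def, slab, intensity_slab, e, ENNReal.toReal_mul]
  rfl

theorem IsFragMeasure.intensity_slab_ne_top (hμ : IsFragMeasure μ) (a h : ℝ≥0) (i : ℕ) {C : Set (CInf × ℕ+)} (hC : C ⊆ activeMarks n) :
    intensity μ (slab a h i ×ˢ C) ≠ ∞ := by
  have := hμ.sigmaFinite
  rw [slab, intensity_slab]
  exact ENNReal.mul_ne_top ENNReal.coe_ne_top
    (measure_ne_top_of_subset hC hμ.markMeasure_ne_top)

variable [IsProbabilityMeasure P]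
variable (hμ : IsFragMeasure μ) (hM : IsPoissonMeasure M (intensity μ) P)
include hμ hM

/-- Union bound over the `N` intervals. With `h = r / N` the bound is of order `1 / N`. -/
theorem real_not_sparse (a h : ℝ≥0) (N : ℕ) :
    P.real {ω | ¬ Sparse (M ω) n a h N} ≤ N * (h * totalRate μ n) ^ 2 := by
  have : {ω | ¬ Sparse (M ω) n a h N} =
      ⋃ i ∈ Finset.range N, {ω | ¬ M ω (slab a h i ×ˢ activeMarks n) ≤ 1} := by
    ext ω; simp [Sparse]
  rw [this]
  refine (measureReal_biUnion_finset_le _ _).trans ?_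
  refine (Finset.sum_le_sum (g := fun _ => (h * totalRate μ n) ^ 2) fun i _ => ?_).trans ?_
  · refine (hM.real_two_le (measurableSet_Ioc.prod (measurableSet_activeMarks n))
      (hμ.intensity_slab_ne_top a h i subset_rfl)).trans (le_of_eq ?_)
    exact congrArg (· ^ 2) (hμ.intensity_real_slab a h i _)
  · simp

theorem tendsto_not_sparse (a r : ℝ≥0) :
    Tendsto (fun N : ℕ => P.real {ω | ¬ Sparse (M ω) n a (r / N) N}) atTop (𝓝 0) := by
  have h1 : Tendsto (fun N : ℕ => (r * totalRate μ n) ^ 2 / (N : ℝ)) atTop (𝓝 0) :=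
    tendsto_const_div_atTop_nhds_zero_nat _
  refine squeeze_zero (fun N => measureReal_nonneg) (fun N => ?_) h1
  refine (real_not_sparse hμ hM a (r / N) N).trans (le_of_eq ?_)
  rcases Nat.eq_zero_or_pos N with rfl | hN
  · simp
  · push_cast
    field_simp

/-- The event that every subdivision fails has at most the probability that the `N`-th one fails,
for each `N`, and this tends to 0. -/
theorem ae_exists_sparse (a r : ℝ≥0) :
    ∀ᵐ ω ∂P, ∃ N : ℕ, 0 < N ∧ Sparse (M ω) n a (r / N) N := by
  have h0 : P.real {ω | ¬ ∃ N : ℕ, 0 < N ∧ Sparse (M ω) n a (r / N) N} = 0 := by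
    refine le_antisymm ?_ measureReal_nonneg
    refine ge_of_tendsto (tendsto_not_sparse (n := n) hμ hM a r) ?_
    filter_upwards [eventually_gt_atTop 0] with N hN
    exact measureReal_mono fun ω hω hc => hω ⟨N, hN, hc⟩
  rw [ae_iff]
  exact (measureReal_eq_zero_iff).1 h0

theorem ae_locallySparse : ∀ᵐ ω ∂P, ∀ n, LocallySparse (M ω) n := by
  rw [ae_all_iff]
  intro n
  have : ∀ᵐ ω ∂P, ∀ T : ℕ, ∃ N : ℕ, 0 < N ∧ Sparse (M ω) n 0 (T / N) N := by
    rw [ae_all_iff]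
    exact fun T => ae_exists_sparse hμ hM 0 T
  filter_upwards [this] with ω hω T
  obtain ⟨k, hk⟩ := exists_nat_ge T
  obtain ⟨N, hN, h⟩ := hω k
  refine ⟨k / N, N, ?_, h⟩
  have : (N : ℝ≥0) ≠ 0 := by exact_mod_cast hN.ne'
  rwa [mul_div_cancel₀ _ this]

theorem ae_existsUnique_path : ∀ᵐ ω ∂P, (∀ n, ∃! f, IsPoissonPathFin (M ω) n f) ∧
    ∃! f, IsPoissonPath (M ω) f := by
  filter_upwards [ae_locallySparse hμ hM] with ω hω
  exact ⟨fun n => existsUnique_poissonPathFin (hM.isPointMeasure ω) (hω n),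
    existsUnique_poissonPath (hM.isPointMeasure ω) hω⟩

end Poisson


/-! ### The past of a random measure -/

section Past

variable {Ω : Type u} {mΩ : MeasurableSpace Ω} {E : Type*} [MeasurableSpace E]

theorem comap_pi_le {ι : Type*} {m' : MeasurableSpace Ω} {f : ι → Ω → ℝ≥0∞}
    (h : ∀ i, Measurable[m'] (f i)) :
    MeasurableSpace.comap (fun ω i => f i ω) inferInstance ≤ m' :=
  Measurable.comap_le (measurable_pi_lambda _ h)

theorem measurable_comap_pi {ι : Type*} (f : ι → Ω → ℝ≥0∞) (i : ι) :
    Measurable[MeasurableSpace.comap (fun ω i => f i ω) inferInstance] (f i) :=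
  (measurable_pi_apply (X := fun _ : ι => ℝ≥0∞) i).comp
    (comap_measurable (fun ω i => f i ω))

/-- The σ-algebra generated by the random measure `M` inside `B`. -/
abbrev insideAlg (M : Ω → Measure E) (B : Set E) : MeasurableSpace Ω :=
  ⨆ I : Finset {A : Set E // MeasurableSet A ∧ A ⊆ B},
    MeasurableSpace.comap (fun ω (A : I) => M ω A.1.1) inferInstance

theorem insideAlg_le {M : Ω → Measure E} (hM : ∀ A, MeasurableSet A → Measurable fun ω => M ω A)
    (B : Set E) : insideAlg M B ≤ mΩ :=
  iSup_le fun _ => Measurable.comap_le (measurable_pi_lambda _ fun A => hM _ A.1.2.1)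

theorem measurable_insideAlg {M : Ω → Measure E} {B A : Set E} (hA : MeasurableSet A)
    (hAB : A ⊆ B) : Measurable[insideAlg M B] fun ω => M ω A := by
  let A' : {A : Set E // MeasurableSet A ∧ A ⊆ B} := ⟨A, hA, hAB⟩
  have h1 : MeasurableSpace.comap (fun ω (A : ({A'} : Finset _)) => M ω A.1.1) inferInstance ≤
      insideAlg M B := le_iSup (fun I : Finset {A : Set E // MeasurableSet A ∧ A ⊆ B} =>
    MeasurableSpace.comap (fun ω (A : I) => M ω A.1.1) inferInstance) {A'}
  exact Measurable.mono (measurable_comap_pi (fun (A : ({A'} : Finset _)) ω => M ω A.1.1)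
    ⟨A', Finset.mem_singleton_self A'⟩) h1 le_rfl

theorem insideAlg_mono (M : Ω → Measure E) {B B' : Set E} (h : B ⊆ B') :
    insideAlg M B ≤ insideAlg M B' := by
  refine iSup_le fun I => ?_
  exact comap_pi_le fun A => measurable_insideAlg A.1.2.1 (A.1.2.2.trans h)

/-- The definition of a Poisson measure only gives independence over disjoint sets. A finite family
of subsets of `B` is therefore replaced by the partition that it generates; the finite families are
directed, which gives the whole σ-algebra. -/
theorem IsPoissonMeasure.indep_insideAlg {P : Measure Ω} [IsProbabilityMeasure P]
    {M : Ω → Measure E} {ν : Measure E} (hM : IsPoissonMeasure M ν P) {B S : Set E}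
    (hB : MeasurableSet B) (hS : MeasurableSet S) (hd : Disjoint S B) :
    Indep (insideAlg M B) (MeasurableSpace.comap (fun ω => M ω S) inferInstance) P := by
  classical
  refine indep_iSup_of_directed_le (fun I => ?_)
    (fun I => Measurable.comap_le (measurable_pi_lambda _ fun A => hM.measurable _ A.1.2.1))
    (hM.measurable S hS).comap_le ?_
  -- The value at `none` is `S`; the value at `some s` is the set of points of `B` that lie in the
  -- members of `s` and in no other member of the family.
  · let C : Option (Set I) → Set E := fun o => o.elim S fun s => {x ∈ B | {A : I | x ∈ A.1.1} = s}
    have hC : ∀ o, MeasurableSet (C o) := by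
      rintro (_ | s)
      · exact hS
      · have : C (some s) = B ∩ ⋂ A : I, (if A ∈ s then A.1.1 else A.1.1ᶜ) := by
          ext x
          simp only [C, Option.elim_some, Set.mem_inter_iff, Set.mem_iInter]
          refine and_congr_right fun _ => ⟨?_, fun h => ?_⟩
          · rintro rfl A
            by_cases h : x ∈ A.1.1
            · simp [h]
            · simp [h]
          · ext A
            have := h A
            by_cases hA : A ∈ s
            · simpa [hA] using this
            · simpa [hA] using this
        rw [this]
        refine hB.inter (MeasurableSet.iInter fun A => ?_)
        split_ifs
        · exact A.1.2.1
        · exact A.1.2.1.compl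
    have hCd : ∀ o o', o ≠ o' → Disjoint (C o) (C o') := by
      rintro (_ | s) (_ | s') hne
      · exact absurd rfl hne
      · exact hd.mono_right fun x hx => hx.1
      · exact hd.symm.mono_left fun x hx => hx.1
      · refine Set.disjoint_left.2 fun x hx hx' => hne ?_
        rw [← hx.2, ← hx'.2]
    have e := Finite.equivFin (Option (Set I))
    have h1 := hM.indep _ (fun i => C (e.symm i)) (fun i => hC _)
      fun i j hij => hCd _ _ fun h => hij (e.symm.injective h)
    have h2 : iIndepFun (fun o ω => M ω (C o)) P := by
      have := h1.precomp (g := e) e.injective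
      simpa using this
    have _ : Fintype (Set I) := Fintype.ofFinite _
    let T : Finset (Option (Set I)) := Finset.univ.erase none
    have h3 := h2.indepFun_finset T {none}
      (by simp [T]) fun o => hM.measurable _ (hC o)
    have hmem : ∀ s : Set I, some s ∈ T := by simp [T]
    -- The mass of `A` is recovered by summing the masses of the cells contained in `A`.
    let φ : (T → ℝ≥0∞) → (I → ℝ≥0∞) := fun x A =>
      ∑ s : Set I, if A ∈ s then x ⟨some s, hmem s⟩ else 0
    have hφ : Measurable φ := by
      refine measurable_pi_lambda _ fun A => Finset.measurable_sum _ fun s _ => ?_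
      by_cases h : A ∈ s
      · simp only [h, if_true]; exact measurable_pi_apply _
      · simp only [h, if_false]; exact measurable_const
    have h4 := h3.comp (φ := φ) (ψ := fun (x : ↥({none} : Finset (Option (Set I))) → ℝ≥0∞) =>
        x ⟨none, Finset.mem_singleton_self _⟩) hφ
      (measurable_pi_apply (X := fun _ : ↥({none} : Finset (Option (Set I))) => ℝ≥0∞) _)
    have h5 : (fun ω (A : I) => M ω A.1.1) = φ ∘ (fun ω (o : T) => M ω (C o)) := by
      funext ω A
      simp only [Function.comp, φ]
      have : A.1.1 = ⋃ s ∈ (Finset.univ.filter fun s : Set I => A ∈ s), C (some s) := by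
        ext x
        simp only [Set.mem_iUnion, Finset.mem_filter, Finset.mem_univ, true_and]
        constructor
        · intro hx
          exact ⟨{A : I | x ∈ A.1.1}, hx, A.1.2.2 hx, rfl⟩
        · rintro ⟨s, hs, -, rfl⟩
          exact hs
      rw [← Finset.sum_filter]
      conv_lhs => rw [this]
      exact measure_biUnion_finset (fun s _ s' _ h => hCd _ _ (by simpa using h))
        fun s _ => hC _
    rw [h5]
    exact h4
  · intro I J
    refine ⟨I ∪ J, ?_, ?_⟩
    · exact comap_pi_le fun A => measurable_comap_pi
        (fun (A : (I ∪ J : Finset _)) ω => M ω A.1.1) ⟨A.1, Finset.mem_union_left _ A.2⟩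
    · exact comap_pi_le fun A => measurable_comap_pi
        (fun (A : (I ∪ J : Finset _)) ω => M ω A.1.1) ⟨A.1, Finset.mem_union_right _ A.2⟩

end Past

/-! ### Measurability of the discretized dynamics -/

section Measurability

variable {Ω : Type u} [MeasurableSpace Ω] {M : Ω → Measure Marks} {n : ℕ+}

theorem measurableSet_onlyType {J : Set ℝ≥0}
    (hM : ∀ C, MeasurableSet C → Measurable fun ω => M ω (J ×ˢ C)) (p : JumpType n) :
    MeasurableSet {ω | OnlyType (M ω) J p} :=
  (hM _ ((measurableSet_activeMarks n).diff (measurableSet_typeMarks p))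
    (measurableSet_singleton 0)).inter
    (hM _ (measurableSet_activeMarks n) (measurableSet_singleton 0).compl)

theorem measurableSet_step {J : Set ℝ≥0}
    (hM : ∀ C, MeasurableSet C → Measurable fun ω => M ω (J ×ˢ C)) (γ γ' : CFin n) :
    MeasurableSet {ω | step (M ω) n J γ = γ'} := by
  have : {ω | step (M ω) n J γ = γ'} =
      (⋃ p : JumpType n, ⋃ (_ : jump p γ = γ'), {ω | OnlyType (M ω) J p}) ∪
        {ω | γ = γ' ∧ ∀ p : JumpType n, ¬ OnlyType (M ω) J p} := by
    ext ω
    by_cases h : ∃ p : JumpType n, OnlyType (M ω) J p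
    · obtain ⟨p, hp⟩ := h
      have h1 : ∀ p', OnlyType (M ω) J p' ↔ p' = p :=
        fun p' => ⟨fun h => h.eq hp, fun h => h ▸ hp⟩
      simp only [step_of_onlyType hp, h1, Set.mem_ofPred_eq, Set.mem_union, Set.mem_iUnion,
        exists_prop, exists_eq_right]
      exact ⟨.inl, fun h => h.elim id fun h => absurd rfl (h.2 p)⟩
    · have h' := h
      push Not at h'
      simp [step_of_not h, h']
  rw [this]
  refine (MeasurableSet.iUnion fun p => MeasurableSet.iUnion fun _ =>
    measurableSet_onlyType hM p).union ?_
  simp only [Set.ofPred_and, Set.ofPred_forall]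
  exact (MeasurableSet.const _).inter
    (MeasurableSet.iInter fun p => (measurableSet_onlyType hM p).compl)

/-- Only the masses of the intervals in question enter the hypothesis, so the lemma also applies
with the σ-algebra of the past at the end of these intervals. -/
theorem measurableSet_steps {a h : ℝ≥0} {N : ℕ}
    (hM : ∀ i < N, ∀ C, MeasurableSet C → Measurable fun ω => M ω (slab a h i ×ˢ C))
    (γ γ' : CFin n) : MeasurableSet {ω | steps (M ω) n a h N γ = γ'} := by
  induction N generalizing γ' with
  | zero => exact MeasurableSet.const (γ = γ')
  | succ N ih =>
    have : {ω | steps (M ω) n a h (N + 1) γ = γ'} = ⋃ x, {ω | steps (M ω) n a h N γ = x} ∩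
        {ω | step (M ω) n (slab a h N) x = γ'} := by
      ext ω; simp [steps]
    rw [this]
    exact MeasurableSet.iUnion fun x => (ih (fun i hi => hM i (hi.trans N.lt_succ_self)) x).inter
      (measurableSet_step (hM N N.lt_succ_self) x γ')

theorem measurableSet_sparse {a h : ℝ≥0} {N : ℕ}
    (hM : ∀ i < N, ∀ C, MeasurableSet C → Measurable fun ω => M ω (slab a h i ×ˢ C)) :
    MeasurableSet {ω | Sparse (M ω) n a h N} := by
  simp only [Sparse, Set.ofPred_forall]
  exact MeasurableSet.iInter fun i => MeasurableSet.iInter fun hi =>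
    measurableSet_le (hM i hi _ (measurableSet_activeMarks n)) measurable_const

end Measurability

/-- The past of the random measure `M` at time `t`. -/
abbrev pastAlg {Ω : Type u} (M : Ω → Measure Marks) (t : ℝ≥0) : MeasurableSpace Ω :=
  insideAlg M (Set.Iic t ×ˢ Set.univ)

theorem measurable_pastAlg {Ω : Type u} [MeasurableSpace Ω] {M : Ω → Measure Marks} {t : ℝ≥0} {J : Set ℝ≥0}
    (hJ : MeasurableSet J) (hJt : J ⊆ Set.Iic t) {C : Set (CInf × ℕ+)} (hC : MeasurableSet C) :
    Measurable[pastAlg M t] fun ω => M ω (J ×ˢ C) :=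
  measurable_insideAlg (hJ.prod hC) (Set.prod_mono hJt (Set.subset_univ _))

theorem slab_subset_Iic (a h : ℝ≥0) {i N : ℕ} (hi : i < N) :
    slab a h i ⊆ Set.Iic (a + N * h) := by
  intro x hx
  refine hx.2.trans ?_
  gcongr
  exact_mod_cast hi

/-! ### The law of the discretized dynamics -/

section Law

variable {n : ℕ+}

/-- The probability that the marks in an interval of length `h` are all of type `p`. -/
def onlyProb (μ : Measure CInf) (h : ℝ) (p : JumpType n) : ℝ :=
  Real.exp (-(h * (totalRate μ n - jumpRate μ p))) - Real.exp (-(h * totalRate μ n))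

/-- The transition matrix of a discretization step of length `h`. -/
def stepMat (μ : Measure CInf) (n : ℕ+) (h : ℝ) : Matrix (CFin n) (CFin n) ℝ := fun γ γ' =>
  ∑ p : JumpType n, onlyProb μ h p *
    ((if jump p γ = γ' then 1 else 0) - if γ = γ' then 1 else 0) + if γ = γ' then 1 else 0

/-- The jump rates of the fragmentation process on `𝒞_n`. -/
def rates (μ : Measure CInf) (n : ℕ+) (x : CFin n) : ℝ :=
  if x = oneFin n then -∑ y ∈ Finset.univ.erase (oneFin n), μ.real {γ | γ.toFin n = y}
  else μ.real {γ | γ.toFin n = x}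

theorem sum_rates (μ : Measure CInf) (n : ℕ+) : ∑ x, rates μ n x = 0 := by
  rw [← Finset.add_sum_erase _ _ (Finset.mem_univ (oneFin n))]
  have h : ∑ x ∈ Finset.univ.erase (oneFin n), rates μ n x =
      ∑ x ∈ Finset.univ.erase (oneFin n), μ.real {γ | γ.toFin n = x} :=
    Finset.sum_congr rfl fun x hx => if_neg (Finset.ne_of_mem_erase hx)
  rw [h]
  simp [rates]

theorem rates_of_ne (μ : Measure CInf) {x : CFin n} (hx : x ≠ oneFin n) :
    rates μ n x = μ.real {γ | γ.toFin n = x} := if_neg hx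

/-- The rates sum to 0, so the term of the trivial composition, which leaves `γ` unchanged, is
subtracted from each of the others. -/
theorem genM_rates (μ : Measure CInf) (γ γ' : CFin n) :
    genM (seg_nonempty n) (rates μ n) γ γ' = ∑ p : JumpType n, jumpRate μ p *
      ((if jump p γ = γ' then 1 else 0) - if γ = γ' then 1 else 0) := by
  have h1 : ∀ g : CFin n → ℝ, ∑ x, rates μ n x * g x =
      ∑ x ∈ Finset.univ.erase (oneFin n), μ.real {δ | δ.toFin n = x} * (g x - g (oneFin n)) := by
    intro g
    rw [← Finset.add_sum_erase _ _ (Finset.mem_univ (oneFin n)), rates, if_pos rfl, neg_mul,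
      Finset.sum_mul, ← sub_eq_neg_add, ← Finset.sum_sub_distrib]
    refine Finset.sum_congr rfl fun x hx => ?_
    rw [rates_of_ne μ (Finset.ne_of_mem_erase hx)]
    ring
  unfold genM
  rw [Finset.sum_congr rfl fun k _ => h1 _]
  have h2 : ∀ k : seg n, γ.frag (Function.update (fun _ => Comp.one (seg n) (seg_nonempty n)) k
      (oneFin n)) = γ := by
    intro k
    have : Function.update (fun _ => Comp.one (seg n) (seg_nonempty n)) k (oneFin n) =
        fun _ => oneFin n := Function.update_eq_self k _
    rw [this, Comp.frag_oneFin]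
  simp only [h2]
  rw [Finset.sum_comm, ← Finset.sum_product' (Finset.univ.erase (oneFin n)) Finset.univ
    (fun x k => μ.real {δ | δ.toFin n = x} *
      ((if γ.frag (Function.update (fun _ => Comp.one (seg n) (seg_nonempty n)) k x) = γ'
        then 1 else 0) - if γ = γ' then 1 else 0))]
  symm
  refine Finset.sum_bij (fun p _ => p.1) (fun p _ => ?_) (fun p _ p' _ h => Subtype.ext h) ?_ ?_
  · simpa using p.2
  · intro x hx
    simp only [Finset.mem_product, Finset.mem_erase, Finset.mem_univ, and_true] at hx
    exact ⟨⟨x, hx⟩, Finset.mem_univ _, rfl⟩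
  · intro p _
    rfl

theorem stepMat_zero (μ : Measure CInf) : stepMat μ n 0 = 1 := by
  ext γ γ'
  simp [stepMat, onlyProb, Matrix.one_apply]

/-- At first order in `h`, the probability that there are marks and that all are of type `p` is `h`
times the rate of `p`. How `step` treats several marks in one interval is therefore irrelevant in
the limit. -/
theorem hasDerivWithinAt_stepMat (μ : Measure CInf) (γ γ' : CFin n) :
    HasDerivWithinAt (fun h => stepMat μ n h γ γ') (genM (seg_nonempty n) (rates μ n) γ γ')
      (Set.Ioi 0) 0 := by
  rw [genM_rates]
  refine HasDerivAt.hasDerivWithinAt ?_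
  refine HasDerivAt.add_const _ (HasDerivAt.fun_sum fun p _ => HasDerivAt.mul_const ?_ _)
  have h1 : ∀ c : ℝ, HasDerivAt (fun h : ℝ => Real.exp (-(h * c))) (-c) 0 := by
    intro c
    have := (((hasDerivAt_id (0 : ℝ)).mul_const c).neg).exp
    simpa using this
  have := (h1 (totalRate μ n - jumpRate μ p)).fun_sub (h1 (totalRate μ n))
  rwa [show -(totalRate μ n - jumpRate μ p) - -totalRate μ n = jumpRate μ p by ring] at this

theorem tendsto_stepMat_pow (μ : Measure CInf) {r : ℝ} (hr : 0 < r) :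
    Tendsto (fun N : ℕ => stepMat μ n (r / N) ^ N) atTop
      (𝓝 (chain (seg_nonempty n) (rates μ n) r)) :=
  tendsto_pow_chain (seg_nonempty n) (hasDerivWithinAt_stepMat μ) (stepMat_zero μ) hr

variable {Ω : Type u} [MeasurableSpace Ω] {P : Measure Ω} [IsProbabilityMeasure P]
  {M : Ω → Measure Marks} {μ : Measure CInf}
  (hμ : IsFragMeasure μ) (hM : IsPoissonMeasure M (intensity μ) P)
include hμ hM

theorem real_inter_eq_zero {t a h : ℝ≥0} {i : ℕ} (hta : t ≤ a + i * h) {B : Set Ω}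
    (hB : MeasurableSet[pastAlg M t] B) {C : Set (CInf × ℕ+)} (hC : MeasurableSet C)
    (hCa : C ⊆ activeMarks n) :
    P.real (B ∩ {ω | M ω (slab a h i ×ˢ C) = 0}) =
      P.real B * Real.exp (-(h * (markMeasure μ).real C)) := by
  have hm : MeasurableSet (slab a h i ×ˢ C) := measurableSet_Ioc.prod hC
  have hd : Disjoint (slab a h i ×ˢ C) (Set.Iic t ×ˢ (Set.univ : Set (CInf × ℕ+))) := by
    refine Set.disjoint_left.2 fun x hx hx' => ?_
    exact absurd (hx'.1.trans hta) (not_le.2 hx.1.1)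
  have h1 := (Indep_iff _ _ _).1
    (hM.indep_insideAlg (measurableSet_Iic.prod MeasurableSet.univ) hm hd) B
    {ω | M ω (slab a h i ×ˢ C) = 0} hB ⟨{0}, measurableSet_singleton 0, rfl⟩
  rw [measureReal_def, h1, ENNReal.toReal_mul]
  congr 1
  rw [← measureReal_def, hM.real_eq_zero hm (hμ.intensity_slab_ne_top a h i hCa),
    hμ.intensity_real_slab]

/-- The event is the difference of two nested void events: no mark of another type, and no mark at
all. Each has an exponential probability and is independent of the past. -/
theorem real_inter_onlyType {t a h : ℝ≥0} {i : ℕ} (hta : t ≤ a + i * h) {B : Set Ω}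
    (hB : MeasurableSet[pastAlg M t] B) (p : JumpType n) :
    P.real (B ∩ {ω | OnlyType (M ω) (slab a h i) p}) = P.real B * onlyProb μ h p := by
  have hactive := measurableSet_activeMarks n
  have hC := hactive.diff (measurableSet_typeMarks p)
  have e : B ∩ {ω | OnlyType (M ω) (slab a h i) p} =
      (B ∩ {ω | M ω (slab a h i ×ˢ (activeMarks n \ typeMarks p)) = 0}) \
        (B ∩ {ω | M ω (slab a h i ×ˢ activeMarks n) = 0}) := by
    ext ω
    simp only [OnlyType, Set.mem_inter_iff, Set.mem_sdiff, Set.mem_ofPred_eq]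
    tauto
  have hB' : MeasurableSet B := insideAlg_le hM.measurable _ _ hB
  have hsub : B ∩ {ω | M ω (slab a h i ×ˢ activeMarks n) = 0} ⊆
      B ∩ {ω | M ω (slab a h i ×ˢ (activeMarks n \ typeMarks p)) = 0} :=
    Set.inter_subset_inter_right _ fun ω hω =>
      measure_mono_null (Set.prod_mono_right Set.sdiff_subset) hω
  rw [e, measureReal_sdiff hsub (hB'.inter
      (hM.measurable _ (measurableSet_Ioc.prod hactive) (measurableSet_singleton 0))),
    real_inter_eq_zero hμ hM hta hB hC Set.sdiff_subset,
    real_inter_eq_zero hμ hM hta hB hactive subset_rfl, hμ.real_diff_typeMarks, onlyProb]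
  exact (mul_sub _ _ _).symm

theorem real_inter_step {t a h : ℝ≥0} {i : ℕ} (hta : t ≤ a + i * h) {B : Set Ω}
    (hB : MeasurableSet[pastAlg M t] B) (γ γ' : CFin n) :
    P.real (B ∩ {ω | step (M ω) n (slab a h i) γ = γ'}) = P.real B * stepMat μ n h γ γ' := by
  classical
  have hB' : MeasurableSet B := insideAlg_le hM.measurable _ _ hB
  have hMm : ∀ C, MeasurableSet C → Measurable fun ω => M ω (slab a h i ×ˢ C) :=
    fun C hC => hM.measurable _ (measurableSet_Ioc.prod hC)
  have hO : ∀ p : JumpType n, MeasurableSet {ω | OnlyType (M ω) (slab a h i) p} :=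
    fun p => measurableSet_onlyType hMm p
  -- The step changes `γ` only if all marks have a common type, and that type is unique; the
  -- indicator is thus a constant plus a sum of indicators of disjoint events.
  have hpt : ∀ ω, ({ω | step (M ω) n (slab a h i) γ = γ'}.indicator (fun _ => (1 : ℝ)) ω) =
      ∑ p : JumpType n, {ω | OnlyType (M ω) (slab a h i) p}.indicator (fun _ =>
        ((if jump p γ = γ' then 1 else 0) - if γ = γ' then 1 else 0 : ℝ)) ω +
        if γ = γ' then 1 else 0 := by
    intro ω
    by_cases hex : ∃ p : JumpType n, OnlyType (M ω) (slab a h i) p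
    · obtain ⟨p, hp⟩ := hex
      rw [Finset.sum_eq_single p]
      · simp [Set.indicator_apply, hp, step_of_onlyType hp]
      · intro p' _ hne
        have : ¬ OnlyType (M ω) (slab a h i) p' := fun h' => hne (h'.eq hp)
        simp [this]
      · simp
    · rw [Finset.sum_eq_zero]
      · simp [Set.indicator_apply, step_of_not hex]
      · intro p _
        have : ¬ OnlyType (M ω) (slab a h i) p := fun h' => hex ⟨p, h'⟩
        simp [this]
  have h1 : ∫ ω in B, {ω | step (M ω) n (slab a h i) γ = γ'}.indicator (fun _ => (1 : ℝ)) ω ∂P =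
      P.real (B ∩ {ω | step (M ω) n (slab a h i) γ = γ'}) := by
    rw [setIntegral_indicator (measurableSet_step hMm γ γ')]
    simp
  rw [← h1]
  simp only [hpt]
  rw [integral_add (integrable_finsetSum _ fun p _ =>
      (integrable_const _).indicator (hO p)) (integrable_const _),
    integral_finsetSum _ fun p _ => (integrable_const _).indicator (hO p)]
  simp only [setIntegral_indicator (hO _), setIntegral_const, smul_eq_mul,
    real_inter_onlyType hμ hM hta hB]
  rw [stepMat, mul_add, Finset.mul_sum]
  simp only [mul_assoc]

/-- The first `N` steps depend on the marks up to time `a + N * h`, and the next step is independent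
of these; this produces one more matrix factor. -/
theorem real_inter_steps {a h : ℝ≥0} {B : Set Ω} (hB : MeasurableSet[pastAlg M a] B) (N : ℕ)
    (γ γ' : CFin n) :
    P.real (B ∩ {ω | steps (M ω) n a h N γ = γ'}) = P.real B * (stepMat μ n h ^ N) γ γ' := by
  induction N generalizing γ' with
  | zero =>
    by_cases hγ : γ = γ' <;> simp [steps, hγ]
  | succ N ih =>
    have hB' : MeasurableSet B := insideAlg_le hM.measurable _ _ hB
    have hle : pastAlg M a ≤ pastAlg M (a + N * h) :=
      insideAlg_mono M (Set.prod_mono_left (Set.Iic_subset_Iic.2 (by simp)))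
    have hmeas : ∀ x, MeasurableSet[pastAlg M (a + N * h)]
        (B ∩ {ω | steps (M ω) n a h N γ = x}) := fun x => by
      refine @MeasurableSet.inter _ (pastAlg M (a + N * h)) _ _ (hle _ hB) ?_
      exact @measurableSet_steps _ (pastAlg M (a + N * h)) _ _ _ _ _
        (fun i hi C hC => measurable_pastAlg measurableSet_Ioc (slab_subset_Iic a h hi) hC) γ x
    have e : B ∩ {ω | steps (M ω) n a h (N + 1) γ = γ'} =
        ⋃ x ∈ (Finset.univ : Finset (CFin n)), (B ∩ {ω | steps (M ω) n a h N γ = x}) ∩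
          {ω | step (M ω) n (slab a h N) x = γ'} := by
      ext ω; simp [steps]
    have hd : ∀ x ∈ (Finset.univ : Finset (CFin n)), MeasurableSet
        ((B ∩ {ω | steps (M ω) n a h N γ = x}) ∩ {ω | step (M ω) n (slab a h N) x = γ'}) :=
      fun x _ => (insideAlg_le hM.measurable _ _ (hmeas x)).inter
        (measurableSet_step (fun C hC => hM.measurable _ (measurableSet_Ioc.prod hC)) x γ')
    rw [e, measureReal_biUnion_finset ?_ hd]
    · rw [pow_succ, Matrix.mul_apply, Finset.mul_sum]
      refine Finset.sum_congr rfl fun x _ => ?_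
      rw [real_inter_step hμ hM le_rfl (hmeas x), ih, mul_assoc]
    · intro x _ y _ hxy
      refine Set.disjoint_left.2 fun ω hω hω' => hxy ?_
      exact (hω.1.2 : _ = x).symm.trans hω'.1.2

end Law


/-! ### The process built from a Poisson measure -/

section Construct

variable {Ω : Type u} [MeasurableSpace Ω] {P : Measure Ω} {M : Ω → Measure Marks}
  {μ : Measure CInf} {n : ℕ+}

/-- The event that the path on `𝒞_n` built from `M` is equal to `γ` at time `t`, expressed through
the discretized dynamics. -/
def pathEvent (M : Ω → Measure Marks) (t : ℝ≥0) (γ : CFin n) : Set Ω :=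
  ⋃ N : ℕ, ⋃ _ : 0 < N, {ω | Sparse (M ω) n 0 (t / N) N} ∩
    {ω | steps (M ω) n 0 (t / N) N (oneFin n) = γ}

theorem natCast_mul_div {N : ℕ} (hN : 0 < N) (t : ℝ≥0) : (N : ℝ≥0) * (t / N) = t :=
  mul_div_cancel₀ t (by exact_mod_cast hN.ne')

theorem measurableSet_pathEvent (M : Ω → Measure Marks) (t : ℝ≥0) (γ : CFin n) :
    MeasurableSet[pastAlg M t] (pathEvent M t γ) := by
  refine @MeasurableSet.iUnion _ _ (pastAlg M t) _ _ fun N =>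
    @MeasurableSet.iUnion _ _ (pastAlg M t) _ _ fun hN => ?_
  have hle : ∀ i < N, slab 0 (t / N) i ⊆ Set.Iic t := fun i hi => by
    have := slab_subset_Iic 0 (t / N) hi
    rwa [zero_add, natCast_mul_div hN] at this
  exact @MeasurableSet.inter _ (pastAlg M t) _ _
    (@measurableSet_sparse _ (pastAlg M t) _ _ _ _ _
      fun i hi C hC => measurable_pastAlg measurableSet_Ioc (hle i hi) hC)
    (@measurableSet_steps _ (pastAlg M t) _ _ _ _ _
      (fun i hi C hC => measurable_pastAlg measurableSet_Ioc (hle i hi) hC) _ _)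

/-- Every sparse subdivision computes the same value `f t`, so the union over `N` in `pathEvent`
does not mix values. This makes the value of the path measurable with respect to the past of `M`. -/
theorem mem_pathEvent_iff {Ω : Type u} {M : Ω → Measure Marks} {ω : Ω} (hm : IsPointMeasure (M ω)) {f : ℝ≥0 → CFin n}
    (hf : IsPoissonPathFin (M ω) n f) {t : ℝ≥0}
    (hex : ∃ N : ℕ, 0 < N ∧ Sparse (M ω) n 0 (t / N) N) (γ : CFin n) :
    ω ∈ pathEvent M t γ ↔ f t = γ := by
  have key : ∀ N : ℕ, 0 < N → Sparse (M ω) n 0 (t / N) N →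
      steps (M ω) n 0 (t / N) N (oneFin n) = f t := fun N hN hS => by
    have := hf.eq_steps hm hS
    rw [zero_add, natCast_mul_div hN, hf.zero] at this
    exact this.symm
  simp only [pathEvent, Set.mem_iUnion]
  constructor
  · rintro ⟨N, hN, hS, h⟩
    exact (key N hN hS).symm.trans h
  · rintro rfl
    obtain ⟨N, hN, hS⟩ := hex
    exact ⟨N, hN, hS, key N hN hS⟩

variable [IsProbabilityMeasure P]

variable (hμ : IsFragMeasure μ) (hM : IsPoissonMeasure M (intensity μ) P)
include hμ hM

theorem ae_eq_pathEvent {Γ : ℝ≥0 → Ω → CInf} (hΓ : IsPoissonConstruction Γ M P) (t : ℝ≥0)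
    (γ : CFin n) : ({ω | (Γ t ω).toFin n = γ} : Set Ω) =ᵐ[P] pathEvent M t γ := by
  filter_upwards [hΓ.path, ae_exists_sparse (n := n) hμ hM 0 t] with ω hω hS
  exact propext (mem_pathEvent_iff (hM.isPointMeasure ω) (hω n) hS γ).symm

/-- The path exists outside a null event. It is measurable at rational times through `pathEvent`,
and at the other times by right continuity. -/
theorem exists_isPoissonConstruction : ∃ Γ, IsPoissonConstruction Γ M P := by
  classical
  -- Sparse subdivisions are required simultaneously at all levels and all rational times `i / (j +
  -- 1)`, which is a countable requirement.
  let G₀ : Set Ω := {ω | (∀ n, LocallySparse (M ω) n) ∧ ∀ (n : ℕ+) (i j : ℕ),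
    ∃ N : ℕ, 0 < N ∧ Sparse (M ω) n 0 (((i / (j + 1 : ℕ) : ℝ≥0)) / N) N}
  have hG₀ : ∀ᵐ ω ∂P, ω ∈ G₀ := by
    have h2 : ∀ᵐ ω ∂P, ∀ (n : ℕ+) (i j : ℕ),
        ∃ N : ℕ, 0 < N ∧ Sparse (M ω) n 0 (((i / (j + 1 : ℕ) : ℝ≥0)) / N) N := by
      simp only [ae_all_iff]
      exact fun n i j => ae_exists_sparse hμ hM 0 _
    filter_upwards [ae_locallySparse hμ hM, h2] with ω h h' using ⟨h, h'⟩
  -- A measurable event of full probability inside `G₀`; outside it the path is set equal to `𝟏_ℕ`.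
  let G : Set Ω := (toMeasurable P G₀ᶜ)ᶜ
  have hGm : MeasurableSet G := (measurableSet_toMeasurable _ _).compl
  have hGsub : G ⊆ G₀ := Set.compl_subset_comm.1 (subset_toMeasurable _ _)
  have hG : ∀ᵐ ω ∂P, ω ∈ G := by
    rw [ae_iff]
    have : {ω | ω ∉ G} = toMeasurable P G₀ᶜ := compl_compl _
    rw [this, measure_toMeasurable]
    exact hG₀
  have hex : ∀ ω ∈ G, ∃ f, IsPoissonPath (M ω) f := fun ω hω =>
    (existsUnique_poissonPath (hM.isPointMeasure ω) (hGsub hω).1).exists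
  have : Nonempty CInf := ⟨oneInf⟩
  choose! f hf using hex
  let Γ : ℝ≥0 → Ω → CInf := fun t ω => if ω ∈ G then f ω t else oneInf
  have hΓin : ∀ t, ∀ ω ∈ G, Γ t ω = f ω t := fun t ω hω => if_pos hω
  have hΓout : ∀ t ω, ω ∉ G → Γ t ω = oneInf := fun t ω hω => if_neg hω
  have hrat : ∀ (n : ℕ+) (i j : ℕ),
      Measurable fun ω => (Γ (i / (j + 1 : ℕ) : ℝ≥0) ω).toFin n := by
    intro n i j
    refine measurable_to_countable' fun γ => ?_
    have e : (fun ω => (Γ (i / (j + 1 : ℕ) : ℝ≥0) ω).toFin n) ⁻¹' {γ} =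
        (G ∩ pathEvent M (i / (j + 1 : ℕ) : ℝ≥0) γ) ∪ (Gᶜ ∩ {_ω | oneFin n = γ}) := by
      ext ω
      by_cases hω : ω ∈ G
      · simp only [Set.mem_preimage, Set.mem_singleton_iff, Set.mem_union, Set.mem_inter_iff, hω,
          true_and, Set.mem_compl_iff, not_true, false_and, or_false, hΓin _ ω hω]
        exact (mem_pathEvent_iff (hM.isPointMeasure ω) (hf ω hω n) ((hGsub hω).2 n i j) γ).symm
      · simp [hω, hΓout _ ω hω]
        rfl
    rw [e]
    exact (hGm.inter (insideAlg_le hM.measurable _ _ (measurableSet_pathEvent M _ γ))).union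
      (hGm.compl.inter (MeasurableSet.const _))
  refine ⟨Γ, fun t => measurable_toCInf fun n => ?_, ?_⟩
  -- Rational times that tend to `t`; the added 1 keeps them strictly above `t`, so that right
  -- continuity applies.
  · let s : ℕ → ℝ≥0 := fun j => ((⌊t * (j + 1 : ℕ)⌋₊ + 1 : ℕ) : ℝ≥0) / (j + 1 : ℕ)
    have hpos : ∀ j : ℕ, (0 : ℝ≥0) < (j + 1 : ℕ) := fun j => by exact_mod_cast j.succ_pos
    have hs1 : ∀ j, t < s j := fun j => by
      rw [lt_div_iff₀ (hpos j)]
      exact_mod_cast Nat.lt_floor_add_one (t * ((j + 1 : ℕ) : ℝ≥0))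
    have hs2 : ∀ j, s j ≤ t + 1 / (j + 1 : ℕ) := fun j => by
      have h1 : s j = (⌊t * (j + 1 : ℕ)⌋₊ : ℝ≥0) / (j + 1 : ℕ) + 1 / (j + 1 : ℕ) := by
        rw [← add_div]; simp [s]
      rw [h1]
      gcongr
      rw [div_le_iff₀ (hpos j)]
      exact Nat.floor_le zero_le
    have hs : Tendsto s atTop (𝓝[>] t) := by
      refine tendsto_nhdsWithin_iff.2 ⟨?_, Eventually.of_forall hs1⟩
      refine tendsto_of_tendsto_of_tendsto_of_le_of_le tendsto_const_nhds ?_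
        (fun j => (hs1 j).le) hs2
      have h2 : Tendsto (fun j : ℕ => (1 : ℝ≥0) / (j + 1 : ℕ)) atTop (𝓝 0) := by
        have := tendsto_one_div_add_atTop_nhds_zero_nat (𝕜 := ℝ≥0)
        simpa using this
      simpa using tendsto_const_nhds.add h2
    refine measurable_of_tendsto_metrizable (f := fun j ω => (Γ (s j) ω).toFin n)
      (fun j => hrat n _ j) (tendsto_pi_nhds.2 fun ω => ?_)
    rw [nhds_discrete, tendsto_pure]
    by_cases hω : ω ∈ G
    · simp only [hΓin _ ω hω]
      exact hs.eventually ((hf ω hω n).right t)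
    · simp only [hΓout _ ω hω, eventually_true]
  · filter_upwards [hG] with ω hω
    have : (fun t => Γ t ω) = f ω := funext fun t => hΓin t ω hω
    rw [this]
    exact hf ω hω

end Construct

/-- The past of a process. -/
abbrev procPast {Ω : Type u} {E : Type*} [MeasurableSpace E] (X : ℝ≥0 → Ω → E) (t : ℝ≥0) :
    MeasurableSpace Ω :=
  ⨆ r : Set.Iic t, MeasurableSpace.comap (X r) inferInstance

/-- The restrictions of the process `Γ` to the sets `[n]` are Markov chains, with respect to the
past of `Γ`, with the transition matrices associated with the measure `μ`. -/
structure HasTransitions {Ω : Type u} [MeasurableSpace Ω] (Γ : ℝ≥0 → Ω → CInf) (P : Measure Ω)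
    (μ : Measure CInf) : Prop where
  measurable : ∀ t, Measurable (Γ t)
  zero : ∀ᵐ ω ∂P, Γ 0 ω = oneInf
  trans : ∀ (n : ℕ+) (t r : ℝ≥0) (B : Set Ω), MeasurableSet[procPast Γ t] B →
    ∀ γ γ' : CFin n,
      P.real (B ∩ {ω | (Γ t ω).toFin n = γ} ∩ {ω | (Γ (t + r) ω).toFin n = γ'}) =
        P.real (B ∩ {ω | (Γ t ω).toFin n = γ}) * chain (seg_nonempty n) (rates μ n) r γ γ'

/-! ### Transition probabilities of the process built from a Poisson measure. -/

section Trans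

variable {Ω : Type u} [MeasurableSpace Ω] {P : Measure Ω} {M : Ω → Measure Marks}
  {μ : Measure CInf} {n : ℕ+} [IsProbabilityMeasure P] (hμ : IsFragMeasure μ)
  (hM : IsPoissonMeasure M (intensity μ) P)
include hμ hM

/-- Since `Γ` is tied to `M` only almost surely, its past lies in the completion of the past of `M`;
it is enough to check this on cylinders. -/
theorem exists_pastAlg_ae_eq {Γ : ℝ≥0 → Ω → CInf} (hΓ : IsPoissonConstruction Γ M P) {t : ℝ≥0}
    {B : Set Ω} (hB : MeasurableSet[procPast Γ t] B) :
    ∃ B', MeasurableSet[pastAlg M t] B' ∧ B =ᵐ[P] B' := by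
  have hle : procPast Γ t ≤ eventuallyMeasurableSpace (pastAlg M t) (ae P) := by
    refine iSup_le fun r => ?_
    rw [generateFrom_cylinders, MeasurableSpace.comap_generateFrom]
    refine MeasurableSpace.generateFrom_le ?_
    rintro _ ⟨_, ⟨n, D, rfl⟩, rfl⟩
    refine ⟨⋃ γ ∈ D, pathEvent M r γ, ?_, ?_⟩
    · refine @MeasurableSet.iUnion _ _ (pastAlg M t) _ _ fun γ =>
        @MeasurableSet.iUnion _ _ (pastAlg M t) _ _ fun _ => ?_
      exact insideAlg_mono M (Set.prod_mono_left (Set.Iic_subset_Iic.2 r.2)) _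
        (measurableSet_pathEvent M r γ)
    · have h1 : Γ r ⁻¹' {γ | γ.toFin n ∈ D} = ⋃ γ ∈ D, {ω | (Γ r ω).toFin n = γ} := by
        ext ω; simp
      rw [h1]
      exact Filter.EventuallyEq.countable_iUnion fun γ => Filter.EventuallyEq.countable_iUnion fun _ =>
        ae_eq_pathEvent hμ hM hΓ r γ
  exact hle B hB

/-- Unless a subdivision of the interval after `t` fails to be sparse, which has vanishing
probability, the value at `t + r` is obtained from that at `t` by `N` discrete steps independent of
the past. The matrices of these steps converge to `chain`. -/
theorem real_inter_path {Γ : ℝ≥0 → Ω → CInf} (hΓ : IsPoissonConstruction Γ M P) (t : ℝ≥0)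
    {r : ℝ≥0} (hr : 0 < r) {B : Set Ω} (hB : MeasurableSet[procPast Γ t] B) (γ γ' : CFin n) :
    P.real (B ∩ {ω | (Γ t ω).toFin n = γ} ∩ {ω | (Γ (t + r) ω).toFin n = γ'}) =
      P.real (B ∩ {ω | (Γ t ω).toFin n = γ}) *
        chain (seg_nonempty n) (rates μ n) r γ γ' := by
  obtain ⟨B', hB', hBB'⟩ := exists_pastAlg_ae_eq hμ hM hΓ hB
  set A : Set Ω := B' ∩ pathEvent M t γ with hA
  have hAm : MeasurableSet[pastAlg M t] A :=
    @MeasurableSet.inter _ (pastAlg M t) _ _ hB' (measurableSet_pathEvent M t γ)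
  have hBA : (B ∩ {ω | (Γ t ω).toFin n = γ} : Set Ω) =ᵐ[P] A :=
    hBB'.inter (ae_eq_pathEvent hμ hM hΓ t γ)
  set C : Set Ω := {ω | (Γ (t + r) ω).toFin n = γ'} with hC
  have e1 : P.real (B ∩ {ω | (Γ t ω).toFin n = γ} ∩ C) = P.real (A ∩ C) :=
    measureReal_congr (hBA.inter (Filter.EventuallyEq.refl _ _))
  have e2 : P.real (B ∩ {ω | (Γ t ω).toFin n = γ}) = P.real A := measureReal_congr hBA
  rw [e1, e2]
  let S : ℕ → Set Ω := fun N => {ω | steps (M ω) n t (r / N) N γ = γ'}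
  let Z : ℕ → Set Ω := fun N => {ω | ¬ Sparse (M ω) n t (r / N) N}
  have hZ : Tendsto (fun N => P.real (Z N)) atTop (𝓝 0) := tendsto_not_sparse hμ hM t r
  have hS : Tendsto (fun N => P.real (A ∩ S N)) atTop
      (𝓝 (P.real A * chain (seg_nonempty n) (rates μ n) r γ γ')) := by
    have h1 := tendsto_entry (tendsto_stepMat_pow (n := n) μ (r := r) (by exact_mod_cast hr)) γ γ'
    refine (h1.const_mul (P.real A)).congr fun N => ?_
    have := real_inter_steps hμ hM hAm (h := r / N) N γ γ'
    rw [this]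
    norm_cast
  -- On a sparse subdivision the discrete dynamics is exact, so the two events differ only inside `Z
  -- N`.
  have hkey : ∀ N : ℕ, 0 < N → ∀ᵐ ω ∂P, ω ∈ A → ω ∉ Z N → (ω ∈ S N ↔ ω ∈ C) := by
    intro N hN
    filter_upwards [hΓ.path, ae_eq_pathEvent (n := n) hμ hM hΓ t γ] with ω hω hE hωA hωZ
    have hγ : (Γ t ω).toFin n = γ := hE.symm.mp hωA.2
    have h1 := (hω n).eq_steps (hM.isPointMeasure ω) (not_not.1 hωZ)
    rw [natCast_mul_div hN, hγ] at h1
    simp only [S, hC, Set.mem_ofPred_eq, h1]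
  have hle1 : ∀ N : ℕ, 0 < N → P.real (A ∩ C) ≤ P.real (A ∩ S N) + P.real (Z N) := by
    intro N hN
    refine le_trans ?_ (measureReal_union_le _ _)
    refine ENNReal.toReal_mono (measure_ne_top _ _) (measure_mono_ae ?_)
    filter_upwards [hkey N hN] with ω hω h
    by_cases hz : ω ∈ Z N
    · exact .inr hz
    · exact .inl ⟨h.1, (hω h.1 hz).2 h.2⟩
  have hle2 : ∀ N : ℕ, 0 < N → P.real (A ∩ S N) ≤ P.real (A ∩ C) + P.real (Z N) := by
    intro N hN
    refine le_trans ?_ (measureReal_union_le _ _)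
    refine ENNReal.toReal_mono (measure_ne_top _ _) (measure_mono_ae ?_)
    filter_upwards [hkey N hN] with ω hω h
    by_cases hz : ω ∈ Z N
    · exact .inr hz
    · exact .inl ⟨h.1, (hω h.1 hz).1 h.2⟩
  refine le_antisymm ?_ ?_
  · have h1 := hS.add hZ
    rw [add_zero] at h1
    refine ge_of_tendsto h1 ?_
    filter_upwards [eventually_gt_atTop 0] with N hN using hle1 N hN
  · have h1 := (tendsto_const_nhds (x := P.real (A ∩ C))).add hZ
    rw [add_zero] at h1
    refine le_of_tendsto_of_tendsto hS h1 ?_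
    filter_upwards [eventually_gt_atTop 0] with N hN using hle2 N hN

theorem IsPoissonConstruction.hasTransitions {Γ : ℝ≥0 → Ω → CInf}
    (hΓ : IsPoissonConstruction Γ M P) : HasTransitions Γ P μ where
  measurable := hΓ.measurable
  zero := by
    filter_upwards [hΓ.path] with ω hω
    exact CInf.eq_oneInf_of_toFin fun n => (hω n).zero
  trans n t r B hB γ γ' := by
    rcases eq_or_ne r 0 with rfl | hr
    · rw [NNReal.coe_zero, chain_zero, Matrix.one_apply, add_zero]
      by_cases h : γ = γ'
      · subst h
        rw [Set.inter_assoc, Set.inter_self]; simp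
      · rw [if_neg h, mul_zero]
        have : (B ∩ {ω | (Γ t ω).toFin n = γ} ∩ {ω | (Γ t ω).toFin n = γ'} : Set Ω) = ∅ := by
          ext ω
          simp only [Set.mem_inter_iff, Set.mem_ofPred_eq, Set.mem_empty_iff_false, iff_false]
          rintro ⟨⟨-, h1⟩, h2⟩
          exact h (h1.symm.trans h2)
        rw [this, measureReal_empty]
    · exact real_inter_path hμ hM hΓ t (pos_of_ne_zero hr) hB γ γ'

end Trans


/-! ### Processes with the transition matrices of a measure -/

/-- The law of `FRAG(γ, ·)` is a row of the fragmentation kernel. -/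
theorem fragLaw_real {S : Finset ℕ+} (p : Measure (Comp S)) [IsProbabilityMeasure p]
    (γ γ' : Comp S) : (fragLaw p γ).real {γ'} = Fr (fun x => p.real {x}) γ γ' := by
  classical
  rw [fragLaw, measureReal_def, Measure.map_apply .of_discrete (measurableSet_singleton _),
    ← measureReal_def]
  have h : (γ.frag ⁻¹' {γ'} : Set (S → Comp S)) =
      ↑(Finset.univ.filter fun δ : S → Comp S => γ.frag δ = γ') := by
    ext δ; simp
  rw [h, ← sum_measureReal_singleton, Fr, expW, Finset.sum_filter]
  refine Finset.sum_congr rfl fun δ _ => ?_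
  rw [measureReal_def, Measure.pi_singleton, ENNReal.toReal_prod]
  split_ifs <;> simp [measureReal_def]

section

variable {Ω : Type u} {m F mΩ : MeasurableSpace Ω} {P : Measure Ω} [IsProbabilityMeasure P]
  {Γ : ℝ≥0 → Ω → CInf} {μ : Measure CInf} {n : ℕ+}

theorem sum_real_fiber {X : Type*} [Fintype X] [MeasurableSpace X] [DiscreteMeasurableSpace X]
    {f : Ω → X} (hf : Measurable f) {B : Set Ω} (hB : MeasurableSet B) :
    ∑ x, P.real (B ∩ {ω | f ω = x}) = P.real B := by
  have e : B = ⋃ x ∈ (Finset.univ : Finset X), B ∩ {ω | f ω = x} := by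
    ext ω; simp
  conv_rhs => rw [e]
  rw [measureReal_biUnion_finset]
  · intro x _ y _ hxy
    exact Set.disjoint_left.2 fun ω hω hω' => hxy (hω.2.symm.trans hω'.2)
  · exact fun x _ => hB.inter (hf (measurableSet_singleton x))

theorem procPast_le {E : Type*} [MeasurableSpace E] {X : ℝ≥0 → Ω → E}
    (hX : ∀ t, Measurable (X t)) (t : ℝ≥0) : procPast X t ≤ mΩ :=
  iSup_le fun r => (hX r).comap_le

theorem comap_le_procPast {E : Type*} [MeasurableSpace E] (X : ℝ≥0 → Ω → E) (t : ℝ≥0) :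
    MeasurableSpace.comap (X t) inferInstance ≤ procPast X t :=
  le_iSup (fun r : Set.Iic t => MeasurableSpace.comap (X r) inferInstance) ⟨t, Set.mem_Iic.2 le_rfl⟩

theorem procPast_toFin_le (Γ : ℝ≥0 → Ω → CInf) (n : ℕ+) (t : ℝ≥0) :
    procPast (fun t ω => (Γ t ω).toFin n) t ≤ procPast Γ t := by
  refine iSup_mono fun r => ?_
  have : (fun ω => (Γ r ω).toFin n) = (fun γ : CInf => γ.toFin n) ∘ Γ r := rfl
  change MeasurableSpace.comap (fun ω => (Γ r ω).toFin n) inferInstance ≤ _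
  rw [this, ← MeasurableSpace.comap_comp]
  exact MeasurableSpace.comap_mono (CInf.measurable_toFin n).comap_le

theorem perm_eq_oneFin {σ : Equiv.Perm (seg n)} {x : CFin n} :
    x.perm σ = oneFin n ↔ x = oneFin n := by
  constructor
  · intro h
    have := congrArg (Comp.perm σ⁻¹) h
    rw [← Comp.perm_mul, inv_mul_cancel, Comp.perm_one] at this
    rw [this]
    exact Comp.perm_one_comp _ _
  · rintro rfl
    exact Comp.perm_one_comp _ _

theorem rates_perm (hμ : IsExchangeable μ) (σ : Equiv.Perm (seg n)) (x : CFin n) :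
    rates μ n (x.perm σ) = rates μ n x := by
  have h1 : x.perm σ = oneFin n ↔ x = oneFin n := perm_eq_oneFin
  by_cases hx : x = oneFin n
  · rw [h1.2 hx, hx]
  · rw [rates_of_ne μ hx, rates_of_ne μ fun h => hx (h1.1 h), measureReal_def, measureReal_def,
      hμ n σ (x.perm σ)]
    congr 2
    ext δ
    exact (Comp.permEquiv σ).injective.eq_iff

/-! ### From transition matrices to c-fragmentations and their measures. -/

namespace HasTransitions

theorem measurable_toFin {P : Measure Ω} (h : HasTransitions Γ P μ) (n : ℕ+) (t : ℝ≥0) : Measurable fun ω => (Γ t ω).toFin n :=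
  (CInf.measurable_toFin n).comp (h.measurable t)

theorem measurableSet_eq {P : Measure Ω} (h : HasTransitions Γ P μ) (t : ℝ≥0) (γ : CFin n) : MeasurableSet {ω | (Γ t ω).toFin n = γ} :=
  h.measurable_toFin n t (measurableSet_singleton γ)

theorem trans_univ {P : Measure Ω} (h : HasTransitions Γ P μ) (n : ℕ+) (t r : ℝ≥0) (γ γ' : CFin n) :
    P.real ({ω | (Γ t ω).toFin n = γ} ∩ {ω | (Γ (t + r) ω).toFin n = γ'}) =
      P.real {ω | (Γ t ω).toFin n = γ} * chain (seg_nonempty n) (rates μ n) r γ γ' := by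
  simpa using h.trans n t r Set.univ MeasurableSet.univ γ γ'

variable (h : HasTransitions Γ P μ)
include h

/-- The conditional probability given the past is a function of `Γ_[n](s)`, namely a sum over `D` of
entries of `chain`. Leaving `F` and `m` general makes it serve for `Γ` and for each of its
restrictions. -/
theorem exists_transition {s t : ℝ≥0} (hst : s ≤ t)
    (hF : F ≤ procPast Γ s) (hΓm : Measurable[m] fun ω => (Γ s ω).toFin n) (D : Set (CFin n)) :
    ∃ g : Ω → ℝ, StronglyMeasurable[m] g ∧ Integrable g P ∧ ∀ B, MeasurableSet[F] B →
      ∫ ω in B, g ω ∂P = P.real (B ∩ {ω | (Γ t ω).toFin n ∈ D}) := by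
  classical
  let φ : CFin n → ℝ := fun γ => ∑ γ', if γ' ∈ D then
    chain (seg_nonempty n) (rates μ n) ((t - s : ℝ≥0) : ℝ) γ γ' else 0
  have hgm : Measurable[m] fun ω => φ ((Γ s ω).toFin n) :=
    (Measurable.of_discrete (f := φ)).comp hΓm
  have hgi : ∀ ω, φ ((Γ s ω).toFin n) =
      ∑ γ, {ω | (Γ s ω).toFin n = γ}.indicator (fun _ => φ γ) ω := by
    intro ω
    rw [Finset.sum_eq_single ((Γ s ω).toFin n)]
    · simp
    · intro γ _ hne
      rw [Set.indicator_of_notMem]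
      exact fun h' => hne h'.symm
    · simp
  have hint : ∀ γ, Integrable ({ω | (Γ s ω).toFin n = γ}.indicator (fun _ => φ γ)) P :=
    fun γ => (integrable_const _).indicator (h.measurableSet_eq s γ)
  refine ⟨fun ω => φ ((Γ s ω).toFin n), hgm.stronglyMeasurable, ?_, fun B hB => ?_⟩
  · simp only [hgi]
    exact integrable_finsetSum _ fun γ _ => hint γ
  · have hB1 : MeasurableSet[procPast Γ s] B := hF _ hB
    have hB2 : MeasurableSet B := procPast_le h.measurable s _ hB1
    simp only [hgi]
    rw [integral_finsetSum _ fun γ _ => (hint γ).integrableOn]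
    have hD : MeasurableSet {ω | (Γ t ω).toFin n ∈ D} :=
      h.measurable_toFin n t (MeasurableSet.of_discrete (s := D))
    rw [← sum_real_fiber (h.measurable_toFin n s) (hB2.inter hD)]
    refine Finset.sum_congr rfl fun γ _ => ?_
    rw [setIntegral_indicator (h.measurableSet_eq s γ), setIntegral_const, smul_eq_mul,
      Finset.mul_sum]
    have hBγ : MeasurableSet ((B ∩ {ω | (Γ t ω).toFin n ∈ D}) ∩ {ω | (Γ s ω).toFin n = γ}) :=
      (hB2.inter hD).inter (h.measurableSet_eq s γ)
    rw [← sum_real_fiber (h.measurable_toFin n t) hBγ]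
    refine Finset.sum_congr rfl fun γ' _ => ?_
    split_ifs with hγ'
    · rw [← h.trans n s (t - s) B hB1 γ γ', add_tsub_cancel_of_le hst]
      congr 1
      ext ω
      simp only [Set.mem_inter_iff, Set.mem_ofPred_eq]
      constructor
      · rintro ⟨⟨h1, h2⟩, h3⟩
        exact ⟨⟨⟨h1, by rwa [h3]⟩, h2⟩, h3⟩
      · rintro ⟨⟨⟨h1, -⟩, h2⟩, h3⟩
        exact ⟨⟨h1, h2⟩, h3⟩
    · rw [mul_zero]
      have : B ∩ {ω | (Γ t ω).toFin n ∈ D} ∩ {ω | (Γ s ω).toFin n = γ} ∩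
          {ω | (Γ t ω).toFin n = γ'} = ∅ := by
        ext ω
        simp only [Set.mem_inter_iff, Set.mem_ofPred_eq, Set.mem_empty_iff_false, iff_false]
        rintro ⟨⟨⟨-, h1⟩, -⟩, h2⟩
        exact hγ' (h2 ▸ h1)
      rw [this, measureReal_empty]

theorem isMarkov : IsMarkovProcess Γ P := by
  intro s t hst A hA
  refine condExp_eq_of_piSystem (comap_le_procPast Γ s) (procPast_le h.measurable s)
    (h.measurable t) generateFrom_cylinders isPiSystem_cylinders ?_ hA
  rintro _ ⟨n, D, rfl⟩
  exact h.exists_transition hst le_rfl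
    ((CInf.measurable_toFin n).comp (comap_measurable _)) D

theorem isMarkov_toFin (n : ℕ+) : IsMarkovProcess (fun t ω => (Γ t ω).toFin n) P := by
  intro s t hst A hA
  refine condExp_eq_of_piSystem (C := {A | MeasurableSet A})
    (comap_le_procPast (fun t ω => (Γ t ω).toFin n) s)
    (procPast_le (X := fun t ω => (Γ t ω).toFin n) (fun t => h.measurable_toFin n t) s)
    (h.measurable_toFin n t) MeasurableSpace.generateFrom_measurableSet.symm
    MeasurableSpace.isPiSystem_measurableSet ?_ hA
  intro D _
  exact h.exists_transition hst (procPast_toFin_le Γ n s)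
    (comap_measurable (fun ω => (Γ s ω).toFin n)) D

theorem real_eq (n : ℕ+) (r : ℝ≥0) (γ : CFin n) :
    P.real {ω | (Γ r ω).toFin n = γ} = chain (seg_nonempty n) (rates μ n) r (oneFin n) γ := by
  have h0 : ∀ᵐ ω ∂P, (Γ 0 ω).toFin n = oneFin n := by
    filter_upwards [h.zero] with ω hω
    rw [hω]; rfl
  have h1 := h.trans_univ n 0 r (oneFin n) γ
  have e1 : P.real {ω | (Γ 0 ω).toFin n = oneFin n} = 1 := by
    have : ({ω | (Γ 0 ω).toFin n = oneFin n} : Set Ω) =ᵐ[P] Set.univ :=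
      h0.mono fun ω hω => propext ⟨fun _ => trivial, fun _ => hω⟩
    rw [measureReal_congr this]; simp
  have e2 : P.real ({ω | (Γ 0 ω).toFin n = oneFin n} ∩ {ω | (Γ (0 + r) ω).toFin n = γ}) =
      P.real {ω | (Γ r ω).toFin n = γ} := by
    rw [zero_add]
    refine measureReal_congr (h0.mono fun ω hω => propext ⟨fun h => h.2, fun h => ⟨hω, h⟩⟩)
  rw [e1, e2, one_mul] at h1
  exact h1

/-- Split according to the value at time `s`; each term is a probability at most 1 times the chance
of having moved. As `chain` is continuous with value 1 at time 0, continuity in probability follows.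
-/
theorem real_ne_le {s t : ℝ≥0} (hst : s ≤ t) :
    P.real {ω | (Γ s ω).toFin n ≠ (Γ t ω).toFin n} ≤
      ∑ γ : CFin n, |1 - chain (seg_nonempty n) (rates μ n) ((t - s : ℝ≥0) : ℝ) γ γ| := by
  have hm : MeasurableSet {ω | (Γ s ω).toFin n ≠ (Γ t ω).toFin n} :=
    (measurableSet_eq_fun (h.measurable_toFin n s) (h.measurable_toFin n t)).compl
  rw [← sum_real_fiber (h.measurable_toFin n s) hm]
  refine Finset.sum_le_sum fun γ _ => ?_
  have e : {ω | (Γ s ω).toFin n ≠ (Γ t ω).toFin n} ∩ {ω | (Γ s ω).toFin n = γ} =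
      {ω | (Γ s ω).toFin n = γ} \
        ({ω | (Γ s ω).toFin n = γ} ∩ {ω | (Γ (s + (t - s)) ω).toFin n = γ}) := by
    rw [add_tsub_cancel_of_le hst]
    ext ω
    simp only [Set.mem_inter_iff, Set.mem_ofPred_eq, Set.mem_sdiff]
    constructor
    · rintro ⟨h1, h2⟩
      exact ⟨h2, fun h3 => h1 (h2.trans h3.2.symm)⟩
    · rintro ⟨h1, h2⟩
      exact ⟨fun h3 => h2 ⟨h1, h3.symm.trans h1⟩, h1⟩
  rw [e, measureReal_sdiff Set.inter_subset_left
    ((h.measurableSet_eq s γ).inter (h.measurableSet_eq _ γ)), h.trans_univ]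
  have h1 : P.real {ω | (Γ s ω).toFin n = γ} ≤ 1 := measureReal_le_one
  have h2 : (0 : ℝ) ≤ P.real {ω | (Γ s ω).toFin n = γ} := measureReal_nonneg
  calc _ = P.real {ω | (Γ s ω).toFin n = γ} *
        (1 - chain (seg_nonempty n) (rates μ n) ((t - s : ℝ≥0) : ℝ) γ γ) := by ring
    _ ≤ P.real {ω | (Γ s ω).toFin n = γ} *
        |1 - chain (seg_nonempty n) (rates μ n) ((t - s : ℝ≥0) : ℝ) γ γ| := by
      gcongr; exact le_abs_self _
    _ ≤ _ := mul_le_of_le_one_left (abs_nonneg _) h1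

theorem continuous_in_prob (n : ℕ+) (t : ℝ≥0) :
    Tendsto (fun s => P {ω | (Γ s ω).toFin n ≠ (Γ t ω).toFin n}) (𝓝 t) (𝓝 0) := by
  let ψ : ℝ → ℝ := fun x => ∑ γ : CFin n, |1 - chain (seg_nonempty n) (rates μ n) x γ γ|
  have hψ : Continuous ψ := by
    refine continuous_finsetSum _ fun γ _ => (continuous_const.sub ?_).abs
    exact (continuous_apply γ).comp ((continuous_apply γ).comp (continuous_chain _ _))
  have hψ0 : ψ 0 = 0 := by simp [ψ, chain_zero]
  have hb : ∀ s, P.real {ω | (Γ s ω).toFin n ≠ (Γ t ω).toFin n} ≤ ψ |(t : ℝ) - s| := by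
    intro s
    rcases le_total s t with hst | hst
    · have := h.real_ne_le (n := n) hst
      rwa [NNReal.coe_sub hst, ← abs_of_nonneg (sub_nonneg.2 (NNReal.coe_le_coe.2 hst))] at this
    · have := h.real_ne_le (n := n) hst
      rw [NNReal.coe_sub hst, ← abs_of_nonneg (sub_nonneg.2 (NNReal.coe_le_coe.2 hst)),
        abs_sub_comm] at this
      refine le_trans (le_of_eq ?_) this
      simp only [ne_comm]
  have hlim : Tendsto (fun s : ℝ≥0 => ψ |(t : ℝ) - s|) (𝓝 t) (𝓝 0) := by
    have hc : Continuous fun s : ℝ≥0 => ψ |(t : ℝ) - s| := by fun_prop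
    have := hc.tendsto t
    simpa [hψ0] using this
  have h1 := squeeze_zero (fun s => measureReal_nonneg) hb hlim
  have h2 := ENNReal.tendsto_ofReal h1
  simpa [ofReal_measureReal] using h2

/-- The law `p_r` is that of `Γ_[n](r)`, the first row of `chain`. It is exchangeable by
`chain_perm`, and the conditional laws have the FRAG form by `chain_eq_Fr`. -/
theorem isFragProcessFin (hμ : IsExchangeable μ) (n : ℕ+) :
    IsFragProcessFin (fun t ω => (Γ t ω).toFin n) P where
  measurable := h.measurable_toFin n
  markov := h.isMarkov_toFin n
  continuous_in_prob := h.continuous_in_prob n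
  zero := by
    filter_upwards [h.zero] with ω hω
    rw [hω]; rfl
  semigroup := by
    have hp : ∀ r, IsProbabilityMeasure (P.map fun ω => (Γ r ω).toFin n) := fun r =>
      Measure.isProbabilityMeasure_map (h.measurable_toFin n r).aemeasurable
    have hpr : ∀ r x, (P.map fun ω => (Γ r ω).toFin n).real {x} =
        chain (seg_nonempty n) (rates μ n) r (oneFin n) x := fun r x => by
      rw [← h.real_eq n r x, measureReal_def, Measure.map_apply (h.measurable_toFin n r)
        (measurableSet_singleton x)]
      rfl
    refine ⟨fun r => ⟨P.map fun ω => (Γ r ω).toFin n, hp r⟩, fun r hr σ γ => ?_,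
      fun t r γ hr hγ => ?_⟩
    all_goals simp only [ProbabilityMeasure.coe_mk]
    · have e : {δ : CFin n | δ.perm σ = γ} = {γ.perm σ⁻¹} := by
        ext δ
        simp only [Set.mem_ofPred_eq, Set.mem_singleton_iff]
        constructor
        · rintro rfl
          rw [← Comp.perm_mul, inv_mul_cancel, Comp.perm_one]
        · rintro rfl
          rw [← Comp.perm_mul, mul_inv_cancel, Comp.perm_one]
      have e' : {δ : CFin n | δ = γ} = {γ} := rfl
      rw [e, e', ← ENNReal.toReal_eq_toReal_iff' (measure_ne_top _ _) (measure_ne_top _ _)]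
      change (P.map fun ω => (Γ r ω).toFin n).real {γ} =
        (P.map fun ω => (Γ r ω).toFin n).real {γ.perm σ⁻¹}
      rw [hpr, hpr]
      exact (chain_perm _ _ (sum_rates μ n) (by exact_mod_cast hr) σ⁻¹
        (fun x => rates_perm hμ _ x) γ).symm
    · have hm := h.measurable_toFin n
      have : IsProbabilityMeasure (P[|{ω | (Γ t ω).toFin n = γ}]) :=
        cond_isProbabilityMeasure hγ
      have : IsProbabilityMeasure
          ((P[|{ω | (Γ t ω).toFin n = γ}]).map fun ω => (Γ (t + r) ω).toFin n) :=
        Measure.isProbabilityMeasure_map (hm _).aemeasurable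
      have : IsProbabilityMeasure (fragLaw (P.map fun ω => (Γ r ω).toFin n) γ) :=
        Measure.isProbabilityMeasure_map Measurable.of_discrete.aemeasurable
      refine Measure.ext_of_singleton fun γ' => ?_
      rw [← ENNReal.toReal_eq_toReal_iff' (measure_ne_top _ _) (measure_ne_top _ _)]
      have e1 : (fragLaw (P.map fun ω => (Γ r ω).toFin n) γ {γ'}).toReal =
          chain (seg_nonempty n) (rates μ n) r γ γ' := by
        have h1 := fragLaw_real (P.map fun ω => (Γ r ω).toFin n) γ γ'
        rw [measureReal_def] at h1
        rw [h1, chain_eq_Fr _ _ (sum_rates μ n) (by exact_mod_cast hr)]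
        simp only [hpr]
        rfl
      refine Eq.trans ?_ e1.symm
      rw [Measure.map_apply (hm _) (measurableSet_singleton γ'),
        cond_apply (h.measurableSet_eq t γ), ENNReal.toReal_mul, ENNReal.toReal_inv]
      have h2 := h.trans_univ n t r γ γ'
      rw [measureReal_def, measureReal_def] at h2
      have h3 : (P {ω | (Γ t ω).toFin n = γ}).toReal ≠ 0 :=
        ENNReal.toReal_ne_zero.2 ⟨hγ, measure_ne_top _ _⟩
      refine (congrArg (fun x => (P {ω | (Γ t ω).toFin n = γ}).toReal⁻¹ * x) h2).trans ?_
      rw [← mul_assoc, inv_mul_cancel₀ h3, one_mul]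

theorem isCFragmentation (hμ : IsExchangeable μ) : IsCFragmentation Γ P where
  measurable := h.measurable
  markov := h.isMarkov
  restrict := h.isFragProcessFin hμ

/-- The law of `Γ_[n](s)` is the row of `chain` at the one-block composition, whose derivative at 0
is given by the generator. -/
theorem hasFragMeasure (hμ : IsFragMeasure μ) : HasFragMeasure Γ P μ where
  exchangeable := hμ.exchangeable
  one_eq_zero := hμ.one_eq_zero
  rate n γ hγ := by
    have h1 := hasDerivWithinAt_chain (seg_nonempty n) (rates μ n) (oneFin n) γ
    rw [hasDerivWithinAt_iff_tendsto_slope' (by simp)] at h1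
    have h2 : genM (seg_nonempty n) (rates μ n) (oneFin n) γ = μ.real {δ | δ.toFin n = γ} := by
      rw [← rates_of_ne μ hγ]
      exact genM_one_left _ _ hγ
    rw [h2] at h1
    have hc : Tendsto (fun s : ℝ≥0 => (s : ℝ)) (𝓝[>] 0) (𝓝[>] 0) := by
      refine tendsto_nhdsWithin_iff.2 ⟨?_, ?_⟩
      · exact (NNReal.continuous_coe.tendsto 0).mono_left nhdsWithin_le_nhds
      · filter_upwards [self_mem_nhdsWithin] with s hs
        exact NNReal.coe_pos.2 hs
    have h3 := ENNReal.tendsto_ofReal (h1.comp hc)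
    rw [ofReal_measureReal (hμ.lt_top_of_ne hγ).ne] at h3
    refine h3.congr' ?_
    filter_upwards [self_mem_nhdsWithin] with s hs
    have hs' : (0 : ℝ) < s := NNReal.coe_pos.2 hs
    simp only [Function.comp]
    rw [slope_def_field, chain_zero, Matrix.one_apply_ne (Ne.symm hγ), ← h.real_eq, sub_zero,
      sub_zero, ENNReal.ofReal_div_of_pos hs', ofReal_measureReal, ENNReal.ofReal_coe_nnreal]

end HasTransitions

end


/-! ### The transition matrices of an exchangeable fragmentation process -/

/-- `X` is a Markov chain on `𝒞_n` that starts from `𝟏_n`, with the transition matrices associated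
with the rates `q`. -/
structure IsChain {Ω : Type u} [MeasurableSpace Ω] {n : ℕ+} (X : ℝ≥0 → Ω → CFin n)
    (P : Measure Ω) (q : CFin n → ℝ) : Prop where
  zero : ∀ᵐ ω ∂P, X 0 ω = oneFin n
  trans : ∀ (t r : ℝ≥0) (B : Set Ω), MeasurableSet[procPast X t] B → ∀ γ γ' : CFin n,
    P.real (B ∩ {ω | X t ω = γ} ∩ {ω | X (t + r) ω = γ'}) =
      P.real (B ∩ {ω | X t ω = γ}) * chain (seg_nonempty n) q r γ γ'

section

variable {Ω : Type u} {mΩ : MeasurableSpace Ω} {P : Measure Ω} [IsProbabilityMeasure P] {n : ℕ+}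
  {X : ℝ≥0 → Ω → CFin n}

/-- In the elementary transition probabilities of a Markov process, one can condition on the whole
past. -/
theorem IsMarkovProcess.real_inter {E : Type*} [MeasurableSpace E] [MeasurableSingletonClass E]
    {X : ℝ≥0 → Ω → E} (hX : ∀ t, Measurable (X t)) (hmk : IsMarkovProcess X P) {s t : ℝ≥0}
    (hst : s ≤ t) {x y : E} {c : ℝ}
    (hc : P.real ({ω | X s ω = x} ∩ {ω | X t ω = y}) = P.real {ω | X s ω = x} * c) {B : Set Ω}
    (hB : MeasurableSet[procPast X s] B) :
    P.real (B ∩ {ω | X s ω = x} ∩ {ω | X t ω = y}) = P.real (B ∩ {ω | X s ω = x}) * c := by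
  have hxm : ∀ t (x : E), MeasurableSet {ω | X t ω = x} := fun t x =>
    hX t (measurableSet_singleton x)
  have hms : MeasurableSpace.comap (X s) inferInstance ≤ mΩ := (hX s).comap_le
  have hxs : MeasurableSet[MeasurableSpace.comap (X s) inferInstance] {ω | X s ω = x} :=
    ⟨{x}, measurableSet_singleton x, rfl⟩
  have h1 := hmk s t hst {y} (measurableSet_singleton y)
  set g := P[(X t ⁻¹' {y}).indicator (fun _ => (1 : ℝ)) |
    MeasurableSpace.comap (X s) inferInstance] with hg
  -- The conditional expectation is a function of `X s`, hence constant on the event `X s = x`.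
  obtain ⟨φ, -, hφ⟩ := (stronglyMeasurable_condExp (m := MeasurableSpace.comap (X s) inferInstance)
    (μ := P) (f := (X t ⁻¹' {y}).indicator (fun _ => (1 : ℝ)))).exists_eq_measurable_comp
  have hφ' : ∀ ω, g ω = φ (X s ω) := fun ω => congrFun hφ ω
  have hint : Integrable ((X t ⁻¹' {y}).indicator (fun _ => (1 : ℝ))) P :=
    integrable_indicator_one (hxm t y)
  have key : ∀ B : Set Ω, MeasurableSet[procPast X s] B →
      P.real (B ∩ {ω | X s ω = x} ∩ {ω | X t ω = y}) = P.real (B ∩ {ω | X s ω = x}) * φ x := by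
    intro B hB
    have hB0 : MeasurableSet[procPast X s] (B ∩ {ω | X s ω = x}) :=
      @MeasurableSet.inter _ (procPast X s) _ _ hB (comap_le_procPast X s _ hxs)
    have hB1 : MeasurableSet (B ∩ {ω | X s ω = x}) := procPast_le hX s _ hB0
    have h2 := setIntegral_condExp (procPast_le hX s) hint hB0
    rw [setIntegral_indicator (hX t (measurableSet_singleton y)), setIntegral_const, smul_eq_mul, mul_one,
      setIntegral_congr_ae hB1 (h1.mono fun ω hω _ => hω)] at h2
    rw [← setIntegral_congr_fun (f := fun _ => φ x) hB1 fun ω hω => by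
      rw [hφ', show X s ω = x from hω.2], setIntegral_const, smul_eq_mul] at h2
    exact h2.symm
  rw [key B hB]
  -- Taking the whole space as past event identifies `φ x` with `c`, unless `X s = x` has
  -- probability 0, in which case both sides vanish.
  have hu := key Set.univ MeasurableSet.univ
  rw [Set.univ_inter, hc] at hu
  by_cases h0 : P.real {ω | X s ω = x} = 0
  · have : P.real (B ∩ {ω | X s ω = x}) = 0 :=
      le_antisymm ((measureReal_mono Set.inter_subset_right).trans h0.le) measureReal_nonneg
    rw [this, zero_mul, zero_mul]
  · rw [mul_left_cancel₀ h0 hu]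

theorem sum_real_eq_one (hX : ∀ t, Measurable (X t)) (t : ℝ≥0) :
    ∑ x, P.real {ω | X t ω = x} = 1 := by
  have := sum_real_fiber (P := P) (hX t) MeasurableSet.univ
  simpa using this

/-- Starting from one block forces `p_r` to be the law of `X r`. The Chapman–Kolmogorov equation and
continuity in probability then make the kernels `Fr p_r` a continuous semigroup, to which
`exists_rates` applies; the Markov property extends the transitions to the whole past. -/
theorem IsFragProcessFin.exists_isChain (h : IsFragProcessFin X P) :
    ∃ q : CFin n → ℝ, ∑ x, q x = 0 ∧ IsChain X P q ∧
      (∀ x, HasDerivWithinAt (fun t : ℝ => P.real {ω | X t.toNNReal ω = x}) (q x) (Set.Ioi 0) 0) ∧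
      ∀ t, 0 < t → ∀ (σ : Equiv.Perm (seg n)) x,
        P.real {ω | X t ω = x.perm σ} = P.real {ω | X t ω = x} := by
  obtain ⟨p, hpe, hp⟩ := h.semigroup
  have hxm : ∀ t x, MeasurableSet {ω | X t ω = x} := fun t x =>
    h.measurable t (measurableSet_singleton x)
  let w : ℝ≥0 → CFin n → ℝ := fun t x => P.real {ω | X t ω = x}
  have hw1 : ∀ t, ∑ x, w t x = 1 := fun t => sum_real_eq_one h.measurable t
  have hp1 : ∀ r, ∑ x, (p r : Measure (CFin n)).real {x} = 1 := fun r => by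
    rw [sum_measureReal_singleton]; simp
  have hw0 : w 0 = fun x => if x = oneFin n then (1 : ℝ) else 0 := by
    funext x
    simp only [w]
    split_ifs with hx
    · have : ({ω | X 0 ω = x} : Set Ω) =ᵐ[P] Set.univ :=
        h.zero.mono fun ω hω => propext ⟨fun _ => trivial, fun _ => hω.trans hx.symm⟩
      rw [measureReal_congr this]; simp
    · have : ({ω | X 0 ω = x} : Set Ω) =ᵐ[P] (∅ : Set Ω) :=
        h.zero.mono fun ω hω => propext ⟨fun h' => hx (h'.symm.trans hω), fun h' => h'.elim⟩
      rw [measureReal_congr this, measureReal_empty]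
  have htr0 : ∀ (t r : ℝ≥0), 0 < r → ∀ γ γ', P.real ({ω | X t ω = γ} ∩ {ω | X (t + r) ω = γ'}) =
      w t γ * Fr (fun x => (p r : Measure (CFin n)).real {x}) γ γ' := by
    intro t r hr γ γ'
    by_cases h0 : P {ω | X t ω = γ} = 0
    · have h1 : P ({ω | X t ω = γ} ∩ {ω | X (t + r) ω = γ'}) = 0 :=
        measure_mono_null Set.inter_subset_left h0
      simp [w, measureReal_def, h0, h1]
    · have h1 := congrArg (fun ν : Measure (CFin n) => ν.real {γ'}) (hp t r γ hr h0)
      simp only [fragLaw_real] at h1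
      rw [← h1, measureReal_def, measureReal_def, Measure.map_apply (h.measurable _)
        (measurableSet_singleton γ'), cond_apply (hxm t γ), ENNReal.toReal_mul, ENNReal.toReal_inv]
      have h3 : (P {ω | X t ω = γ}).toReal ≠ 0 := ENNReal.toReal_ne_zero.2 ⟨h0, measure_ne_top _ _⟩
      simp only [w, measureReal_def]
      rw [← mul_assoc, mul_inv_cancel₀ h3, one_mul]
      rfl
  have hpw : ∀ r, 0 < r → (fun x => (p r : Measure (CFin n)).real {x}) = w r := by
    intro r hr
    funext x
    have h1 := htr0 0 r hr (oneFin n) x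
    have h2 : P.real ({ω | X 0 ω = oneFin n} ∩ {ω | X (0 + r) ω = x}) = w r x := by
      rw [zero_add]
      exact measureReal_congr (h.zero.mono fun ω hω => propext ⟨fun h => h.2, fun h => ⟨hω, h⟩⟩)
    have e0 : w 0 (oneFin n) = 1 := by rw [hw0]; exact if_pos rfl
    rw [h2, e0, one_mul] at h1
    rw [h1]
    exact (Fr_one_left (seg_nonempty n) _ (hp1 r) x).symm
  have htr : ∀ (t r : ℝ≥0), 0 < r → ∀ γ γ', P.real ({ω | X t ω = γ} ∩ {ω | X (t + r) ω = γ'}) =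
      w t γ * Fr (w r) γ γ' := fun t r hr γ γ' => by rw [htr0 t r hr, hpw r hr]
  have hmul : ∀ s t : ℝ≥0, ∀ x, w (s + t) x = ∑ y, w s y * Fr (w t) y x := by
    intro s t x
    rcases eq_or_ne t 0 with rfl | ht
    · have : Fr (w 0) = 1 := by rw [hw0]; exact Fr_single (seg_nonempty n)
      rw [this, add_zero]
      simp [Matrix.one_apply]
    · have h1 := sum_real_fiber (P := P) (h.measurable s) (hxm (s + t) x)
      rw [← show P.real {ω | X (s + t) ω = x} = w (s + t) x from rfl, ← h1]
      refine Finset.sum_congr rfl fun y _ => ?_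
      rw [Set.inter_comm, htr s t (pos_of_ne_zero ht)]
  have hcont : ∀ x, Continuous fun t => w t x := by
    intro x
    refine continuous_iff_continuousAt.2 fun t => ?_
    have h1 : Tendsto (fun s => P.real {ω | X s ω ≠ X t ω}) (𝓝 t) (𝓝 0) := by
      have := (ENNReal.tendsto_toReal ENNReal.zero_ne_top).comp (h.continuous_in_prob t)
      rw [ENNReal.toReal_zero] at this
      exact this
    refine tendsto_iff_dist_tendsto_zero.2 (squeeze_zero (fun _ => dist_nonneg) (fun s => ?_) h1)
    rw [Real.dist_eq, abs_sub_le_iff]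
    have hsub : ∀ s t, w s x - w t x ≤ P.real {ω | X s ω ≠ X t ω} := by
      intro s t
      rw [sub_le_iff_le_add']
      refine le_trans (measureReal_mono fun ω hω => ?_) (measureReal_union_le _ _)
      by_cases hst : X s ω = X t ω
      · exact .inl (hst.symm.trans hω)
      · exact .inr hst
    refine ⟨hsub s t, ?_⟩
    have := hsub t s
    simpa only [ne_comm] using this
  -- The weights are extended to negative times by their value at 0, which keeps them continuous on
  -- `ℝ`.
  obtain ⟨q, hq, hq'⟩ := exists_rates (seg_nonempty n) (p := fun t x => w t.toNNReal x)
    (fun t => hw1 _) (by simp only [Real.toNNReal_zero]; exact hw0) (fun x => (hcont x).comp continuous_real_toNNReal)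
    fun s t hs ht x => by
      simp only [Real.toNNReal_add hs ht]
      exact hmul _ _ x
  -- The weights sum to 1 at all times, so their derivatives sum to 0.
  have hqs : ∑ x, q x = 0 := by
    have h1 : HasDerivWithinAt (fun t : ℝ => ∑ x, w t.toNNReal x) (∑ x, q x) (Set.Ioi 0) 0 :=
      HasDerivWithinAt.fun_sum fun x _ => hq x
    simp only [hw1] at h1
    have h2 := hasDerivWithinAt_const (0 : ℝ) (Set.Ioi 0) (1 : ℝ)
    exact (uniqueDiffWithinAt_Ioi (0 : ℝ)).eq_deriv _ h1 h2
  refine ⟨q, hqs, ⟨h.zero, fun t r B hB γ γ' => ?_⟩, hq, fun t ht σ x => ?_⟩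
  · rcases eq_or_ne r 0 with rfl | hr
    · rw [NNReal.coe_zero, chain_zero, Matrix.one_apply, add_zero]
      by_cases h : γ = γ'
      · subst h
        rw [Set.inter_assoc, Set.inter_self]; simp
      · rw [if_neg h, mul_zero]
        have : (B ∩ {ω | X t ω = γ} ∩ {ω | X t ω = γ'} : Set Ω) = ∅ := by
          ext ω
          simp only [Set.mem_inter_iff, Set.mem_ofPred_eq, Set.mem_empty_iff_false, iff_false]
          rintro ⟨⟨-, h1⟩, h2⟩
          exact h (h1.symm.trans h2)
        rw [this, measureReal_empty]
    · have hr' : (0 : ℝ) < r := by exact_mod_cast pos_of_ne_zero hr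
      refine h.markov.real_inter h.measurable le_self_add ?_ hB
      rw [htr t r (pos_of_ne_zero hr), ← hq' r hr']
      simp only [Real.toNNReal_coe]
      rfl
  · have h1 : ∀ y, P.real {ω | X t ω = y} = (p t : Measure (CFin n)).real {y} :=
      fun y => (congrFun (hpw t ht) y).symm
    have h2 := hpe t ht σ (x.perm σ)
    have h3 : {δ : CFin n | δ.perm σ = x.perm σ} = {x} := by
      ext δ
      exact (Comp.permEquiv σ).injective.eq_iff
    rw [h1, h1, measureReal_def, measureReal_def, ← h3, ← h2]
    rfl

theorem measurableSet_procPast {Ω : Type*} (X : ℝ≥0 → Ω → CFin n) {s t : ℝ≥0} (hst : s ≤ t) (x : CFin n) :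
    MeasurableSet[procPast X t] {ω | X s ω = x} :=
  le_iSup (fun r : Set.Iic t => MeasurableSpace.comap (X r) inferInstance) ⟨s, hst⟩ _
    ⟨{x}, measurableSet_singleton x, rfl⟩

theorem IsChain.real_eq {q : CFin n → ℝ} (h : IsChain X P q) (t : ℝ≥0) (γ : CFin n) :
    P.real {ω | X t ω = γ} = chain (seg_nonempty n) q t (oneFin n) γ := by
  have h1 := h.trans 0 t Set.univ MeasurableSet.univ (oneFin n) γ
  rw [Set.univ_inter, zero_add] at h1
  have e1 : P.real {ω | X 0 ω = oneFin n} = 1 := by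
    have : ({ω | X 0 ω = oneFin n} : Set Ω) =ᵐ[P] Set.univ :=
      h.zero.mono fun ω hω => propext ⟨fun _ => trivial, fun _ => hω⟩
    rw [measureReal_congr this]; simp
  have e2 : P.real ({ω | X 0 ω = oneFin n} ∩ {ω | X t ω = γ}) = P.real {ω | X t ω = γ} :=
    measureReal_congr (h.zero.mono fun ω hω => propext ⟨fun h => h.2, fun h => ⟨hω, h⟩⟩)
  rw [e1, e2, one_mul] at h1
  exact h1

/-- Apply the transition from the largest time of `s`, the conditions at the times of `s` being an
event of the past. -/
theorem IsChain.real_insert {Ω : Type*} [MeasurableSpace Ω] {P : Measure Ω}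
    {X : ℝ≥0 → Ω → CFin n} {q : CFin n → ℝ} (h : IsChain X P q) (γ : ℝ≥0 → CFin n)
    {s : Finset ℝ≥0} (hne : s.Nonempty) {a : ℝ≥0} (hs : ∀ x ∈ s, x < a) :
    P.real {ω | ∀ t ∈ insert a s, X t ω = γ t} = P.real {ω | ∀ t ∈ s, X t ω = γ t} *
      chain (seg_nonempty n) q ((a - s.max' hne : ℝ≥0) : ℝ) (γ (s.max' hne)) (γ a) := by
  set b := s.max' hne
  have hb : b ∈ s := s.max'_mem hne
  have hB : MeasurableSet[procPast X b] {ω | ∀ t ∈ s, X t ω = γ t} := by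
    have : {ω | ∀ t ∈ s, X t ω = γ t} = ⋂ t ∈ s, {ω | X t ω = γ t} := by ext ω; simp
    rw [this]
    exact @Finset.measurableSet_biInter _ _ (procPast X b) _ s fun t ht =>
      measurableSet_procPast X (s.le_max' t ht) (γ t)
  have h1 := h.trans b (a - b) _ hB (γ b) (γ a)
  rw [add_tsub_cancel_of_le (hs b hb).le] at h1
  have e1 : {ω | ∀ t ∈ s, X t ω = γ t} ∩ {ω | X b ω = γ b} =
      {ω | ∀ t ∈ s, X t ω = γ t} := Set.inter_eq_left.2 fun ω hω => hω b hb
  rw [e1] at h1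
  rw [← h1]
  congr 1
  ext ω
  simp only [Finset.mem_insert, forall_eq_or_imp, Set.mem_ofPred_eq, Set.mem_inter_iff]
  exact and_comm

/-- The rates determine the finite-dimensional distributions. -/
theorem IsChain.fdd_eq {q : CFin n → ℝ} (h : IsChain X P q) {Ω' : Type*} [MeasurableSpace Ω']
    {P' : Measure Ω'} [IsProbabilityMeasure P'] {X' : ℝ≥0 → Ω' → CFin n} (h' : IsChain X' P' q)
    (I : Finset ℝ≥0) (γ : ℝ≥0 → CFin n) :
    P.real {ω | ∀ t ∈ I, X t ω = γ t} = P'.real {ω | ∀ t ∈ I, X' t ω = γ t} := by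
  induction I using Finset.induction_on_max with
  | empty => simp
  | insert a s hs ih =>
    rcases s.eq_empty_or_nonempty with rfl | hne
    · simp only [Finset.mem_insert, Finset.notMem_empty, or_false, forall_eq]
      rw [h.real_eq, h'.real_eq]
    · rw [h.real_insert γ hne hs, h'.real_insert γ hne hs, ih]

end


/-! ### Measures on `𝒞` and their values on cylinders -/

theorem measure_toFin_mem (μ : Measure CInf) {n : ℕ+} (D : Set (CFin n)) :
    μ {γ | γ.toFin n ∈ D} = ∑ x ∈ D.toFinite.toFinset, μ {γ | γ.toFin n = x} := by
  have e : {γ : CInf | γ.toFin n ∈ D} =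
      ⋃ x ∈ D.toFinite.toFinset, {γ : CInf | γ.toFin n = x} := by
    ext γ; simp
  rw [e, measure_biUnion_finset]
  · intro x _ y _ hxy
    exact Set.disjoint_left.2 fun γ h h' => hxy (h.symm.trans h')
  · exact fun x _ => CInf.measurableSet_toFin {x}

theorem measure_toFin_ne_lt_top {μ : Measure CInf} {n : ℕ+}
    (h : ∀ x : CFin n, x ≠ oneFin n → μ {γ | γ.toFin n = x} ≠ ∞) :
    μ {γ | γ.toFin n ≠ oneFin n} < ∞ := by
  have := measure_toFin_mem μ {x : CFin n | x ≠ oneFin n}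
  rw [show {γ : CInf | γ.toFin n ≠ oneFin n} = {γ | γ.toFin n ∈ {x | x ≠ oneFin n}} from rfl, this]
  refine ENNReal.sum_lt_top.2 fun x hx => (h x ?_).lt_top
  simpa using hx

/-- The cylinder sets that do not contain `𝟏_ℕ`, and the singleton `{𝟏_ℕ}`. -/
def awayCylinders : Set (Set CInf) :=
  {A | A = {oneInf} ∨ ∃ (n : ℕ+) (D : Set (CFin n)), oneFin n ∉ D ∧ A = {γ | γ.toFin n ∈ D}}

/-- A fragmentation measure may be infinite on cylinders that contain `𝟏_ℕ`, so only those avoiding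
it can be used to compare measures. They are disjoint from the added singleton. -/
theorem isPiSystem_awayCylinders : IsPiSystem awayCylinders := by
  have hno : ∀ (n : ℕ+) (D : Set (CFin n)), oneFin n ∉ D →
      ¬ (({oneInf} : Set CInf) ∩ {γ | γ.toFin n ∈ D}).Nonempty := by
    rintro n D hD ⟨γ, rfl, h⟩
    exact hD h
  rintro _ (rfl | ⟨n, D, hD, rfl⟩) _ (rfl | ⟨m, D', hD', rfl⟩) hne
  · exact .inl (Set.inter_self _)
  · exact absurd hne (hno m D' hD')
  · rw [Set.inter_comm] at hne
    exact absurd hne (hno n D hD)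
  · refine .inr ⟨max n m, {x | x.restrict (seg_subset (le_max_left n m)) ∈ D ∧
      x.restrict (seg_subset (le_max_right n m)) ∈ D'}, fun h => hD ?_, ?_⟩
    · have := h.1
      rwa [restrict_oneFin (le_max_left n m)] at this
    · ext γ
      have e1 := γ.restrict_toFin (le_max_left n m)
      have e2 := γ.restrict_toFin (le_max_right n m)
      change _ ↔ (γ.toFin (max n m)).restrict _ ∈ D ∧ (γ.toFin (max n m)).restrict _ ∈ D'
      rw [e1, e2]
      rfl

/-- A cylinder that contains `𝟏_ℕ` is the complement of one that does not. -/
theorem generateFrom_awayCylinders :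
    (inferInstance : MeasurableSpace CInf) = MeasurableSpace.generateFrom awayCylinders := by
  refine le_antisymm ?_ ?_
  · rw [generateFrom_cylinders]
    refine MeasurableSpace.generateFrom_le ?_
    rintro _ ⟨n, D, rfl⟩
    have haway : ∀ D : Set (CFin n), oneFin n ∉ D →
        MeasurableSet[MeasurableSpace.generateFrom awayCylinders] {γ : CInf | γ.toFin n ∈ D} :=
      fun D hD => MeasurableSpace.measurableSet_generateFrom (.inr ⟨n, D, hD, rfl⟩)
    by_cases h : oneFin n ∈ D
    · have := @MeasurableSet.compl _ _ (MeasurableSpace.generateFrom awayCylinders)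
        (haway Dᶜ fun hc => hc h)
      have e : {γ : CInf | γ.toFin n ∈ Dᶜ}ᶜ = {γ : CInf | γ.toFin n ∈ D} := by
        ext γ; simp
      rwa [e] at this
    · exact haway D h
  · refine MeasurableSpace.generateFrom_le ?_
    rintro _ (rfl | ⟨n, D, -, rfl⟩)
    · exact measurableSet_singleton _
    · exact CInf.measurableSet_toFin D

/-- A measure on `𝒞` is determined by its values on `{𝟏_ℕ}` and on the cylinder sets that do not
contain it, provided that they are finite. -/
theorem measure_ext_of_toFin {μ μ' : Measure CInf} (h0 : μ {oneInf} = 0) (h0' : μ' {oneInf} = 0)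
    (hfin : ∀ (n : ℕ+) (x : CFin n), x ≠ oneFin n → μ {γ | γ.toFin n = x} ≠ ∞)
    (h : ∀ (n : ℕ+) (x : CFin n), x ≠ oneFin n →
      μ {γ | γ.toFin n = x} = μ' {γ | γ.toFin n = x}) : μ = μ' := by
  -- An exhaustion by sets of finite mass: the singleton first, then the compositions that are
  -- non-trivial at the level `j.succPNat`.
  let B : ℕ → Set CInf := fun k => match k with
    | 0 => {oneInf}
    | j + 1 => {γ | γ.toFin j.succPNat ∈ ({oneFin j.succPNat}ᶜ : Set (CFin j.succPNat))}
  refine Measure.ext_of_generateFrom_of_iUnion awayCylinders B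
    generateFrom_awayCylinders isPiSystem_awayCylinders ?_ ?_ ?_ ?_
  · refine Set.eq_univ_of_forall fun γ => ?_
    by_cases hγ : γ = oneInf
    · exact Set.mem_iUnion.2 ⟨0, hγ⟩
    · have : ∃ n, γ.toFin n ≠ oneFin n := by
        by_contra hc
        push Not at hc
        exact hγ (CInf.eq_oneInf_of_toFin hc)
      obtain ⟨n, hn⟩ := this
      refine Set.mem_iUnion.2 ⟨n.natPred + 1, ?_⟩
      change γ.toFin n.natPred.succPNat ≠ _
      rwa [PNat.succPNat_natPred]
  · rintro (_ | k)
    · exact .inl rfl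
    · exact .inr ⟨_, _, by simp, rfl⟩
  · rintro (_ | k)
    · change μ {oneInf} ≠ ∞
      rw [h0]; exact ENNReal.zero_ne_top
    · exact (measure_toFin_ne_lt_top (hfin _)).ne
  · rintro _ (rfl | ⟨n, D, hD, rfl⟩)
    · rw [h0, h0']
    · rw [measure_toFin_mem, measure_toFin_mem]
      refine Finset.sum_congr rfl fun x hx => h n x ?_
      rintro rfl
      exact hD (by simpa using hx)

theorem isClopen_toFin {n : ℕ+} (D : Set (CFin n)) : IsClopen {γ : CInf | γ.toFin n ∈ D} :=
  (isClopen_discrete D).preimage (CInf.continuous_toFin n)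

/-! ### Measures on `𝒞` with prescribed rates. -/

section Existence

variable {ρ : ℝ≥0 → Measure CInf} [∀ s, IsFiniteMeasure (ρ s)] {q : (n : ℕ+) → CFin n → ℝ≥0∞}
  (hq : ∀ n x, x ≠ oneFin n → q n x ≠ ∞)
  (hlim : ∀ n x, x ≠ oneFin n → Tendsto (fun s : ℝ≥0 => ρ s {γ | γ.toFin n = x} / (s : ℝ≥0∞))
    (𝓝[>] 0) (𝓝 (q n x)))
include hq hlim

/-- On the clopen set `{γ_[N] ≠ 𝟏_N}` the measures `ρ s / s` have bounded mass as `s` tends to 0, so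
compactness of `𝒞` gives a weak limit point. Cylinders are clopen, so their indicators are
continuous and their masses converge. -/
theorem exists_measure_toFin_of_level (N : ℕ+) : ∃ ν : Measure CInf, IsFiniteMeasure ν ∧
    ∀ (n : ℕ+) (x : CFin n), {γ : CInf | γ.toFin n = x} ⊆ {γ | γ.toFin N ≠ oneFin N} →
      x ≠ oneFin n → ν {γ | γ.toFin n = x} = q n x := by
  let S : Set CInf := {γ | γ.toFin N ≠ oneFin N}
  have hS : MeasurableSet S := CInf.measurableSet_toFin {oneFin N}ᶜ
  let ν : ℝ≥0 → FiniteMeasure CInf := fun s => s⁻¹ • ⟨(ρ s).restrict S, inferInstance⟩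
  have hν : ∀ s : ℝ≥0, 0 < s → ∀ A, MeasurableSet A → A ⊆ S →
      (ν s : Measure CInf) A = ρ s A / (s : ℝ≥0∞) := by
    intro s hs A hA hAS
    have h1 : (ν s : Measure CInf) A = (s⁻¹ : ℝ≥0) • (ρ s).restrict S A := rfl
    rw [h1, Measure.restrict_apply hA, Set.inter_eq_left.2 hAS, ENNReal.smul_def, smul_eq_mul,
      ENNReal.coe_inv hs.ne', mul_comm, ENNReal.div_eq_inv_mul, mul_comm]
  have hmass0 : ∀ s : ℝ≥0, ((ν s).mass : ℝ≥0∞) = (ν s : Measure CInf) S := by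
    intro s
    rw [FiniteMeasure.ennreal_mass]
    have h1 : ∀ A, (ν s : Measure CInf) A = (s⁻¹ : ℝ≥0) • (ρ s).restrict S A := fun _ => rfl
    rw [h1, h1, Measure.restrict_apply_univ, Measure.restrict_apply_self]
  let L : ℝ≥0∞ := ∑ x ∈ ({oneFin N}ᶜ : Set (CFin N)).toFinite.toFinset, q N x
  have hL : L ≠ ∞ := ENNReal.sum_ne_top.2 fun x hx => hq N x (by simpa using hx)
  have hmasslim : Tendsto (fun s => ((ν s).mass : ℝ≥0∞)) (𝓝[>] 0) (𝓝 L) := by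
    have h1 : Tendsto (fun s : ℝ≥0 => ∑ x ∈ ({oneFin N}ᶜ : Set (CFin N)).toFinite.toFinset,
        ρ s {γ | γ.toFin N = x} / (s : ℝ≥0∞)) (𝓝[>] 0) (𝓝 L) :=
      tendsto_finsetSum _ fun x hx => hlim N x (by simpa using hx)
    refine h1.congr' ?_
    filter_upwards [self_mem_nhdsWithin] with s hs
    rw [hmass0, hν s hs S hS subset_rfl]
    simp only [ENNReal.div_eq_inv_mul, ← Finset.mul_sum]
    rw [← measure_toFin_mem]
    rfl
  have hmass : ∀ᶠ s in 𝓝[>] (0 : ℝ≥0), (ν s).mass ≤ (L + 1).toNNReal := by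
    have : ∀ᶠ s in 𝓝[>] (0 : ℝ≥0), ((ν s).mass : ℝ≥0∞) < L + 1 :=
      hmasslim.eventually (gt_mem_nhds (ENNReal.lt_add_right hL one_ne_zero))
    filter_upwards [this] with s hs
    rw [← ENNReal.coe_le_coe, ENNReal.coe_toNNReal (by simp [hL])]
    exact hs.le
  -- An ultrafilter finer than the right neighbourhoods of 0 gives convergence directly from
  -- compactness, with no extraction of subsequences.
  let U : Ultrafilter ℝ≥0 := Ultrafilter.of (𝓝[>] 0)
  have hU : (U : Filter ℝ≥0) ≤ 𝓝[>] 0 := Ultrafilter.of_le _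
  obtain ⟨ν₀, -, hν₀⟩ := (isCompact_setOfPred_finiteMeasure_le_of_compactSpace CInf
    (L + 1).toNNReal).ultrafilter_le_nhds' (U.map ν) (hU hmass)
  have hconv : Tendsto ν U (𝓝 ν₀) := hν₀
  refine ⟨ν₀, inferInstance, fun n x hx hx1 => ?_⟩
  have hclopen : IsClopen {γ : CInf | γ.toFin n = x} := isClopen_toFin {x}
  have hA : MeasurableSet {γ : CInf | γ.toFin n = x} := CInf.measurableSet_toFin {x}
  have h1 := FiniteMeasure.tendsto_iff_forall_integral_tendsto.1 hconv
    (BoundedContinuousFunction.indicator _ hclopen)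
  have h2 : ∀ ν : Measure CInf, ∫ γ, BoundedContinuousFunction.indicator _ hclopen γ ∂ν =
      ν.real {γ | γ.toFin n = x} := by
    intro ν
    have : (fun γ => BoundedContinuousFunction.indicator _ hclopen γ) =
        {γ : CInf | γ.toFin n = x}.indicator (fun _ => (1 : ℝ)) := by
      funext γ
      simp only [BoundedContinuousFunction.indicator_apply]
      rfl
    rw [this, integral_indicator hA]
    simp
  simp only [h2] at h1
  have h3 : Tendsto (fun s => (ν s : Measure CInf) {γ | γ.toFin n = x}) U
      (𝓝 ((ν₀ : Measure CInf) {γ | γ.toFin n = x})) := by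
    have := ENNReal.tendsto_ofReal h1
    rw [ofReal_measureReal] at this
    refine this.congr fun s => ?_
    exact ofReal_measureReal
  have h4 : Tendsto (fun s => (ν s : Measure CInf) {γ | γ.toFin n = x}) U (𝓝 (q n x)) := by
    refine ((hlim n x hx1).congr' ?_).mono_left hU
    filter_upwards [self_mem_nhdsWithin] with s hs
    exact (hν s hs _ hA hx).symm
  exact tendsto_nhds_unique h3 h4

/-- The measure with given values on cylinder sets, if these are limits of the values of
measures. -/
theorem exists_measure_toFin : ∃ μ : Measure CInf, μ {oneInf} = 0 ∧
    ∀ (n : ℕ+) (x : CFin n), x ≠ oneFin n → μ {γ | γ.toFin n = x} = q n x := by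
  classical
  choose ν hν1 hν2 using exists_measure_toFin_of_level hq hlim
  -- The complement of `𝟏_ℕ` is cut according to the first level at which a composition is
  -- non-trivial, and each piece receives the limit measure of its own level.
  let S : ℕ → Set CInf := fun k => {γ | γ.toFin k.succPNat ≠ oneFin k.succPNat}
  have hSm : ∀ k, MeasurableSet (S k) := fun k => CInf.measurableSet_toFin {oneFin k.succPNat}ᶜ
  let T : ℕ → Set CInf := disjointed S
  have hTm : ∀ k, MeasurableSet (T k) := fun k => MeasurableSet.disjointed hSm k
  have hTS : ∀ k, T k ⊆ S k := disjointed_subset S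
  have hTd : ∀ {j k}, j ≠ k → Disjoint (T j) (T k) := fun h => disjoint_disjointed S h
  refine ⟨Measure.sum fun k => (ν k.succPNat).restrict (T k), ?_, fun n x hx => ?_⟩
  · rw [Measure.sum_apply _ (measurableSet_singleton _)]
    refine ENNReal.tsum_eq_zero.2 fun k => ?_
    rw [Measure.restrict_apply (measurableSet_singleton _)]
    have : ({oneInf} : Set CInf) ∩ T k = ∅ := by
      rw [Set.singleton_inter_eq_empty]
      exact fun h => hTS k h rfl
    rw [this, measure_empty]
  · set A : Set CInf := {γ | γ.toFin n = x} with hA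
    have hAm : MeasurableSet A := CInf.measurableSet_toFin {x}
    -- Whether a composition is non-trivial at a level at most `n` is decided by its restriction to
    -- `[n]`. Hence a cylinder of level `n` with `x ≠ 𝟏_n` lies in a single piece.
    have hAk : ∀ k : ℕ, k.succPNat ≤ n → ∀ γ ∈ A, ∀ γ' ∈ A, γ ∈ S k → γ' ∈ S k := by
      intro k hk γ hγ γ' hγ' h
      change γ'.toFin k.succPNat ≠ _
      rw [← γ'.restrict_toFin hk, show γ'.toFin n = x from hγ', ← show γ.toFin n = x from hγ,
        γ.restrict_toFin hk]
      exact h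
    rw [Measure.sum_apply _ hAm]
    simp only [Measure.restrict_apply hAm]
    by_cases hne : A.Nonempty
    · obtain ⟨γ₀, hγ₀⟩ := hne
      have hex : ∃ k, γ₀ ∈ S k := ⟨n.natPred, by
        change γ₀.toFin n.natPred.succPNat ≠ _
        rw [PNat.succPNat_natPred, show γ₀.toFin n = x from hγ₀]
        exact hx⟩
      have hkn : (Nat.find hex).succPNat ≤ n := by
        rw [← PNat.coe_le_coe, Nat.succPNat_coe, Nat.succ_le_iff]
        have h1 : Nat.find hex ≤ n.natPred := Nat.find_min' hex (by
          change γ₀.toFin n.natPred.succPNat ≠ _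
          rw [PNat.succPNat_natPred, show γ₀.toFin n = x from hγ₀]
          exact hx)
        have h2 := PNat.natPred_add_one n
        omega
      set k₀ := Nat.find hex with hk₀
      have hAT : A ⊆ T k₀ := by
        intro γ hγ
        have h1 : γ ∈ S k₀ := hAk k₀ hkn γ₀ hγ₀ γ hγ (Nat.find_spec hex)
        have h2 : ∀ j < k₀, γ ∉ S j := fun j hj h => by
          have hjn : j.succPNat ≤ n := (Nat.succPNat_le_succPNat.2 hj.le).trans hkn
          exact Nat.find_min hex hj (hAk j hjn γ hγ γ₀ hγ₀ h)
        change γ ∈ disjointed S k₀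
        rw [disjointed_eq_inter_compl]
        exact ⟨h1, Set.mem_iInter₂.2 h2⟩
      rw [tsum_eq_single k₀, Set.inter_eq_left.2 hAT]
      · exact hν2 _ n x (hAT.trans (hTS k₀)) hx
      · intro k hk
        have : A ∩ T k = ∅ := by
          refine Set.eq_empty_of_forall_notMem fun γ hγ => ?_
          exact Set.disjoint_left.1 (hTd hk) hγ.2 (hAT hγ.1)
        rw [this, measure_empty]
    -- If the cylinder is empty, the measure of level `n` shows that the prescribed value is 0; no
    -- extension of `x` to `ℕ` is needed.
    · rw [Set.not_nonempty_iff_eq_empty] at hne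
      have h0 : ν n A = q n x := hν2 n n x (by rw [← hA, hne]; exact Set.empty_subset _) hx
      rw [hne, measure_empty] at h0
      simp [hne, ← h0]

end Existence

/-! ### Laws of processes -/

/-- The sets of paths defined by finitely many conditions on the restrictions to some `[n]`. -/
def pathCylinders : Set (Set (ℝ≥0 → CInf)) :=
  {A | ∃ (n : ℕ+) (I : Finset ℝ≥0) (D : ℝ≥0 → Set (CFin n)),
    A = {f | ∀ t ∈ I, (f t).toFin n ∈ D t}}

theorem isPiSystem_pathCylinders : IsPiSystem pathCylinders := by
  rintro _ ⟨n, I, D, rfl⟩ _ ⟨m, J, D', rfl⟩ -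
  refine ⟨max n m, I ∪ J, fun t => {x | (t ∈ I → x.restrict (seg_subset (le_max_left n m)) ∈ D t) ∧
    (t ∈ J → x.restrict (seg_subset (le_max_right n m)) ∈ D' t)}, ?_⟩
  ext f
  simp only [Set.mem_inter_iff, Set.mem_ofPred_eq, Finset.mem_union,
    CInf.restrict_toFin _ (le_max_left n m), CInf.restrict_toFin _ (le_max_right n m)]
  constructor
  · rintro ⟨h1, h2⟩ t -
    exact ⟨h1 t, h2 t⟩
  · intro h
    exact ⟨fun t ht => (h t (.inl ht)).1 ht, fun t ht => (h t (.inr ht)).2 ht⟩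

theorem generateFrom_pathCylinders :
    (MeasurableSpace.pi : MeasurableSpace (ℝ≥0 → CInf)) =
      MeasurableSpace.generateFrom pathCylinders := by
  refine le_antisymm ?_ ?_
  · refine iSup_le fun t => ?_
    change MeasurableSpace.comap (fun f : ℝ≥0 → CInf => f t) (inferInstance : MeasurableSpace CInf)
      ≤ _
    rw [generateFrom_cylinders, MeasurableSpace.comap_generateFrom]
    refine MeasurableSpace.generateFrom_le ?_
    rintro _ ⟨_, ⟨n, D, rfl⟩, rfl⟩
    refine MeasurableSpace.measurableSet_generateFrom ⟨n, {t}, fun _ => D, ?_⟩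
    ext f; simp
  · refine MeasurableSpace.generateFrom_le ?_
    rintro _ ⟨n, I, D, rfl⟩
    have : {f : ℝ≥0 → CInf | ∀ t ∈ I, (f t).toFin n ∈ D t} =
        ⋂ t ∈ I, {f | (f t).toFin n ∈ D t} := by ext f; simp
    rw [this]
    exact Finset.measurableSet_biInter I fun t _ =>
      ((CInf.measurable_toFin n).comp (measurable_pi_apply t)) (MeasurableSet.of_discrete (s := D t))

theorem measurable_path {Ω : Type*} [MeasurableSpace Ω] {Γ : ℝ≥0 → Ω → CInf}
    (h : ∀ t, Measurable (Γ t)) : Measurable fun ω t => Γ t ω := measurable_pi_lambda _ h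

/-- The law of a process is determined by the finite-dimensional distributions of its
restrictions. -/
theorem processLaw_eq {Ω Ω' : Type u} [MeasurableSpace Ω] [MeasurableSpace Ω'] {P : Measure Ω}
    {P' : Measure Ω'} [IsProbabilityMeasure P] [IsProbabilityMeasure P'] {Γ : ℝ≥0 → Ω → CInf}
    {Γ' : ℝ≥0 → Ω' → CInf} (hΓ : ∀ t, Measurable (Γ t)) (hΓ' : ∀ t, Measurable (Γ' t))
    (h : ∀ (n : ℕ+) (I : Finset ℝ≥0) (γ : ℝ≥0 → CFin n),
      P.real {ω | ∀ t ∈ I, (Γ t ω).toFin n = γ t} =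
        P'.real {ω | ∀ t ∈ I, (Γ' t ω).toFin n = γ t}) :
    processLaw Γ P = processLaw Γ' P' := by
  have _ : IsProbabilityMeasure (processLaw Γ P) :=
    Measure.isProbabilityMeasure_map (measurable_path hΓ).aemeasurable
  have _ : IsProbabilityMeasure (processLaw Γ' P') :=
    Measure.isProbabilityMeasure_map (measurable_path hΓ').aemeasurable
  refine ext_of_generate_finite pathCylinders generateFrom_pathCylinders isPiSystem_pathCylinders
    ?_ (by simp)
  rintro _ ⟨n, I, D, rfl⟩
  have hm : ∀ {Ω : Type u} [MeasurableSpace Ω] {Γ : ℝ≥0 → Ω → CInf}, (∀ t, Measurable (Γ t)) →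
      Measurable fun ω (t : I) => (Γ t ω).toFin n := fun hΓ =>
    measurable_pi_lambda _ fun t => (CInf.measurable_toFin n).comp (hΓ t)
  have key : P.map (fun ω (t : I) => (Γ t ω).toFin n) =
      P'.map (fun ω (t : I) => (Γ' t ω).toFin n) := by
    have _ := Measure.isProbabilityMeasure_map (μ := P) (hm hΓ).aemeasurable
    have _ := Measure.isProbabilityMeasure_map (μ := P') (hm hΓ').aemeasurable
    refine Measure.ext_of_singleton fun γ => ?_
    rw [← ENNReal.toReal_eq_toReal_iff' (measure_ne_top _ _) (measure_ne_top _ _),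
      Measure.map_apply (hm hΓ) (measurableSet_singleton γ),
      Measure.map_apply (hm hΓ') (measurableSet_singleton γ)]
    -- The value given to times outside `I` plays no role.
    have h1 := h n I fun t => if ht : t ∈ I then γ ⟨t, ht⟩ else oneFin n
    have e : ∀ {Ω : Type u} (Γ : ℝ≥0 → Ω → CInf),
        {ω | ∀ t ∈ I, (Γ t ω).toFin n = if ht : t ∈ I then γ ⟨t, ht⟩ else oneFin n} =
          (fun ω (t : I) => (Γ t ω).toFin n) ⁻¹' {γ} := by
      intro Ω Γ
      ext ω
      simp only [Set.mem_ofPred_eq, Set.mem_preimage, Set.mem_singleton_iff, funext_iff,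
        Subtype.forall]
      exact forall_congr' fun t => forall_congr' fun ht => by rw [dif_pos ht]
    rw [e, e] at h1
    exact h1
  have hD : MeasurableSet {x : I → CFin n | ∀ t : I, x t ∈ D t} := MeasurableSet.of_discrete
  have hcyl : MeasurableSet {f : ℝ≥0 → CInf | ∀ t ∈ I, (f t).toFin n ∈ D t} := by
    rw [generateFrom_pathCylinders]
    exact MeasurableSpace.measurableSet_generateFrom ⟨n, I, D, rfl⟩
  have h2 := congrArg (fun ν : Measure (I → CFin n) => ν {x | ∀ t : I, x t ∈ D t}) key
  simp only [Measure.map_apply (hm hΓ) hD, Measure.map_apply (hm hΓ') hD] at h2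
  rw [processLaw, processLaw, Measure.map_apply (measurable_path hΓ) hcyl,
    Measure.map_apply (measurable_path hΓ') hcyl]
  simpa [Set.preimage] using h2


/-! ### The measure of a c-fragmentation -/

section

variable {Ω : Type u} [MeasurableSpace Ω] {P : Measure Ω} {Γ : ℝ≥0 → Ω → CInf} {μ : Measure CInf}

/-- The rates are one-sided derivatives at 0 of the laws of the restrictions; positivity and
exchangeability off the one-block composition pass to the limit. -/
theorem IsCFragmentation.exists_rates [IsProbabilityMeasure P] (h : IsCFragmentation Γ P) :
    ∃ q : (n : ℕ+) → CFin n → ℝ, (∀ n, ∑ x, q n x = 0) ∧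
      (∀ n, IsChain (fun t ω => (Γ t ω).toFin n) P (q n)) ∧
      (∀ n x, x ≠ oneFin n → 0 ≤ q n x) ∧
      (∀ n x, x ≠ oneFin n → Tendsto (fun s : ℝ≥0 => P {ω | (Γ s ω).toFin n = x} / (s : ℝ≥0∞))
        (𝓝[>] 0) (𝓝 (ENNReal.ofReal (q n x)))) ∧
      ∀ n (σ : Equiv.Perm (seg n)) x, x ≠ oneFin n → q n (x.perm σ) = q n x := by
  choose q hq0 hq hqd hqp using fun n => (h.restrict n).exists_isChain
  have hc : Tendsto (fun s : ℝ≥0 => (s : ℝ)) (𝓝[>] 0) (𝓝[>] 0) := by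
    refine tendsto_nhdsWithin_iff.2 ⟨?_, ?_⟩
    · exact (NNReal.continuous_coe.tendsto 0).mono_left nhdsWithin_le_nhds
    · filter_upwards [self_mem_nhdsWithin] with s hs
      exact NNReal.coe_pos.2 hs
  have hlim : ∀ n x, x ≠ oneFin n → Tendsto (fun s : ℝ≥0 => P.real {ω | (Γ s ω).toFin n = x} / s)
      (𝓝[>] 0) (𝓝 (q n x)) := by
    intro n x hx
    have h1 := hqd n x
    rw [hasDerivWithinAt_iff_tendsto_slope' (by simp)] at h1
    have h0 : P.real {ω | (Γ 0 ω).toFin n = x} = 0 := by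
      rw [(hq n).real_eq 0 x, NNReal.coe_zero, chain_zero, Matrix.one_apply_ne (Ne.symm hx)]
    refine (h1.comp hc).congr fun s => ?_
    simp only [Function.comp]
    rw [slope_def_field, Real.toNNReal_coe, Real.toNNReal_zero, h0, sub_zero, sub_zero]
  refine ⟨q, hq0, hq, fun n x hx => ?_, fun n x hx => ?_, fun n σ x hx => ?_⟩
  · exact ge_of_tendsto' (hlim n x hx) fun s => by positivity
  · refine (ENNReal.tendsto_ofReal (hlim n x hx)).congr' ?_
    filter_upwards [self_mem_nhdsWithin] with s hs
    rw [ENNReal.ofReal_div_of_pos (NNReal.coe_pos.2 hs), ofReal_measureReal,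
      ENNReal.ofReal_coe_nnreal]
  · refine tendsto_nhds_unique (hlim n _ fun h => hx (perm_eq_oneFin.1 h))
      ((hlim n x hx).congr' ?_)
    filter_upwards [self_mem_nhdsWithin] with s hs
    rw [hqp n s hs σ x]

/-- A measure of a c-fragmentation is a fragmentation measure, and its rates are those of the
restrictions of the c-fragmentation. -/
theorem HasFragMeasure.isFragMeasure_and_isChain [IsProbabilityMeasure P]
    (hμ : HasFragMeasure Γ P μ) (h : IsCFragmentation Γ P) :
    IsFragMeasure μ ∧ ∀ n, IsChain (fun t ω => (Γ t ω).toFin n) P (rates μ n) := by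
  obtain ⟨q, hq0, hq, hqn, hqlim, -⟩ := h.exists_rates
  have hval : ∀ n x, x ≠ oneFin n → μ {γ | γ.toFin n = x} = ENNReal.ofReal (q n x) :=
    fun n x hx => tendsto_nhds_unique (hμ.rate n x hx) (hqlim n x hx)
  refine ⟨⟨hμ.exchangeable, hμ.one_eq_zero, fun n =>
    measure_toFin_ne_lt_top fun x hx => ?_⟩, fun n => ?_⟩
  · rw [hval n x hx]; exact ENNReal.ofReal_ne_top
  · have hne : ∀ x, x ≠ oneFin n → rates μ n x = q n x := fun x hx => by
      rw [rates_of_ne μ hx, measureReal_def, hval n x hx, ENNReal.toReal_ofReal (hqn n x hx)]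
    -- The two families agree off `𝟏_n` and both sum to 0, so they also agree at `𝟏_n`.
    have : rates μ n = q n := by
      classical
      funext x
      by_cases hx : x = oneFin n
      · have h1 := sum_rates μ n
        rw [← hq0 n, ← Finset.add_sum_erase _ _ (Finset.mem_univ (oneFin n)),
          ← Finset.add_sum_erase _ _ (Finset.mem_univ (oneFin n)),
          Finset.sum_congr rfl fun y hy => hne y (Finset.ne_of_mem_erase hy)] at h1
        rw [hx]
        exact add_right_cancel h1
      · exact hne x hx
    rw [this]
    exact hq n

theorem HasFragMeasure.unique {μ' : Measure CInf} [IsProbabilityMeasure P]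
    (hμ : HasFragMeasure Γ P μ) (hμ' : HasFragMeasure Γ P μ') (h : IsCFragmentation Γ P) :
    μ = μ' :=
  measure_ext_of_toFin hμ.one_eq_zero hμ'.one_eq_zero
    (fun _ _ hx => ((hμ.isFragMeasure_and_isChain h).1.lt_top_of_ne hx).ne)
    fun n x hx => tendsto_nhds_unique (hμ.rate n x hx) (hμ'.rate n x hx)

/-- Apply `exists_measure_toFin` to the laws of `Γ s`, whose cylinder masses divided by `s` converge
to the rates. -/
theorem IsCFragmentation.exists_hasFragMeasure [IsProbabilityMeasure P]
    (h : IsCFragmentation Γ P) : ∃ μ, HasFragMeasure Γ P μ := by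
  obtain ⟨q, -, -, -, hqlim, hqp⟩ := h.exists_rates
  have hev : ∀ (s : ℝ≥0) n (x : CFin n),
      P.map (Γ s) {γ | γ.toFin n = x} = P {ω | (Γ s ω).toFin n = x} := fun s n x =>
    Measure.map_apply (h.measurable s) (CInf.measurableSet_toFin {x})
  have _ : ∀ s, IsFiniteMeasure (P.map (Γ s)) := fun s => inferInstance
  obtain ⟨μ, hμ0, hμ⟩ := exists_measure_toFin (ρ := fun s => P.map (Γ s))
    (q := fun n x => ENNReal.ofReal (q n x)) (fun _ _ _ => ENNReal.ofReal_ne_top)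
    (by simpa only [hev] using hqlim)
  refine ⟨μ, ⟨fun n σ γ => ?_, hμ0, fun n x hx => by rw [hμ n x hx]; exact hqlim n x hx⟩⟩
  have e : ∀ δ : CFin n, δ.perm σ = γ ↔ δ = γ.perm σ⁻¹ := by
    intro δ
    constructor
    · rintro rfl
      rw [← Comp.perm_mul, inv_mul_cancel, Comp.perm_one]
    · rintro rfl
      rw [← Comp.perm_mul, mul_inv_cancel, Comp.perm_one]
  simp only [e]
  by_cases hγ : γ = oneFin n
  -- The mass of this cylinder is not among the prescribed values, but permutations fix the
  -- one-block composition, so both sides are the same cylinder.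
  · rw [perm_eq_oneFin.2 hγ, hγ]
  · rw [hμ n γ hγ, hμ n _ fun h => hγ (perm_eq_oneFin.1 h), hqp n _ γ hγ]

/-- The measure of a c-fragmentation is a function of its law. -/
theorem hasFragMeasure_processLaw_iff (hΓ : ∀ t, Measurable (Γ t)) :
    HasFragMeasure (fun t f => f t) (processLaw Γ P) μ ↔ HasFragMeasure Γ P μ := by
  have hev : ∀ (s : ℝ≥0) n (x : CFin n),
      processLaw Γ P {f | (f s).toFin n = x} = P {ω | (Γ s ω).toFin n = x} := fun s n x =>
    Measure.map_apply (measurable_path hΓ)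
      (s := {f : ℝ≥0 → CInf | (f s).toFin n = x})
      ((CInf.measurable_toFin n).comp (measurable_pi_apply s) (measurableSet_singleton x))
  constructor
  · rintro ⟨h1, h2, h3⟩
    exact ⟨h1, h2, by simpa only [hev] using h3⟩
  · rintro ⟨h1, h2, h3⟩
    exact ⟨h1, h2, by simpa only [hev] using h3⟩

/-- The measure of a c-fragmentation determines its law. -/
theorem processLaw_eq_of_hasFragMeasure {Ω' : Type u} [MeasurableSpace Ω'] {P' : Measure Ω'}
    [IsProbabilityMeasure P] [IsProbabilityMeasure P'] {Γ' : ℝ≥0 → Ω' → CInf}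
    (h : IsCFragmentation Γ P) (h' : IsCFragmentation Γ' P') (hμ : HasFragMeasure Γ P μ)
    (hμ' : HasFragMeasure Γ' P' μ) : processLaw Γ P = processLaw Γ' P' :=
  processLaw_eq h.measurable h'.measurable fun n I γ =>
    ((hμ.isFragMeasure_and_isChain h).2 n).fdd_eq ((hμ'.isFragMeasure_and_isChain h').2 n) I γ

end

/-- The measure of the c-fragmentations with a given law. -/
theorem IsCFragLaw.exists_measure {Q : Measure (ℝ≥0 → CInf)} (hQ : IsCFragLaw.{u} Q) :
    ∃ μ, IsFragMeasure μ ∧ ∀ (Ω : Type u) [MeasurableSpace Ω] (P : Measure Ω)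
      [IsProbabilityMeasure P] (Γ : ℝ≥0 → Ω → CInf), IsCFragmentation Γ P → processLaw Γ P = Q →
      ∀ μ' : Measure CInf, HasFragMeasure Γ P μ' ↔ μ' = μ := by
  obtain ⟨Ω, _, P, Γ, _, h, rfl⟩ := hQ
  obtain ⟨μ, hμ⟩ := h.exists_hasFragMeasure
  refine ⟨μ, (hμ.isFragMeasure_and_isChain h).1, fun Ω' _ P' _ Γ' h' hQ μ' => ?_⟩
  have hμ' : HasFragMeasure Γ' P' μ := by
    rw [← hasFragMeasure_processLaw_iff h'.measurable, hQ]
    exact (hasFragMeasure_processLaw_iff h.measurable).2 hμ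
  exact ⟨fun h1 => h1.unique hμ' h', fun h1 => h1 ▸ hμ'⟩

/-- The bijection between the laws of c-fragmentations and the fragmentation measures, given that
each fragmentation measure is the measure of a c-fragmentation. -/
theorem exists_equiv_fragMeasure
    (hex : ∀ μ : Measure CInf, IsFragMeasure μ → ∃ (Ω : Type u) (_ : MeasurableSpace Ω)
      (P : Measure Ω) (Γ : ℝ≥0 → Ω → CInf), IsProbabilityMeasure P ∧ IsCFragmentation Γ P ∧
        HasFragMeasure Γ P μ) :
    ∃ Φ : {Q : Measure (ℝ≥0 → CInf) // IsCFragLaw.{u} Q} ≃ {μ : Measure CInf // IsFragMeasure μ},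
      ∀ (Ω : Type u) [MeasurableSpace Ω] (P : Measure Ω) [IsProbabilityMeasure P]
        (Γ : ℝ≥0 → Ω → CInf), IsCFragmentation Γ P → ∀ Q, processLaw Γ P = Q.1 →
          ∀ μ : Measure CInf, HasFragMeasure Γ P μ ↔ μ = (Φ Q).1 := by
  choose φ hφ hφ' using fun Q : {Q : Measure (ℝ≥0 → CInf) // IsCFragLaw.{u} Q} =>
    Q.2.exists_measure
  refine ⟨Equiv.ofBijective (fun Q => ⟨φ Q, hφ Q⟩) ⟨?_, ?_⟩,
    fun Ω _ P _ Γ h Q hQ => hφ' Q Ω P Γ h hQ⟩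
  -- Injectivity: two c-fragmentations with the same measure have the same rates at every level,
  -- hence the same law.
  · rintro ⟨Q, hQ⟩ ⟨Q', hQ'⟩ he
    have he' : φ ⟨Q, hQ⟩ = φ ⟨Q', hQ'⟩ := congrArg Subtype.val he
    obtain ⟨Ω, _, P, Γ, _, h, hPQ⟩ := id hQ
    obtain ⟨Ω', _, P', Γ', _, h', hPQ'⟩ := id hQ'
    have h1 := (hφ' ⟨Q, hQ⟩ Ω P Γ h hPQ _).2 rfl
    have h2 := (hφ' ⟨Q', hQ'⟩ Ω' P' Γ' h' hPQ' _).2 he'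
    exact Subtype.ext (hPQ.symm.trans ((processLaw_eq_of_hasFragMeasure h h' h1 h2).trans hPQ'))
  · rintro ⟨μ, hμ⟩
    obtain ⟨Ω, _, P, Γ, _, h, h1⟩ := hex μ hμ
    refine ⟨⟨processLaw Γ P, Ω, _, P, Γ, ‹_›, h, rfl⟩, Subtype.ext ?_⟩
    exact ((hφ' _ Ω P Γ h rfl μ).1 h1).symm

end CFrag

end

theorem proposition4p2 :
    -- the Poissonian construction
    (∀ μ : Measure CFrag.CInf, CFrag.IsFragMeasure μ →
      (∃ (Ω : Type u) (_ : MeasurableSpace Ω) (P : Measure Ω) (M : Ω → Measure CFrag.Marks),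
        IsProbabilityMeasure P ∧ CFrag.IsPoissonMeasure M (CFrag.intensity μ) P) ∧
      ∀ (Ω : Type u) [MeasurableSpace Ω] (P : Measure Ω) [IsProbabilityMeasure P]
        (M : Ω → Measure CFrag.Marks), CFrag.IsPoissonMeasure M (CFrag.intensity μ) P →
        (∀ᵐ ω ∂P, (∀ n, ∃! f, CFrag.IsPoissonPathFin (M ω) n f) ∧
          ∃! f, CFrag.IsPoissonPath (M ω) f) ∧
        (∃ Γ, CFrag.IsPoissonConstruction Γ M P) ∧
        ∀ Γ, CFrag.IsPoissonConstruction Γ M P →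
          CFrag.IsCFragmentation Γ P ∧ CFrag.HasFragMeasure Γ P μ) ∧
    -- the bijection between laws of c-fragmentations and fragmentation measures
    (∃ Φ : {Q : Measure (ℝ≥0 → CFrag.CInf) // CFrag.IsCFragLaw.{u} Q} ≃
          {μ : Measure CFrag.CInf // CFrag.IsFragMeasure μ},
      ∀ (Ω : Type u) [MeasurableSpace Ω] (P : Measure Ω) [IsProbabilityMeasure P]
        (Γ : ℝ≥0 → Ω → CFrag.CInf), CFrag.IsCFragmentation Γ P →
        ∀ Q, CFrag.processLaw Γ P = Q.1 →
          ∀ μ : Measure CFrag.CInf, CFrag.HasFragMeasure Γ P μ ↔ μ = (Φ Q).1) := by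
  have hM : ∀ μ : Measure CFrag.CInf, CFrag.IsFragMeasure μ →
      ∃ (Ω : Type u) (_ : MeasurableSpace Ω) (P : Measure Ω) (M : Ω → Measure CFrag.Marks),
        IsProbabilityMeasure P ∧ CFrag.IsPoissonMeasure M (CFrag.intensity μ) P := by
    intro μ hμ
    have := hμ.sigmaFinite
    have := CFrag.sFinite_intensity (μ := μ)
    have : Nonempty CFrag.Marks := ⟨(0, CFrag.oneInf, 1)⟩
    exact CFrag.exists_isPoissonMeasure _
  refine ⟨fun μ hμ => ⟨hM μ hμ, ?_⟩, CFrag.exists_equiv_fragMeasure fun μ hμ => ?_⟩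
  · intro Ω _ P _ M hM
    refine ⟨CFrag.ae_existsUnique_path hμ hM, CFrag.exists_isPoissonConstruction hμ hM,
      fun Γ hΓ => ?_⟩
    have h := hΓ.hasTransitions hμ hM
    exact ⟨h.isCFragmentation hμ.exchangeable, h.hasFragMeasure hμ⟩
  · obtain ⟨Ω, _, P, M, _, hM⟩ := hM μ hμ
    obtain ⟨Γ, hΓ⟩ := CFrag.exists_isPoissonConstruction hμ hM
    have h := hΓ.hasTransitions hμ hM
    exact ⟨Ω, _, P, Γ, ‹_›, h.isCFragmentation hμ.exchangeable, h.hasFragMeasure hμ⟩
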